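/- Let $m\ge 0$, $n=2^m$, and let $Sp(2n)=\{U\in U(2n): U\Delta U^{t}=\Delta\}$ with $\Delta=\begin{pmatrix}0&-\mathbb 1\\ \mathbb 1&0\end{pmatrix}$ acting on the virtual space $\mathbb C^{2n}=(\mathbb C^2)^{\otimes m}\otimes\mathbb C^2$ of $m+1$ qubits (the last factor labels the two blocks of $\Delta$). The $Sp(2n)$ AKLT state on $N$ sites with input $|L\rangle\in\mathbb C^{2n}$ is the valence-bond state in which every site carries two virtual spins $\mathbb C^{2n}$, the left virtual spin of the first site is in the state $|L\rangle$, the right virtual spin of each site forms the singlet $\frac1{\sqrt{2n}}\sum_{a,b}\Delta_{ab}|a\rangle|b\rangle$ with the left virtual spin of the next site (for the last site: with a free edge spin), and the two virtual spins of each site are projected onto $\mathrm{Sym}^2(\mathbb C^{2n})$. An element $g\in Sp(2n)$ acts on a site by $U(g)=g\otimes g$. Call a tensor product of $m$ matrices from $\{\mathbb 1,X,Y,Z\}$ of type $\mathcal Y$ if it has an odd number of factors $Y$, of type $\mathcal X$ if it has an even number of factors $Y$ and is not diagonal, and of type $\mathcal Z$ if it is diagonal and not the identity. Let $\{N_a\}$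 be the family of all $A\otimes\sigma_k$ with $A$ of type $\mathcal X$ or $\mathcal Z$ or $A=\mathbb 1$ and $\sigma_k\in\{X,Y,Z\}$, and all $A\otimes\mathbb 1_2$ with $A$ of type $\mathcal Y$. Then the following holds. 1. (Representations.) The on-site space $\mathrm{Sym}^2(\mathbb C^{2n})$ has dimension $n(2n+1)$. The AKLT state is a matrix product state on the virtual space $\mathbb C^{2n}$: projecting the sites onto $s_1,\dots,s_N\in \mathrm{Sym}^2(\mathbb C^{2n})$, regarded as symmetric matrices, leaves the edge spin in the state $K(s_N)\cdots K(s_1)|L\rangle$ with $K(s)=-\frac1{\sqrt{2n}}\Delta\bar s$. The map $K$ is a bijection onto $\mathfrak{sp}(2n,\mathbb C)$, and $K(U(g)s)=gK(s)g^\dagger$ for $g\in Sp(2n)$, so the sites carry the adjoint representation. 2. (Pauli generators.) The real spans of the Pauli strings of types $\mathcal X,\mathcal Y,\mathcal Z$ are those of the generalized Gell-Mann matrices $X_{ij}=\frac12(E_{ij}+E_{ji})$, $Y_{ij}=\frac{-i}2(E_{ij}-E_{ji})$ $(i<j)$ and $Z_j=\frac1{\sqrt{2j(j-1)}}\bigl(\sum_{\ell<j}E_{\ell\ell}-(j-1)E_{jj}\bigr)$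 $(2\le j\le n)$ of $SU(n)$, respectively. There are $n(2n+1)$ operators $N_a$. The on-site vectors $|a\rangle=\frac1{\sqrt{2n}}\overline{\Delta N_a}$ form an orthonormal basis of the on-site space, in which the Kraus operators are $K(|a\rangle)=\frac1{2n}N_a$. For $g\in Sp(2n)$ the matrix $u_{ab}(g)=\mathrm{tr}(N_a^\dagger gN_bg^\dagger)/2n$ is unitary, $\langle a|U(g)=\sum_b u_{ab}(g)\langle b|$, and $\sum_b u_{ab}(g)N_b=g^\dagger N_ag$. 3. (Counts.) A string of type $\mathcal X$ commutes with exactly $n^2/4$ strings of type $\mathcal X$, $n^2/4-n/2$ of type $\mathcal Y$, and $n/2-1$ of type $\mathcal Z$. A string of type $\mathcal Y$ commutes with exactly $n^2/4$ strings of type $\mathcal Y$, $n^2/4-n/2$ of type $\mathcal X$, and $n/2-1$ of type $\mathcal Z$. A string of type $\mathcal Z$ commutes with exactly $n^2/4-n/2$ strings of each of the types $\mathcal X$ and $\mathcal Y$. 4. (Success probability.) Let the sites be measured one after the other in orthonormal bases with bras $\langle a|U(g)$, $g\in Sp(2n)$, where $g$ may depend on the earlier outcomes, on a nonzero input. Every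 string of $N$ outcomes has Born probability $(n(2n+1))^{-N}$. Let $\sin\theta\ne0$, and let a site be measured with $g=e^{-i(\theta/2)N_a}$. The outcome $b$ executes on the virtual space the operator $\frac{1}{2n}g^\dagger N_b g$, which is proportional to $N_be^{-i\theta N_a}$ (the gate $e^{-i\theta N_a}$ with byproduct $N_b$: success) if and only if $N_b$ anticommutes with $N_a$, and equals $\frac1{2n}N_b$ (identity up to byproduct) otherwise. Given any earlier outcomes, the probability of success is $\dfrac{n+1}{2n+1}$. 5. (Gate set.) The gates that can be executed in this way, up to a phase and a Pauli byproduct, form $Sp(2n)$. That is: the gates $e^{-i\theta N_a}$ generate $Sp(2n)$; for each $V\in Sp(2n)$ there is an adaptive rule, which measures every site in a basis rotated by some $e^{-i\theta N_a}$, such that for every nonzero input the probability that the operator induced by the first $N$ outcomes is $cBV$, with $c\ne0$ and $B$ a tensor product of Pauli matrices, tends to $1$ as $N\to\infty$; and if, under any adaptive rule with bases rotated by elements of $Sp(2n)$, some outcomes induce $cBV$ with $c\neq 0$, $B$ a tensor product of Pauli matrices and $V$ unitary, then $zV\in Sp(2n)$ for some phase $z$. -/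

import Mathlib

open Matrix Filter Topology

noncomputable section

namespace SpAKLT

/-! ## The compact symplectic group, and the valence-bond-solid state it defines

The virtual space is `ℂ^{2n}`, with index type `l ⊕ l`, `n = |l|`. The symplectic form is
`Matrix.J l ℂ = [[0, -1], [1, 0]]`. -/

section VBS

variable (l : Type) [Fintype l] [DecidableEq l]

/-- `Sp(2n) = U(2n) ∩ Sp(2n, ℂ)`. -/
def CSp : Submonoid (Matrix (l ⊕ l) (l ⊕ l) ℂ) :=
  Matrix.unitaryGroup (l ⊕ l) ℂ ⊓ Matrix.symplecticGroup l ℂ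

/-- The normalized `Sp(2n)`-singlet of two virtual spins; the entry `(a, b)` of the matrix is the
coefficient of `|a⟩|b⟩`. -/
def singlet : Matrix (l ⊕ l) (l ⊕ l) ℂ :=
  ((Real.sqrt (Fintype.card (l ⊕ l)) : ℂ))⁻¹ • Matrix.J l ℂ

/-- The on-site space `Sym²(ℂ^{2n})`, inside the space of two virtual spins (a matrix `s` stands
for `∑ s a b |a⟩|b⟩`). -/
def onSite : Submodule ℂ (Matrix (l ⊕ l) (l ⊕ l) ℂ) where
  carrier := {s | sᵀ = s}
  add_mem' := by
    intro a b ha hb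
    simp only [Set.mem_ofPred_eq] at ha hb ⊢
    rw [Matrix.transpose_add, ha, hb]
  zero_mem' := by simp
  smul_mem' := by
    intro c a ha
    simp only [Set.mem_ofPred_eq] at ha ⊢
    rw [Matrix.transpose_smul, ha]

variable {l}

/-- The on-site action `g ⊗ g` of `g` on two virtual spins. -/
def siteSym (g s : Matrix (l ⊕ l) (l ⊕ l) ℂ) : Matrix (l ⊕ l) (l ⊕ l) ℂ := g * s * gᵀ

/-- `N` sites with two virtual spins each, followed by one edge spin, before the on-site
projection. The left spin of the first site is in the state `L`; the right spin of every site is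
in a singlet with the left spin of the next one, and that of the last site with the edge spin. -/
def bonds (N : ℕ) (L : l ⊕ l → ℂ) (x : Fin N → (l ⊕ l) × (l ⊕ l)) (e : l ⊕ l) : ℂ :=
  let left : Fin (N + 1) → l ⊕ l := Fin.snoc (fun k => (x k).1) e
  L (left 0) * ∏ k : Fin N, singlet l (x k).2 (left k.succ)

/-- The `Sp(2n)` AKLT state with input `L` (not normalized): the two spins of every site are
projected onto the symmetric subspace `Sym²(ℂ^{2n})`, by averaging over the swaps. -/
def aklt (N : ℕ) (L : l ⊕ l → ℂ) (x : Fin N → (l ⊕ l) × (l ⊕ l)) (e : l ⊕ l) : ℂ :=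
  (1 / 2 : ℂ) ^ N *
    ∑ τ : Fin N → Bool, bonds N L (fun k => if τ k then (x k).swap else x k) e

/-- The (unnormalized) state of the edge spin after projection of the sites onto the on-site
vectors `s 0, …, s (N - 1)`. -/
def contract {N : ℕ} (s : Fin N → Matrix (l ⊕ l) (l ⊕ l) ℂ)
    (Ψ : (Fin N → (l ⊕ l) × (l ⊕ l)) → l ⊕ l → ℂ) (e : l ⊕ l) : ℂ :=
  ∑ x : Fin N → (l ⊕ l) × (l ⊕ l),
    (∏ k, starRingEnd ℂ (s k (x k).1 (x k).2)) * Ψ x e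

/-- The operator on the virtual space induced by projection of one site onto the on-site
vector `s`. -/
def krausOp (s : Matrix (l ⊕ l) (l ⊕ l) ℂ) : Matrix (l ⊕ l) (l ⊕ l) ℂ :=
  -((Real.sqrt (Fintype.card (l ⊕ l)) : ℂ))⁻¹ • (Matrix.J l ℂ * s.map (starRingEnd ℂ))

/-- `A ⊗ σ`, where the last tensor factor `ℂ²` labels the two blocks of `l ⊕ l`. -/
def tensorLast (A : Matrix l l ℂ) (σ : Matrix (Fin 2) (Fin 2) ℂ) : Matrix (l ⊕ l) (l ⊕ l) ℂ :=
  Matrix.fromBlocks (σ 0 0 • A) (σ 0 1 • A) (σ 1 0 • A) (σ 1 1 • A)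

end VBS

/-! ## Pauli strings and generators -/

/-- Computational basis states of `m` qubits; there are `2 ^ m` of them. -/
abbrev Qubits (m : ℕ) : Type := Fin m → Fin 2

/-- `𝟙, X, Y, Z`. -/
def pauli : Fin 4 → Matrix (Fin 2) (Fin 2) ℂ :=
  ![1, !![0, 1; 1, 0], !![0, -Complex.I; Complex.I, 0], !![1, 0; 0, -1]]

/-- Tensor product of `m` Pauli matrices. -/
def pauliString {m : ℕ} (p : Fin m → Fin 4) : Matrix (Qubits m) (Qubits m) ℂ :=
  Matrix.of fun x y => ∏ k, pauli (p k) (x k) (y k)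

/-- Tensor product of `m + 1` Pauli matrices, on the virtual space of `m + 1` qubits. -/
def pauliOp {m : ℕ} (a : (Fin m → Fin 4) × Fin 4) :
    Matrix (Qubits m ⊕ Qubits m) (Qubits m ⊕ Qubits m) ℂ :=
  tensorLast (pauliString a.1) (pauli a.2)

/-- Strings with an even number of `Y`, that are not diagonal. -/
def xStrings (m : ℕ) : Finset (Fin m → Fin 4) :=
  Finset.univ.filter fun p =>
    Even (Finset.univ.filter fun k => p k = 2).card ∧ ∃ k, p k = 1 ∨ p k = 2

/-- Strings with an odd number of `Y`. -/
def yStrings (m : ℕ) : Finset (Fin m → Fin 4) :=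
  Finset.univ.filter fun p => Odd (Finset.univ.filter fun k => p k = 2).card

/-- Strings of `𝟙` and `Z`, other than the identity. -/
def zStrings (m : ℕ) : Finset (Fin m → Fin 4) :=
  Finset.univ.filter fun p => (∀ k, p k = 0 ∨ p k = 3) ∧ ∃ k, p k = 3

/-- The labels of the Pauli generators
`{X-type ⊗ σₖ, Y-type ⊗ 𝟙, Z-type ⊗ σₖ, 𝟙 ⊗ σₖ}` of `Sp(2n)`, `n = 2 ^ m`. -/
def genLabels (m : ℕ) : Finset ((Fin m → Fin 4) × Fin 4) :=
  (xStrings m ∪ zStrings m ∪ {fun _ => 0}) ×ˢ {1, 2, 3} ∪ yStrings m ×ˢ {0}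

/-- The index type of the generators, which is also the set of outcomes of an on-site
measurement. -/
abbrev Gen (m : ℕ) : Type := {a : (Fin m → Fin 4) × Fin 4 // a ∈ genLabels m}

/-- The generator `N_a`. -/
def gen {m : ℕ} (a : Gen m) : Matrix (Qubits m ⊕ Qubits m) (Qubits m ⊕ Qubits m) ℂ :=
  pauliOp a.1

/-- The generalized Gell-Mann matrix `X_{ij}` of `SU(n)`. -/
def gellMannX {n : ℕ} (i j : Fin n) : Matrix (Fin n) (Fin n) ℂ :=
  (1 / 2 : ℂ) • (Matrix.single i j 1 + Matrix.single j i 1)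

/-- The generalized Gell-Mann matrix `Y_{ij}` of `SU(n)`. -/
def gellMannY {n : ℕ} (i j : Fin n) : Matrix (Fin n) (Fin n) ℂ :=
  (-Complex.I / 2) • (Matrix.single i j 1 - Matrix.single j i 1)

/-- The diagonal generalized Gell-Mann matrix of `SU(n)`; with rows numbered from `0`, the
matrix numbered `j ≥ 1` here is the one usually written `Z_{j+1}`. -/
def gellMannZ {n : ℕ} (j : Fin n) : Matrix (Fin n) (Fin n) ℂ :=
  ((Real.sqrt (2 * ((j : ℝ) + 1) * (j : ℝ)) : ℂ))⁻¹ •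
    ((∑ i ∈ Finset.univ.filter (fun i : Fin n => i < j), Matrix.single i i 1) -
      ((j : ℕ) : ℂ) • Matrix.single j j 1)

/-- An operator on `ℂ^{2^m}` as an operator on `m` qubits. -/
def toQubits {m : ℕ} (A : Matrix (Fin (2 ^ m)) (Fin (2 ^ m)) ℂ) :
    Matrix (Qubits m) (Qubits m) ℂ :=
  Matrix.reindex finFunctionFinEquiv.symm finFunctionFinEquiv.symm A

/-! ## Measurements and gates -/

section MBQC

variable {m : ℕ}

/-- The on-site vector `|a⟩`, `a` a generator. -/
def siteVec (a : Gen m) : Matrix (Qubits m ⊕ Qubits m) (Qubits m ⊕ Qubits m) ℂ :=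
  ((Real.sqrt (Fintype.card (Qubits m ⊕ Qubits m)) : ℂ))⁻¹ •
    (Matrix.J (Qubits m) ℂ * gen a).map (starRingEnd ℂ)

/-- The measurement basis rotated by the on-site symmetry operator of `g`, with bras
`⟨a| U(g)`. -/
def rotVec (g : Matrix (Qubits m ⊕ Qubits m) (Qubits m ⊕ Qubits m) ℂ) (a : Gen m) :
    Matrix (Qubits m ⊕ Qubits m) (Qubits m ⊕ Qubits m) ℂ :=
  siteSym gᴴ (siteVec a)

/-- The matrix `u_{ab}(g) = tr (N_a† g N_b g†) / 2n` of `g` in the adjoint representation. -/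
def adjMatrix (g : Matrix (Qubits m ⊕ Qubits m) (Qubits m ⊕ Qubits m) ℂ) :
    Matrix (Gen m) (Gen m) ℂ :=
  Matrix.of fun a b =>
    ((gen a)ᴴ * g * gen b * gᴴ).trace / (Fintype.card (Qubits m ⊕ Qubits m) : ℂ)

/-- The gate `exp(-i θ N_a)`. -/
def expGate (a : Gen m) (θ : ℝ) : Matrix (Qubits m ⊕ Qubits m) (Qubits m ⊕ Qubits m) ℂ :=
  NormedSpace.exp ((-(Complex.I * (θ : ℂ))) • gen a)

/-- An adaptive rule: the rotation of the basis in which the next site is measured, as a function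
of the list of all earlier outcomes (the earliest one first). -/
abbrev Rule (m : ℕ) : Type :=
  List (Gen m) → Matrix (Qubits m ⊕ Qubits m) (Qubits m ⊕ Qubits m) ℂ

/-- All bases are rotated by symmetries. -/
def Rule.IsSymmetric (π : Rule m) : Prop := ∀ h, π h ∈ CSp (Qubits m)

/-- All bases are rotated by symmetries of the form `exp(-i θ N_a)`. -/
def Rule.IsElementary (π : Rule m) : Prop := ∀ h, ∃ (a : Gen m) (θ : ℝ), π h = expGate a θ

/-- The on-site vectors that the sites are projected onto if the outcomes are `i`. -/
def Rule.vecs (π : Rule m) {N : ℕ} (i : Fin N → Gen m) (k : Fin N) :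
    Matrix (Qubits m ⊕ Qubits m) (Qubits m ⊕ Qubits m) ℂ :=
  rotVec (π ((List.ofFn i).take k)) (i k)

/-- The (unnormalized) state of the edge spin after the outcomes `i`. -/
def Rule.out (π : Rule m) (L : Qubits m ⊕ Qubits m → ℂ) {N : ℕ} (i : Fin N → Gen m) :
    Qubits m ⊕ Qubits m → ℂ :=
  contract (π.vecs i) (aklt N L)

/-- Born probability of the outcomes `i` if the `N` sites of the AKLT state are measured. -/
def Rule.prob (π : Rule m) (L : Qubits m ⊕ Qubits m → ℂ) {N : ℕ} (i : Fin N → Gen m) : ℝ :=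
  (∑ e, ‖π.out L i e‖ ^ 2) /
    ∑ x : Fin N → (Qubits m ⊕ Qubits m) × (Qubits m ⊕ Qubits m), ∑ e, ‖aklt N L x e‖ ^ 2

/-- With the outcomes `i`, the gate `V` has been executed on every input, up to a scalar and a
byproduct operator that is a tensor product of Pauli matrices. -/
def Rule.Executes (π : Rule m) {N : ℕ} (i : Fin N → Gen m)
    (V : Matrix (Qubits m ⊕ Qubits m) (Qubits m ⊕ Qubits m) ℂ) : Prop :=
  ∃ (b : (Fin m → Fin 4) × Fin 4) (c : ℂ), c ≠ 0 ∧
    ∀ L : Qubits m ⊕ Qubits m → ℂ, π.out L i = c • ((pauliOp b * V) *ᵥ L)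

/-- The probability that measurement of `N` sites executes `V`, on the input `L`. -/
def Rule.execProb (π : Rule m) (L : Qubits m ⊕ Qubits m → ℂ) (N : ℕ)
    (V : Matrix (Qubits m ⊕ Qubits m) (Qubits m ⊕ Qubits m) ℂ) : ℝ :=
  ∑ i : Fin N → Gen m, Set.indicator {i | π.Executes i V} (fun i => π.prob L i) i

/-- The outcomes `b` for which measurement of one site, in the basis rotated by
`exp(-i (θ/2) N_a)`, executes the gate `exp(-i θ N_a)` up to the byproduct `N_b`. -/
def successes (a : Gen m) (θ : ℝ) : Set (Gen m) :=
  {b | ∃ c : ℂ, c ≠ 0 ∧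
    krausOp (rotVec (expGate a (θ / 2)) b) = c • (gen b * expGate a θ)}

end MBQC

end SpAKLT

end

open SpAKLT

/-! The Pauli part reduces to signs. Two Pauli operators commute up to `opCommSign`, and `sympSign`
is the sign in Δ Pᵀ = ± P Δ; the generators are exactly the Pauli operators with `sympSign` equal to
-1 (`mem_genLabels`), that is, those lying in sp(2n, ℂ). All signs are products over the qubits, so
a sum of signs over all strings factors into sums over four matrices. Writing indicator functions
through signs turns every count into such a sum (`four_mul_ncard_xStrings`,
`card_anticommuting_gen`).

Contracting the chain from its first site replaces the input L by K(s) L (`contract_succ`), whence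
the matrix product form. A matrix A lies in sp exactly if Δ A is symmetric, so K is a bijection; the
identity g Δ = Δ ḡ on Sp(2n) makes it equivariant. Trace orthogonality of Pauli operators, together
with the vanishing of traces between opposite symplectic signs, gives the bases and the adjoint
matrices.

Since N = i exp(-i(π/2) N) for a generator N, each Kraus operator in a symmetric basis is 1/(2n)
times a phase times an element of Sp(2n) (`exists_op_eq_smul`). So the norm of the edge state
depends neither on the outcomes nor on the rotations, and dividing by the norm of the AKLT state
gives the uniform distribution (`prob_eq`). The success probability is then the fraction n(n+1) /
(n(2n+1)) of anticommuting generators. The same factorization confines all executable gates to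
Sp(2n) up to a phase.

Generation of Sp(2n) is local, then global. Near 1 an element is determined by its skew-Hermitian
part (`eq_of_skew_part_eq`), and by the inverse function theorem products of gates attain all small
skew parts, so a neighbourhood of 1 in Sp(2n) consists of products of gates. One-parameter subgroups
follow by taking roots. An arbitrary U is brought to 1 by such rotations, each turning an
eigenvector with eigenvalue other than 1 into a fixed vector (`mem_gateClosure_of_mem_CSp`).

To execute a product of gates, each gate is repeated until it succeeds, with its angle corrected by
the sign of the current Pauli byproduct (`gateRule_op`). A weight that is zero once all gates are
done, and that shrinks on average by a fixed factor otherwise, bounds the probability of being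
unfinished by a geometric sequence (`sum_weight`). -/

namespace SpAKLT

variable {m : ℕ}

/-! ### Tensor products of `2 × 2` matrices -/

/-- Tensor product of `m` matrices. -/
def tensorPow (f : Fin m → Matrix (Fin 2) (Fin 2) ℂ) : Matrix (Qubits m) (Qubits m) ℂ :=
  Matrix.of fun x y => ∏ k, f k (x k) (y k)

/-- Distributivity over all strings. It serves twice: for multiplication and traces of tensor
products, and later for all sums of signs. -/
lemma sum_prod_eq_prod_sum {κ R : Type*} [Fintype κ] [CommSemiring R] (f : Fin m → κ → R) :
    ∑ q : Fin m → κ, ∏ k, f k (q k) = ∏ k, ∑ x, f k x := by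
  classical
  rw [Finset.prod_univ_sum, Fintype.piFinset_univ]

lemma pauliString_eq (p : Fin m → Fin 4) : pauliString p = tensorPow fun k => pauli (p k) := rfl

lemma tensorPow_mul (f g : Fin m → Matrix (Fin 2) (Fin 2) ℂ) :
    tensorPow f * tensorPow g = tensorPow fun k => f k * g k := by
  ext x z
  simp only [tensorPow, Matrix.mul_apply, Matrix.of_apply, ← Finset.prod_mul_distrib]
  exact sum_prod_eq_prod_sum fun k y => f k (x k) y * g k y (z k)

lemma tensorPow_one : tensorPow (fun _ : Fin m => 1) = 1 := by
  ext x y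
  simp only [tensorPow, Matrix.of_apply, Matrix.one_apply, Finset.prod_boole, funext_iff]
  simp

lemma tensorPow_smul (c : Fin m → ℂ) (f : Fin m → Matrix (Fin 2) (Fin 2) ℂ) :
    tensorPow (fun k => c k • f k) = (∏ k, c k) • tensorPow f := by
  ext x y
  simp [tensorPow, Finset.prod_mul_distrib]

lemma tensorPow_transpose (f : Fin m → Matrix (Fin 2) (Fin 2) ℂ) :
    (tensorPow f)ᵀ = tensorPow fun k => (f k)ᵀ := rfl

lemma tensorPow_conjTranspose (f : Fin m → Matrix (Fin 2) (Fin 2) ℂ) :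
    (tensorPow f)ᴴ = tensorPow fun k => (f k)ᴴ := by
  ext x y
  simp [tensorPow, Matrix.conjTranspose_apply]

lemma tensorPow_trace (f : Fin m → Matrix (Fin 2) (Fin 2) ℂ) :
    (tensorPow f).trace = ∏ k, (f k).trace :=
  sum_prod_eq_prod_sum fun k y => f k y y

section TensorLast

variable {l : Type}

lemma tensorLast_mul [Fintype l] (A B : Matrix l l ℂ) (σ τ : Matrix (Fin 2) (Fin 2) ℂ) :
    tensorLast A σ * tensorLast B τ = tensorLast (A * B) (σ * τ) := by
  simp [tensorLast, Matrix.fromBlocks_multiply, Matrix.mul_apply, Fin.sum_univ_two, smul_smul,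
    add_smul, mul_comm]

lemma tensorLast_trace [Fintype l] (A : Matrix l l ℂ) (σ : Matrix (Fin 2) (Fin 2) ℂ) :
    (tensorLast A σ).trace = A.trace * σ.trace := by
  simp [tensorLast, Matrix.trace, Finset.mul_sum, mul_comm, mul_add, Finset.sum_add_distrib]

lemma tensorLast_transpose (A : Matrix l l ℂ) (σ : Matrix (Fin 2) (Fin 2) ℂ) :
    (tensorLast A σ)ᵀ = tensorLast Aᵀ σᵀ := by
  simp [tensorLast, Matrix.fromBlocks_transpose]

lemma tensorLast_conjTranspose (A : Matrix l l ℂ) (σ : Matrix (Fin 2) (Fin 2) ℂ) :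
    (tensorLast A σ)ᴴ = tensorLast Aᴴ σᴴ := by
  simp [tensorLast, Matrix.fromBlocks_conjTranspose]

lemma tensorLast_smul_smul (c d : ℂ) (A : Matrix l l ℂ) (σ : Matrix (Fin 2) (Fin 2) ℂ) :
    tensorLast (c • A) (d • σ) = (c * d) • tensorLast A σ := by
  simp only [tensorLast, Matrix.fromBlocks_smul, Matrix.smul_apply, smul_eq_mul, smul_smul]
  congr 2 <;> ring

lemma tensorLast_one [DecidableEq l] : tensorLast (1 : Matrix l l ℂ) 1 = 1 := by
  simp [tensorLast]

lemma J_eq_tensorLast [DecidableEq l] : Matrix.J l ℂ = tensorLast 1 !![0, -1; 1, 0] := by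
  simp [tensorLast, Matrix.J]

end TensorLast

/-! ### Single-qubit Pauli matrices -/

/-- The sign in `σ_p σ_q = ± σ_q σ_p`. -/
def commSign₁ (p q : Fin 4) : ℤ := if p = 0 ∨ q = 0 ∨ p = q then 1 else -1

/-- The sign in `σᵀ = ± σ`. -/
def transSign₁ (p : Fin 4) : ℤ := if p = 2 then -1 else 1

/-- The sign in `Δ σᵀ = ± σ Δ`. -/
def sympSign₁ (p : Fin 4) : ℤ := if p = 0 then 1 else -1

lemma pauli_mul_comm (p q : Fin 4) :
    pauli p * pauli q = (commSign₁ p q : ℂ) • (pauli q * pauli p) := by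
  fin_cases p <;> fin_cases q <;> simp [pauli, commSign₁, Matrix.one_fin_two]

lemma pauli_transpose (p : Fin 4) : (pauli p)ᵀ = (transSign₁ p : ℂ) • pauli p := by
  fin_cases p <;> ext i j <;> fin_cases i <;> fin_cases j <;>
    simp [pauli, transSign₁, Matrix.one_fin_two]

lemma pauli_symp (p : Fin 4) : !![0, -1; 1, 0] * (pauli p)ᵀ =
    (sympSign₁ p : ℂ) • (pauli p * !![0, -1; 1, 0]) := by
  fin_cases p <;> ext i j <;> fin_cases i <;> fin_cases j <;>
    simp [pauli, sympSign₁, Matrix.one_fin_two, Matrix.mul_apply]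

lemma pauli_conjTranspose (p : Fin 4) : (pauli p)ᴴ = pauli p := by
  fin_cases p <;> ext i j <;> fin_cases i <;> fin_cases j <;>
    simp [pauli, Matrix.one_fin_two]

lemma pauli_mul_self (p : Fin 4) : pauli p * pauli p = 1 := by
  fin_cases p <;> simp [pauli, Matrix.one_fin_two]

lemma pauli_trace_mul (p q : Fin 4) :
    (pauli p * pauli q).trace = if p = q then 2 else 0 := by
  fin_cases p <;> fin_cases q <;> simp [pauli, Matrix.one_fin_two, Matrix.trace_fin_two] <;>
    norm_num

lemma pauli_mul_eq_smul (p q : Fin 4) :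
    ∃ (r : Fin 4) (c : ℂ), c ≠ 0 ∧ pauli p * pauli q = c • pauli r := by
  have hI := Complex.I_ne_zero
  have hI' := neg_ne_zero.mpr hI
  fin_cases p <;> fin_cases q
  · exact ⟨0, 1, by simp, by simp [pauli]⟩
  · exact ⟨1, 1, by simp, by simp [pauli]⟩
  · exact ⟨2, 1, by simp, by simp [pauli]⟩
  · exact ⟨3, 1, by simp, by simp [pauli]⟩
  · exact ⟨1, 1, by simp, by simp [pauli]⟩
  · exact ⟨0, 1, by simp, by simp [pauli, Matrix.one_fin_two]⟩
  · exact ⟨3, Complex.I, hI, by simp [pauli]⟩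
  · exact ⟨2, -Complex.I, hI', by simp [pauli]⟩
  · exact ⟨2, 1, by simp, by simp [pauli]⟩
  · exact ⟨3, -Complex.I, hI', by simp [pauli]⟩
  · exact ⟨0, 1, by simp, by simp [pauli, Matrix.one_fin_two]⟩
  · exact ⟨1, Complex.I, hI, by simp [pauli]⟩
  · exact ⟨3, 1, by simp, by simp [pauli]⟩
  · exact ⟨2, Complex.I, hI, by simp [pauli]⟩
  · exact ⟨1, -Complex.I, hI', by simp [pauli]⟩
  · exact ⟨0, 1, by simp, by simp [pauli, Matrix.one_fin_two]⟩

/-! ### Pauli strings -/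

/-- The sign in `P Q = ± Q P` for Pauli strings. -/
def commSign (p q : Fin m → Fin 4) : ℤ := ∏ k, commSign₁ (p k) (q k)

/-- The sign in `Pᵀ = ± P` for Pauli strings. -/
def transSign (p : Fin m → Fin 4) : ℤ := ∏ k, transSign₁ (p k)

lemma prod_sign {ι : Type*} [Fintype ι] (f : ι → ℤ) (hf : ∀ i, f i = 1 ∨ f i = -1) :
    ∏ i, f i = 1 ∨ ∏ i, f i = -1 := by
  refine Finset.prod_induction f (fun z => z = 1 ∨ z = -1) ?_ (Or.inl rfl) fun i _ => hf i
  rintro a b (rfl | rfl) (rfl | rfl) <;> simp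

lemma commSign_eq_or (p q : Fin m → Fin 4) : commSign p q = 1 ∨ commSign p q = -1 :=
  prod_sign _ fun k => by unfold commSign₁; split_ifs <;> simp

lemma transSign_eq_or (p : Fin m → Fin 4) : transSign p = 1 ∨ transSign p = -1 :=
  prod_sign _ fun k => by unfold transSign₁; split_ifs <;> simp

lemma pauliString_mul_comm (p q : Fin m → Fin 4) :
    pauliString p * pauliString q = (commSign p q : ℂ) • (pauliString q * pauliString p) := by
  simp only [pauliString_eq, tensorPow_mul]
  rw [commSign, Int.cast_prod, ← tensorPow_smul]
  simp only [← pauli_mul_comm]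

lemma pauliString_transpose (p : Fin m → Fin 4) :
    (pauliString p)ᵀ = (transSign p : ℂ) • pauliString p := by
  rw [pauliString_eq, tensorPow_transpose, transSign, Int.cast_prod, ← tensorPow_smul]
  simp only [pauli_transpose]

lemma pauliString_conjTranspose (p : Fin m → Fin 4) : (pauliString p)ᴴ = pauliString p := by
  simp only [pauliString_eq, tensorPow_conjTranspose, pauli_conjTranspose]

lemma pauliString_mul_self (p : Fin m → Fin 4) : pauliString p * pauliString p = 1 := by
  simp only [pauliString_eq, tensorPow_mul, pauli_mul_self, tensorPow_one]

lemma pauliString_trace_mul (p q : Fin m → Fin 4) :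
    (pauliString p * pauliString q).trace = if p = q then 2 ^ m else 0 := by
  simp only [pauliString_eq, tensorPow_mul, tensorPow_trace, pauli_trace_mul]
  rcases eq_or_ne p q with rfl | h
  · simp
  · rw [if_neg h]
    obtain ⟨k, hk⟩ := Function.ne_iff.mp h
    exact Finset.prod_eq_zero (Finset.mem_univ k) (if_neg hk)

lemma pauliString_mul_eq_smul (p q : Fin m → Fin 4) :
    ∃ (r : Fin m → Fin 4) (c : ℂ), c ≠ 0 ∧ pauliString p * pauliString q = c • pauliString r := by
  choose r c hc h using pauli_mul_eq_smul
  refine ⟨fun k => r (p k) (q k), ∏ k, c (p k) (q k), Finset.prod_ne_zero_iff.mpr fun k _ => hc _ _,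
    ?_⟩
  simp only [pauliString_eq, tensorPow_mul, h, tensorPow_smul]

/-- Involutions are invertible, so B A is nonzero and differs from its negative; hence the sign is
determined by the product. This turns statements about operators into statements about integers. -/
lemma commute_of_sign {ι : Type*} [Fintype ι] [DecidableEq ι] [Nonempty ι] {A B : Matrix ι ι ℂ}
    {z : ℤ} (hz : z = 1 ∨ z = -1) (hA : A * A = 1) (hB : B * B = 1)
    (h : A * B = (z : ℂ) • (B * A)) :
    (Commute A B ↔ z = 1) ∧ (A * B = -(B * A) ↔ z = -1) := by
  have h0 : B * A ≠ 0 := by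
    intro h0
    have h1 : B * (B * A) * A = 1 := by
      rw [← mul_assoc B B A, hB, one_mul, hA]
    rw [h0] at h1
    simp at h1
  have hne : ¬ (B * A = -(B * A)) := fun h' => h0 <| by
    have h2 : (2 : ℂ) • (B * A) = 0 := by
      rw [two_smul]
      nth_rewrite 2 [h']
      exact add_neg_cancel _
    exact (smul_eq_zero.mp h2).resolve_left two_ne_zero
  rcases hz with rfl | rfl
  · simp only [Int.cast_one, one_smul] at h
    exact ⟨⟨fun _ => rfl, fun _ => h⟩, ⟨fun h' => absurd (h.symm.trans h') hne, by simp⟩⟩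
  · simp only [Int.cast_neg, Int.cast_one, neg_smul, one_smul] at h
    exact ⟨⟨fun h' => absurd (h'.symm.trans h) hne, by simp⟩, ⟨fun _ => rfl, fun _ => h⟩⟩

lemma commute_pauliString_iff (p q : Fin m → Fin 4) :
    Commute (pauliString p) (pauliString q) ↔ commSign p q = 1 :=
  (commute_of_sign (commSign_eq_or p q) (pauliString_mul_self p) (pauliString_mul_self q)
    (pauliString_mul_comm p q)).1

lemma transSign_eq_pow (p : Fin m → Fin 4) :
    transSign p = (-1) ^ (Finset.univ.filter fun k => p k = 2).card := by
  simp [transSign, transSign₁, Finset.prod_ite]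

lemma mem_yStrings {p : Fin m → Fin 4} : p ∈ yStrings m ↔ transSign p = -1 := by
  rw [transSign_eq_pow, neg_one_pow_eq_neg_one_iff_odd (by norm_num)]
  simp [yStrings]

/-- Whether a Pauli string is diagonal. -/
def IsDiagString (p : Fin m → Fin 4) : Prop := ∀ k, p k = 0 ∨ p k = 3

instance : DecidablePred (IsDiagString (m := m)) := fun p =>
  inferInstanceAs (Decidable (∀ k, p k = 0 ∨ p k = 3))

lemma not_isDiagString {p : Fin m → Fin 4} : ¬ IsDiagString p ↔ ∃ k, p k = 1 ∨ p k = 2 := by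
  simp only [IsDiagString, not_forall]
  refine exists_congr fun k => ?_
  generalize p k = x
  revert x
  decide

lemma mem_xStrings {p : Fin m → Fin 4} :
    p ∈ xStrings m ↔ transSign p = 1 ∧ ¬ IsDiagString p := by
  rw [transSign_eq_pow, neg_one_pow_eq_one_iff_even (by norm_num), not_isDiagString]
  simp [xStrings]

lemma mem_zStrings {p : Fin m → Fin 4} : p ∈ zStrings m ↔ IsDiagString p ∧ p ≠ 0 := by
  simp only [zStrings, Finset.mem_filter, Finset.mem_univ, true_and]
  refine and_congr_right fun h => ?_
  rw [Function.ne_iff]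
  refine exists_congr fun k => ?_
  rcases h k with h | h <;> simp [h]

lemma IsDiagString.transSign {p : Fin m → Fin 4} (h : IsDiagString p) : transSign p = 1 :=
  Finset.prod_eq_one fun k _ => by rcases h k with h | h <;> simp [h, transSign₁]

/-! ### Pauli operators on `m + 1` qubits -/

/-- The sign in `P Q = ± Q P` for Pauli operators on `m + 1` qubits. -/
def opCommSign (a b : (Fin m → Fin 4) × Fin 4) : ℤ := commSign a.1 b.1 * commSign₁ a.2 b.2

/-- The sign in `Δ Pᵀ = ± P Δ` for Pauli operators on `m + 1` qubits. -/
def sympSign (a : (Fin m → Fin 4) × Fin 4) : ℤ := transSign a.1 * sympSign₁ a.2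

lemma opCommSign_eq_or (a b : (Fin m → Fin 4) × Fin 4) :
    opCommSign a b = 1 ∨ opCommSign a b = -1 := by
  have : commSign₁ a.2 b.2 = 1 ∨ commSign₁ a.2 b.2 = -1 := by unfold commSign₁; split_ifs <;> simp
  unfold opCommSign
  rcases commSign_eq_or a.1 b.1 with h | h <;> rcases this with h' | h' <;> simp [h, h']

lemma sympSign_eq_or (a : (Fin m → Fin 4) × Fin 4) : sympSign a = 1 ∨ sympSign a = -1 := by
  have : sympSign₁ a.2 = 1 ∨ sympSign₁ a.2 = -1 := by unfold sympSign₁; split_ifs <;> simp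
  unfold sympSign
  rcases transSign_eq_or a.1 with h | h <;> rcases this with h' | h' <;> simp [h, h']

lemma pauliOp_mul_comm (a b : (Fin m → Fin 4) × Fin 4) :
    pauliOp a * pauliOp b = (opCommSign a b : ℂ) • (pauliOp b * pauliOp a) := by
  simp only [pauliOp, tensorLast_mul]
  rw [opCommSign, Int.cast_mul, ← tensorLast_smul_smul, ← pauliString_mul_comm, ← pauli_mul_comm]

lemma pauliOp_conjTranspose (a : (Fin m → Fin 4) × Fin 4) : (pauliOp a)ᴴ = pauliOp a := by
  rw [pauliOp, tensorLast_conjTranspose, pauliString_conjTranspose, pauli_conjTranspose]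

lemma pauliOp_mul_self (a : (Fin m → Fin 4) × Fin 4) : pauliOp a * pauliOp a = 1 := by
  rw [pauliOp, tensorLast_mul, pauliString_mul_self, pauli_mul_self, tensorLast_one]

lemma J_mul_pauliOp_transpose (a : (Fin m → Fin 4) × Fin 4) :
    Matrix.J (Qubits m) ℂ * (pauliOp a)ᵀ =
      (sympSign a : ℂ) • (pauliOp a * Matrix.J (Qubits m) ℂ) := by
  rw [pauliOp, J_eq_tensorLast, tensorLast_transpose, tensorLast_mul, tensorLast_mul, pauli_symp,
    pauliString_transpose, sympSign, Int.cast_mul, ← tensorLast_smul_smul, one_mul, mul_one]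

lemma pauliOp_trace_mul (a b : (Fin m → Fin 4) × Fin 4) :
    (pauliOp a * pauliOp b).trace = if a = b then 2 ^ (m + 1) else 0 := by
  rw [pauliOp, pauliOp, tensorLast_mul, tensorLast_trace, pauliString_trace_mul, pauli_trace_mul]
  by_cases h1 : a.1 = b.1 <;> by_cases h2 : a.2 = b.2 <;> simp [h1, h2, Prod.ext_iff, pow_succ]

lemma pauliOp_mul_eq_smul (a b : (Fin m → Fin 4) × Fin 4) :
    ∃ (r : (Fin m → Fin 4) × Fin 4) (c : ℂ), c ≠ 0 ∧ pauliOp a * pauliOp b = c • pauliOp r := by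
  obtain ⟨r, c, hc, h⟩ := pauliString_mul_eq_smul a.1 b.1
  obtain ⟨r', c', hc', h'⟩ := pauli_mul_eq_smul a.2 b.2
  exact ⟨(r, r'), c * c', mul_ne_zero hc hc', by
    rw [pauliOp, pauliOp, tensorLast_mul, h, h', tensorLast_smul_smul, pauliOp]⟩

lemma pauliOp_one : pauliOp ((fun _ => 0, 0) : (Fin m → Fin 4) × Fin 4) = 1 := by
  have : pauliString (fun _ : Fin m => 0) = 1 := tensorPow_one
  rw [pauliOp, this]
  exact tensorLast_one

lemma mem_genLabels {a : (Fin m → Fin 4) × Fin 4} : a ∈ genLabels m ↔ sympSign a = -1 := by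
  obtain ⟨p, k⟩ := a
  -- The strings of types 𝒳 and 𝒵 and the identity are together the real symmetric strings; type 𝒴
  -- is the complement.
  have hsym : p ∈ xStrings m ∪ zStrings m ∪ {fun _ => 0} ↔ transSign p = 1 := by
    simp only [Finset.mem_union, mem_xStrings, mem_zStrings, Finset.mem_singleton]
    constructor
    · rintro ((h | h) | rfl)
      · exact h.1
      · exact h.1.transSign
      · exact IsDiagString.transSign fun _ => Or.inl rfl
    · intro h
      by_cases hd : IsDiagString p
      · by_cases h0 : p = 0
        · exact Or.inr h0
        · exact Or.inl (Or.inr ⟨hd, h0⟩)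
      · exact Or.inl (Or.inl ⟨h, hd⟩)
  have hk : k ∈ ({1, 2, 3} : Finset (Fin 4)) ↔ k ≠ 0 := by revert k; decide
  rw [genLabels, Finset.mem_union, Finset.mem_product, Finset.mem_product]
  simp only [hsym, hk, mem_yStrings, Finset.mem_singleton, sympSign, sympSign₁]
  rcases transSign_eq_or p with h | h <;> by_cases hk0 : k = 0 <;> simp [h, hk0]

end SpAKLT

namespace SpAKLT

/-! ### The AKLT state as a matrix product state -/

section MPS

lemma sum_fin_succ {α R : Type*} [Fintype α] [AddCommMonoid R] (N : ℕ)
    (f : (Fin (N + 1) → α) → R) :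
    ∑ x, f x = ∑ a, ∑ x : Fin N → α, f (Fin.cons a x) := by
  rw [← (Fin.consEquiv fun _ => α).sum_comp, Fintype.sum_prod_type]
  rfl

variable {l : Type} [Fintype l] [DecidableEq l]

lemma bonds_zero (L : l ⊕ l → ℂ) (x : Fin 0 → (l ⊕ l) × (l ⊕ l)) (e : l ⊕ l) :
    bonds 0 L x e = L e := by
  simp [bonds, Fin.snoc]

/-- Fixing the right spin of the first site turns its singlet into an input vector for the remaining
chain; this is what makes induction from the first site possible. -/
lemma bonds_succ (N : ℕ) (L : l ⊕ l → ℂ) (a : (l ⊕ l) × (l ⊕ l))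
    (x : Fin N → (l ⊕ l) × (l ⊕ l)) (e : l ⊕ l) :
    bonds (N + 1) L (Fin.cons a x : Fin (N + 1) → _) e =
      L a.1 * bonds N (fun c => singlet l a.2 c) x e := by
  have h : (Fin.snoc (fun k => ((Fin.cons a x : Fin (N + 1) → (l ⊕ l) × (l ⊕ l)) k).1) e :
      Fin (N + 2) → l ⊕ l) = Fin.cons a.1 (Fin.snoc (fun k => (x k).1) e : Fin (N + 1) → l ⊕ l) := by
    rw [Fin.cons_snoc_eq_snoc_cons]
    congr 1
    ext k
    refine Fin.cases ?_ (fun k => ?_) k <;> simp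
  simp only [bonds]
  rw [h, Fin.prod_univ_succ]
  simp

lemma bonds_add (N : ℕ) (L L' : l ⊕ l → ℂ) (x : Fin N → (l ⊕ l) × (l ⊕ l)) (e : l ⊕ l) :
    bonds N (L + L') x e = bonds N L x e + bonds N L' x e := by
  simp [bonds, add_mul]

lemma bonds_smul (N : ℕ) (c : ℂ) (L : l ⊕ l → ℂ) (x : Fin N → (l ⊕ l) × (l ⊕ l)) (e : l ⊕ l) :
    bonds N (c • L) x e = c * bonds N L x e := by
  simp [bonds, mul_assoc]

lemma aklt_add (N : ℕ) (L L' : l ⊕ l → ℂ) (x : Fin N → (l ⊕ l) × (l ⊕ l)) (e : l ⊕ l) :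
    aklt N (L + L') x e = aklt N L x e + aklt N L' x e := by
  simp [aklt, bonds_add, Finset.sum_add_distrib, mul_add]

lemma aklt_smul (N : ℕ) (c : ℂ) (L : l ⊕ l → ℂ) (x : Fin N → (l ⊕ l) × (l ⊕ l)) (e : l ⊕ l) :
    aklt N (c • L) x e = c * aklt N L x e := by
  simp only [aklt, bonds_smul, ← Finset.mul_sum]
  ring

lemma aklt_zero (L : l ⊕ l → ℂ) (x : Fin 0 → (l ⊕ l) × (l ⊕ l)) (e : l ⊕ l) :
    aklt 0 L x e = L e := by
  simp [aklt, bonds_zero]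

/-- The left spin of the second site, once the two spins of the first one are in the state `a`. -/
noncomputable def nextSpin (L : l ⊕ l → ℂ) (a : (l ⊕ l) × (l ⊕ l)) : l ⊕ l → ℂ := fun c =>
  (1 / 2 : ℂ) * (L a.1 * singlet l a.2 c + L a.2 * singlet l a.1 c)

/-- The sum over the swap of the first site yields the two terms of `nextSpin`; the rest of the
chain depends linearly on its input. -/
lemma aklt_succ (N : ℕ) (L : l ⊕ l → ℂ) (a : (l ⊕ l) × (l ⊕ l))
    (x : Fin N → (l ⊕ l) × (l ⊕ l)) (e : l ⊕ l) :
    aklt (N + 1) L (Fin.cons a x : Fin (N + 1) → _) e = aklt N (nextSpin L a) x e := by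
  have hn : nextSpin L a = (1 / 2 * L a.1 : ℂ) • (fun c => singlet l a.2 c) +
      (1 / 2 * L a.2 : ℂ) • (fun c => singlet l a.1 c) := by
    ext c
    simp only [nextSpin, Pi.add_apply, Pi.smul_apply, smul_eq_mul]
    ring
  have hc : ∀ (t : Bool) (τ : Fin N → Bool),
      (fun k => if (Fin.cons t τ : Fin (N + 1) → Bool) k then
        ((Fin.cons a x : Fin (N + 1) → (l ⊕ l) × (l ⊕ l)) k).swap
        else (Fin.cons a x : Fin (N + 1) → (l ⊕ l) × (l ⊕ l)) k) =
      (Fin.cons (if t then a.swap else a) (fun k => if τ k then (x k).swap else x k) :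
        Fin (N + 1) → (l ⊕ l) × (l ⊕ l)) := by
    intro t τ
    ext1 k
    refine Fin.cases ?_ (fun k => ?_) k <;> simp
  rw [hn, aklt_add, aklt_smul, aklt_smul, aklt, sum_fin_succ]
  simp only [hc, bonds_succ, Fintype.sum_bool, aklt, if_true,
    Bool.false_eq_true, if_false, Prod.fst_swap, Prod.snd_swap, ← Finset.mul_sum]
  ring

lemma contract_zero (s : Fin 0 → Matrix (l ⊕ l) (l ⊕ l) ℂ) (L : l ⊕ l → ℂ) :
    contract s (aklt 0 L) = L := by
  ext e
  simp [contract, aklt_zero]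

lemma contract_aklt_sum {ι : Type*} {N : ℕ} (s : Fin N → Matrix (l ⊕ l) (l ⊕ l) ℂ)
    (S : Finset ι) (c : ι → ℂ) (L : ι → l ⊕ l → ℂ) :
    contract s (aklt N (∑ i ∈ S, c i • L i)) = ∑ i ∈ S, c i • contract s (aklt N (L i)) := by
  classical
  have h0 : contract s (aklt N (0 : l ⊕ l → ℂ)) = 0 := by
    ext e
    have : ∀ x, aklt N (0 : l ⊕ l → ℂ) x e = 0 := fun x => by
      simpa using aklt_smul N 0 0 x e
    simp [contract, this]
  induction S using Finset.induction_on with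
  | empty => simpa using h0
  | insert i S hi ih =>
    rw [Finset.sum_insert hi, Finset.sum_insert hi, ← ih]
    ext e
    simp only [contract, aklt_add, aklt_smul, mul_add, Finset.sum_add_distrib, Pi.add_apply,
      Pi.smul_apply, smul_eq_mul, Finset.mul_sum]
    congr 1
    exact Finset.sum_congr rfl fun x _ => mul_left_comm _ _ _

lemma J_apply_swap {l : Type} [DecidableEq l] (a b : l ⊕ l) : Matrix.J l ℂ a b = -Matrix.J l ℂ b a := by
  have := congrFun (congrFun (Matrix.J_transpose l ℂ) b) a
  simpa using this

/-- For symmetric s the two swapped terms contribute equally, which cancels the factor 1/2. The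
minus sign in `krausOp` is the antisymmetry of Δ, whose arguments are exchanged. -/
lemma sum_conj_smul_nextSpin {s : Matrix (l ⊕ l) (l ⊕ l) ℂ} (hs : s ∈ onSite l)
    (L : l ⊕ l → ℂ) :
    ∑ a : (l ⊕ l) × (l ⊕ l), starRingEnd ℂ (s a.1 a.2) • nextSpin L a = krausOp s *ᵥ L := by
  have hs' : ∀ a b, s a b = s b a := fun a b => by
    have : sᵀ = s := hs
    exact congrFun (congrFun this b) a
  ext c
  have hswap : ∑ a : l ⊕ l, ∑ b : l ⊕ l, starRingEnd ℂ (s a b) * (L b * singlet l a c) =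
      ∑ a : l ⊕ l, ∑ b : l ⊕ l, starRingEnd ℂ (s a b) * (L a * singlet l b c) := by
    rw [Finset.sum_comm]
    exact Finset.sum_congr rfl fun a _ => Finset.sum_congr rfl fun b _ => by rw [hs']
  rw [Fintype.sum_prod_type]
  simp only [Finset.sum_apply, Pi.smul_apply, smul_eq_mul, nextSpin, mul_add,
    Finset.sum_add_distrib, mul_left_comm _ (1 / 2 : ℂ), ← Finset.mul_sum]
  rw [hswap, ← add_mul, add_halves, one_mul]
  simp only [Matrix.mulVec, dotProduct, krausOp, Matrix.smul_apply, Matrix.mul_apply,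
    smul_eq_mul, Matrix.map_apply, singlet, Finset.mul_sum, Finset.sum_mul]
  refine Finset.sum_congr rfl fun a _ => Finset.sum_congr rfl fun b _ => ?_
  rw [hs' a b, J_apply_swap b c]
  ring

lemma contract_succ {N : ℕ} (s : Fin (N + 1) → Matrix (l ⊕ l) (l ⊕ l) ℂ)
    (hs : s 0 ∈ onSite l) (L : l ⊕ l → ℂ) :
    contract s (aklt (N + 1) L) =
      contract (fun k => s k.succ) (aklt N (krausOp (s 0) *ᵥ L)) := by
  rw [← sum_conj_smul_nextSpin hs, contract_aklt_sum]
  ext e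
  simp only [contract, sum_fin_succ, Fin.prod_univ_succ, Fin.cons_zero, Fin.cons_succ, aklt_succ,
    Finset.sum_apply, Pi.smul_apply, smul_eq_mul, Finset.mul_sum, mul_assoc]

/-- The AKLT state is a matrix product state. -/
theorem contract_aklt {N : ℕ} (s : Fin N → Matrix (l ⊕ l) (l ⊕ l) ℂ)
    (hs : ∀ k, s k ∈ onSite l) (L : l ⊕ l → ℂ) :
    contract s (aklt N L) = (List.ofFn fun k => krausOp (s k)).reverse.prod *ᵥ L := by
  induction N generalizing L with
  | zero => simp [contract_zero]
  | succ N ih =>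
    rw [contract_succ s (hs 0), ih _ fun k => hs _, List.ofFn_succ, List.reverse_cons,
      List.prod_append, List.prod_singleton, Matrix.mulVec_mulVec]

/-! ### The norm of the AKLT state -/

lemma sum_J_mul_conj (a b : l ⊕ l) :
    ∑ c, Matrix.J l ℂ a c * starRingEnd ℂ (Matrix.J l ℂ b c) = if a = b then 1 else 0 := by
  rcases a with a | a <;> rcases b with b | b <;>
    simp [Matrix.J, Matrix.one_apply, apply_ite (starRingEnd ℂ), eq_comm]

lemma sum_singlet_mul_conj (a b : l ⊕ l) :
    ∑ c, singlet l a c * starRingEnd ℂ (singlet l b c) =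
      if a = b then ((Fintype.card (l ⊕ l) : ℂ))⁻¹ else 0 := by
  have h : ((Real.sqrt (Fintype.card (l ⊕ l)) : ℂ))⁻¹ * ((Real.sqrt (Fintype.card (l ⊕ l)) : ℂ))⁻¹ =
      ((Fintype.card (l ⊕ l) : ℂ))⁻¹ := by
    rw [← mul_inv, ← Complex.ofReal_mul, Real.mul_self_sqrt (Nat.cast_nonneg _)]
    simp
  have : ∀ c, singlet l a c * starRingEnd ℂ (singlet l b c) =
      ((Fintype.card (l ⊕ l) : ℂ))⁻¹ *
        (Matrix.J l ℂ a c * starRingEnd ℂ (Matrix.J l ℂ b c)) := fun c => by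
    rw [← h]
    simp only [singlet, Matrix.smul_apply, smul_eq_mul, map_mul, map_inv₀, Complex.conj_ofReal]
    ring
  simp only [this, ← Finset.mul_sum, sum_J_mul_conj]
  simp

/-- With d the virtual dimension, the second spin of a site is maximally mixed, so the symmetric
projector has expectation (1 + 1/d)/2: the identity contributes 1 and the swap contributes 1/d. -/
lemma sum_norm_sq_nextSpin [Nonempty l] (L : l ⊕ l → ℂ) :
    ∑ a, ∑ c, ‖nextSpin L a c‖ ^ 2 =
      ((Fintype.card (l ⊕ l) + 1 : ℝ) / (2 * Fintype.card (l ⊕ l))) * ∑ e, ‖L e‖ ^ 2 := by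
  have hd : (Fintype.card (l ⊕ l) : ℂ) ≠ 0 := Nat.cast_ne_zero.mpr Fintype.card_ne_zero
  -- The two cross terms survive only for equal spins, since the rows of the singlet matrix are
  -- orthogonal.
  have key : ∀ a : (l ⊕ l) × (l ⊕ l), ∑ c, nextSpin L a c * starRingEnd ℂ (nextSpin L a c) =
      (1 / 4 : ℂ) * ((Fintype.card (l ⊕ l) : ℂ))⁻¹ *
        (L a.1 * starRingEnd ℂ (L a.1) + L a.2 * starRingEnd ℂ (L a.2) +
          2 * if a.1 = a.2 then L a.1 * starRingEnd ℂ (L a.1) else 0) := by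
    rintro ⟨a, b⟩
    have : ∀ c, nextSpin L (a, b) c * starRingEnd ℂ (nextSpin L (a, b) c) = (1 / 4 : ℂ) *
        (L a * starRingEnd ℂ (L a) * (singlet l b c * starRingEnd ℂ (singlet l b c)) +
          L b * starRingEnd ℂ (L b) * (singlet l a c * starRingEnd ℂ (singlet l a c)) +
          L a * starRingEnd ℂ (L b) * (singlet l b c * starRingEnd ℂ (singlet l a c)) +
          L b * starRingEnd ℂ (L a) * (singlet l a c * starRingEnd ℂ (singlet l b c))) := by
      intro c
      simp only [nextSpin, map_mul, map_add, map_div₀, map_one, map_ofNat]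
      ring
    simp only [this, ← Finset.mul_sum, Finset.sum_add_distrib, sum_singlet_mul_conj]
    by_cases h : a = b
    · subst h
      simp only [if_true]
      ring
    · simp only [h, Ne.symm h, if_true, if_false]
      ring
  have hC : ∀ z : ℂ, ((‖z‖ ^ 2 : ℝ) : ℂ) = z * starRingEnd ℂ z := fun z => by
    rw [Complex.mul_conj, Complex.normSq_eq_norm_sq]
  rw [← Complex.ofReal_inj]
  simp only [Complex.ofReal_sum, Complex.ofReal_mul, hC, key, ← Finset.mul_sum,
    Finset.sum_add_distrib, Fintype.sum_prod_type, Finset.sum_const, Finset.card_univ,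
    Finset.sum_ite_eq, Finset.mem_univ, if_true, nsmul_eq_mul]
  simp only [mul_left_comm (L _), ← Finset.mul_sum]
  generalize ∑ x, L x * starRingEnd ℂ (L x) = S
  push_cast
  field_simp
  ring

lemma sum_norm_sq_aklt [Nonempty l] (N : ℕ) (L : l ⊕ l → ℂ) :
    ∑ x : Fin N → (l ⊕ l) × (l ⊕ l), ∑ e, ‖aklt N L x e‖ ^ 2 =
      ((Fintype.card (l ⊕ l) + 1 : ℝ) / (2 * Fintype.card (l ⊕ l))) ^ N * ∑ e, ‖L e‖ ^ 2 := by
  induction N generalizing L with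
  | zero => simp [aklt_zero]
  | succ N ih =>
    simp only [sum_fin_succ, aklt_succ, ih, ← Finset.mul_sum, sum_norm_sq_nextSpin]
    ring

end MPS

end SpAKLT

namespace SpAKLT

variable {m : ℕ}

/-! ### Counting Pauli strings with given signs -/

lemma sum_transSign : ∑ q : Fin m → Fin 4, transSign q = 2 ^ m := by
  unfold transSign
  rw [sum_prod_eq_prod_sum fun _ x => transSign₁ x]
  have : ∑ x, transSign₁ x = 2 := by decide
  simp [this]

lemma sum_commSign {p : Fin m → Fin 4} (hp : p ≠ 0) : ∑ q, commSign p q = 0 := by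
  unfold commSign
  rw [sum_prod_eq_prod_sum fun k x => commSign₁ (p k) x]
  obtain ⟨k, hk⟩ := Function.ne_iff.mp hp
  refine Finset.prod_eq_zero (Finset.mem_univ k) ?_
  have : ∀ y : Fin 4, y ≠ 0 → ∑ x, commSign₁ y x = 0 := by decide
  exact this _ hk

/-- On each qubit the sum over the four matrices returns twice the transposition sign, so
`transSign` is reproduced up to the factor 2 ^ m. In `sum_diagInd_mul_commSign` the diagonal
indicator behaves in the same way. -/
lemma sum_transSign_mul_commSign (p : Fin m → Fin 4) :
    ∑ q, transSign q * commSign p q = 2 ^ m * transSign p := by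
  unfold commSign transSign
  simp only [← Finset.prod_mul_distrib]
  rw [sum_prod_eq_prod_sum fun k x => transSign₁ x * commSign₁ (p k) x]
  have : ∀ y : Fin 4, ∑ x, transSign₁ x * commSign₁ y x = 2 * transSign₁ y := by decide
  simp only [this, Finset.prod_mul_distrib]
  simp

/-- The indicator function of diagonal Pauli matrices. -/
def diagInd₁ (p : Fin 4) : ℤ := if p = 0 ∨ p = 3 then 1 else 0

/-- The indicator function of diagonal strings. -/
def diagInd (p : Fin m → Fin 4) : ℤ := if IsDiagString p then 1 else 0

lemma diagInd_eq_prod (p : Fin m → Fin 4) : diagInd p = ∏ k, diagInd₁ (p k) := by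
  by_cases h : IsDiagString p
  · have h1 : ∀ k, diagInd₁ (p k) = 1 := fun k => if_pos (h k)
    simp [diagInd, h, h1]
  · obtain ⟨k, hk⟩ := not_forall.mp h
    have h0 : diagInd₁ (p k) = 0 := if_neg hk
    rw [diagInd, if_neg h, Finset.prod_eq_zero (Finset.mem_univ k) h0]

lemma sum_diagInd : ∑ q : Fin m → Fin 4, diagInd q = 2 ^ m := by
  simp only [diagInd_eq_prod]
  rw [sum_prod_eq_prod_sum fun _ x => diagInd₁ x]
  have : ∑ x, diagInd₁ x = 2 := by decide
  simp [this]

lemma sum_diagInd_mul_commSign (p : Fin m → Fin 4) :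
    ∑ q, diagInd q * commSign p q = 2 ^ m * diagInd p := by
  simp only [diagInd_eq_prod, commSign, ← Finset.prod_mul_distrib]
  rw [sum_prod_eq_prod_sum fun k x => diagInd₁ x * commSign₁ (p k) x]
  have : ∀ y : Fin 4, ∑ x, diagInd₁ x * commSign₁ y x = 2 * diagInd₁ y := by decide
  simp only [this, Finset.prod_mul_distrib]
  simp

lemma card_strings : ∑ _q : Fin m → Fin 4, (1 : ℤ) = 2 ^ m * 2 ^ m := by
  simp [← mul_pow]

lemma ncard_eq_sum {α : Type*} [Fintype α] (P : α → Prop) [DecidablePred P] :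
    ({q | P q}.ncard : ℤ) = ∑ q, if P q then (1 : ℤ) else 0 := by
  rw [Set.ncard_eq_toFinset_card', Finset.sum_boole]
  simp

-- With t, c the signs of transposition and commutation, the indicator is (1 - t)(1 + c)/4.
open Classical in
lemma four_mul_ncard_yStrings {p : Fin m → Fin 4} (hp : p ≠ 0) :
    (4 * {q | q ∈ yStrings m ∧ Commute (pauliString p) (pauliString q)}.ncard : ℤ) =
      2 ^ m * 2 ^ m - 2 ^ m - 2 ^ m * transSign p := by
  have : ∀ q : Fin m → Fin 4,
      4 * (if q ∈ yStrings m ∧ Commute (pauliString p) (pauliString q) then (1 : ℤ) else 0) =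
        1 - transSign q + commSign p q - transSign q * commSign p q := by
    intro q
    simp only [mem_yStrings, commute_pauliString_iff]
    rcases transSign_eq_or q with h | h <;> rcases commSign_eq_or p q with h' | h' <;> simp [h, h']
  rw [ncard_eq_sum, Finset.mul_sum, Finset.sum_congr rfl fun q _ => this q]
  simp only [Finset.sum_add_distrib, Finset.sum_sub_distrib, card_strings, sum_transSign,
    sum_commSign hp, sum_transSign_mul_commSign]
  ring

-- The indicator is (1 + t)(1 + c)/4 minus that of the commuting diagonal strings, d(1 + c)/2;
-- diagonal strings have t = 1.
open Classical in
lemma four_mul_ncard_xStrings {p : Fin m → Fin 4} (hp : p ≠ 0) :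
    (4 * {q | q ∈ xStrings m ∧ Commute (pauliString p) (pauliString q)}.ncard : ℤ) =
      2 ^ m * 2 ^ m - 2 ^ m + 2 ^ m * transSign p - 2 * (2 ^ m * diagInd p) := by
  have : ∀ q : Fin m → Fin 4,
      4 * (if q ∈ xStrings m ∧ Commute (pauliString p) (pauliString q) then (1 : ℤ) else 0) =
        1 + transSign q + commSign p q + transSign q * commSign p q -
          (2 * diagInd q + 2 * (diagInd q * commSign p q)) := by
    intro q
    simp only [mem_xStrings, commute_pauliString_iff, diagInd]
    by_cases hd : IsDiagString q
    · rcases commSign_eq_or p q with h' | h' <;> simp [hd, hd.transSign, h']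
    · rcases transSign_eq_or q with h | h <;> rcases commSign_eq_or p q with h' | h' <;>
        simp [hd, h, h']
  rw [ncard_eq_sum, Finset.mul_sum, Finset.sum_congr rfl fun q _ => this q]
  simp only [Finset.sum_add_distrib, Finset.sum_sub_distrib, card_strings, sum_transSign,
    sum_commSign hp, sum_transSign_mul_commSign, ← Finset.mul_sum, sum_diagInd,
    sum_diagInd_mul_commSign]
  ring

-- The indicator is d(1 + c)/2, except at the identity, which is diagonal and commutes with
-- everything but is not of type 𝒵.
open Classical in
lemma two_mul_ncard_zStrings (p : Fin m → Fin 4) :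
    (2 * {q | q ∈ zStrings m ∧ Commute (pauliString p) (pauliString q)}.ncard : ℤ) =
      2 ^ m + 2 ^ m * diagInd p - 2 := by
  have : ∀ q : Fin m → Fin 4,
      2 * (if q ∈ zStrings m ∧ Commute (pauliString p) (pauliString q) then (1 : ℤ) else 0) =
        diagInd q + diagInd q * commSign p q - if q = 0 then 2 else 0 := by
    intro q
    simp only [mem_zStrings, commute_pauliString_iff, diagInd]
    by_cases h0 : q = 0
    · subst h0
      have h1 : commSign p 0 = 1 := Finset.prod_eq_one fun k _ => by simp [commSign₁]
      have h2 : IsDiagString (0 : Fin m → Fin 4) := fun _ => Or.inl rfl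
      simp [h1, h2]
    · by_cases hd : IsDiagString q <;> rcases commSign_eq_or p q with h' | h' <;> simp [hd, h0, h']
  rw [ncard_eq_sum, Finset.mul_sum, Finset.sum_congr rfl fun q _ => this q]
  simp only [Finset.sum_add_distrib, Finset.sum_sub_distrib, sum_diagInd,
    sum_diagInd_mul_commSign, Finset.sum_ite_eq', Finset.mem_univ, if_true]

theorem ncard_commute_of_mem_xStrings {p : Fin m → Fin 4} (hp : p ∈ xStrings m) :
    4 * {q | q ∈ xStrings m ∧ Commute (pauliString p) (pauliString q)}.ncard = (2 ^ m) ^ 2 ∧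
    4 * {q | q ∈ yStrings m ∧ Commute (pauliString p) (pauliString q)}.ncard + 2 * 2 ^ m =
      (2 ^ m) ^ 2 ∧
    2 * {q | q ∈ zStrings m ∧ Commute (pauliString p) (pauliString q)}.ncard + 2 = 2 ^ m := by
  obtain ⟨hs, hd⟩ := mem_xStrings.mp hp
  have h0 : p ≠ 0 := by rintro rfl; exact hd fun _ => Or.inl rfl
  have hx := four_mul_ncard_xStrings h0
  have hy := four_mul_ncard_yStrings h0
  have hz := two_mul_ncard_zStrings p
  simp only [hs, diagInd, hd, if_false] at hx hy hz
  zify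
  exact ⟨by linarith, by linarith, by linarith⟩

theorem ncard_commute_of_mem_yStrings {p : Fin m → Fin 4} (hp : p ∈ yStrings m) :
    4 * {q | q ∈ yStrings m ∧ Commute (pauliString p) (pauliString q)}.ncard = (2 ^ m) ^ 2 ∧
    4 * {q | q ∈ xStrings m ∧ Commute (pauliString p) (pauliString q)}.ncard + 2 * 2 ^ m =
      (2 ^ m) ^ 2 ∧
    2 * {q | q ∈ zStrings m ∧ Commute (pauliString p) (pauliString q)}.ncard + 2 = 2 ^ m := by
  have hs := mem_yStrings.mp hp
  have hd : ¬ IsDiagString p := fun h => by rw [h.transSign] at hs; norm_num at hs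
  have h0 : p ≠ 0 := by rintro rfl; exact hd fun _ => Or.inl rfl
  have hx := four_mul_ncard_xStrings h0
  have hy := four_mul_ncard_yStrings h0
  have hz := two_mul_ncard_zStrings p
  simp only [hs, diagInd, hd, if_false] at hx hy hz
  zify
  exact ⟨by linarith, by linarith, by linarith⟩

theorem ncard_commute_of_mem_zStrings {p : Fin m → Fin 4} (hp : p ∈ zStrings m) :
    4 * {q | q ∈ xStrings m ∧ Commute (pauliString p) (pauliString q)}.ncard + 2 * 2 ^ m =
      (2 ^ m) ^ 2 ∧
    4 * {q | q ∈ yStrings m ∧ Commute (pauliString p) (pauliString q)}.ncard + 2 * 2 ^ m =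
      (2 ^ m) ^ 2 := by
  obtain ⟨hd, h0⟩ := mem_zStrings.mp hp
  have hx := four_mul_ncard_xStrings h0
  have hy := four_mul_ncard_yStrings h0
  simp only [hd.transSign, diagInd, hd, if_true] at hx hy
  zify
  exact ⟨by linarith, by linarith⟩

/-! ### Counting generators -/

lemma sympSign_gen (a : Gen m) : sympSign a.1 = -1 := mem_genLabels.mp a.2

/-- Twice the indicator of the generators is 1 - `sympSign`, which converts sums over generators
into factorizable sums over all Pauli operators. -/
lemma sum_gen (f : (Fin m → Fin 4) × Fin 4 → ℤ) :
    2 * ∑ a : Gen m, f a.1 = ∑ a, (f a - sympSign a * f a) := by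
  rw [Finset.sum_coe_sort (genLabels m) f, ← Finset.sum_filter_add_sum_filter_not Finset.univ
    (fun a => a ∈ genLabels m) (fun a => f a - sympSign a * f a), Finset.mul_sum]
  rw [Finset.filter_univ_mem, Finset.sum_eq_zero (s := Finset.filter _ _), add_zero]
  · refine Finset.sum_congr rfl fun a ha => ?_
    rw [mem_genLabels.mp ha]
    ring
  · intro a ha
    rw [Finset.mem_filter, mem_genLabels] at ha
    rw [(sympSign_eq_or a).resolve_right ha.2]
    ring

theorem card_gen : Fintype.card (Gen m) = 2 ^ m * (2 * 2 ^ m + 1) := by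
  have h := sum_gen (m := m) fun _ => 1
  have h4 : ∑ x, sympSign₁ x = -2 := by decide
  simp only [mul_one, Finset.sum_sub_distrib, Fintype.sum_prod_type, sympSign, ← Finset.mul_sum,
    h4, ← Finset.sum_mul, sum_transSign, Finset.sum_const, Finset.card_univ, nsmul_eq_mul] at h
  have h5 : (Fintype.card ((Fin m → Fin 4) × Fin 4) : ℤ) = 2 ^ m * 2 ^ m * 4 := by
    simp [← mul_pow]
  rw [h5] at h
  zify
  linarith

/-- Let n = 2 ^ m. The commutation signs with a generator sum to 0 over all Pauli operators and to
2n when weighted by `sympSign`, hence to -n over the generators. The anticommuting ones therefore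
number (n(2n+1) + n)/2. -/
theorem card_anticommuting_gen (a : Gen m) :
    (Finset.univ.filter fun b : Gen m => opCommSign a.1 b.1 = -1).card =
      2 ^ m * (2 ^ m + 1) := by
  have h := sum_gen (m := m) fun b => opCommSign a.1 b
  have h1 : ∑ b : Gen m, opCommSign a.1 b.1 = Fintype.card (Gen m) -
      2 * (Finset.univ.filter fun b : Gen m => opCommSign a.1 b.1 = -1).card := by
    have : ∀ b : Gen m, opCommSign a.1 b.1 = 1 - 2 * if opCommSign a.1 b.1 = -1 then 1 else 0 := by
      intro b
      rcases opCommSign_eq_or a.1 b.1 with h | h <;> simp [h]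
    rw [Finset.sum_congr rfl fun b _ => this b]
    rw [Finset.sum_sub_distrib, ← Finset.mul_sum, Finset.sum_boole, Finset.sum_const]
    simp
  have h2 : ∑ b, opCommSign a.1 b = 0 := by
    simp only [opCommSign, Fintype.sum_prod_type, ← Finset.mul_sum, ← Finset.sum_mul]
    by_cases hp : a.1.1 = 0
    · have hk : a.1.2 ≠ 0 := by
        intro hk
        have := sympSign_gen a
        simp [sympSign, hp, hk, transSign, transSign₁, sympSign₁] at this
      have : ∀ y : Fin 4, y ≠ 0 → ∑ x, commSign₁ y x = 0 := by decide
      rw [this _ hk, mul_zero]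
    · rw [sum_commSign hp, zero_mul]
  have h3 : ∑ b, sympSign b * opCommSign a.1 b = 2 * 2 ^ m := by
    simp only [sympSign, opCommSign, Fintype.sum_prod_type, mul_mul_mul_comm, ← Finset.mul_sum,
      ← Finset.sum_mul, sum_transSign_mul_commSign]
    have : ∀ y : Fin 4, ∑ x, sympSign₁ x * commSign₁ y x = -2 * sympSign₁ y := by decide
    rw [this]
    have := sympSign_gen a
    unfold sympSign at this
    linear_combination (-2 * 2 ^ m) * this
  rw [Finset.sum_sub_distrib, h1, h2, h3, card_gen] at h
  push_cast at h
  zify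
  linarith

end SpAKLT

namespace SpAKLT

variable {m : ℕ}

/-! ### Expansion in orthogonal bases of matrices -/

/-- Orthogonality for the trace form gives linear independence, the number of elements makes the
family a basis, and traces read off the coefficients. -/
lemma eq_sum_trace_smul {ι κ : Type*} [Fintype ι] [Fintype κ] [DecidableEq ι] [DecidableEq κ]
    {P : κ → Matrix ι ι ℂ} {d : ℂ} (hd : d ≠ 0)
    (hP : ∀ a b, (P a * P b).trace = if a = b then d else 0)
    (hcard : Fintype.card κ = Fintype.card ι * Fintype.card ι) (A : Matrix ι ι ℂ) :
    A = ∑ a, ((P a * A).trace / d) • P a := by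
  have htr : ∀ (c : κ → ℂ) (a : κ), (P a * ∑ b, c b • P b).trace = c a * d := by
    intro c a
    simp [Finset.mul_sum, Matrix.trace_sum, Matrix.trace_smul, hP]
  have hli : LinearIndependent ℂ P := by
    rw [Fintype.linearIndependent_iff]
    intro c hc a
    have := htr c a
    rw [hc, mul_zero, Matrix.trace_zero] at this
    exact (mul_eq_zero.mp this.symm).resolve_right hd
  have hspan : Submodule.span ℂ (Set.range P) = ⊤ := by
    apply hli.span_eq_top_of_card_eq_finrank'
    rw [hcard, Module.finrank_matrix, Module.finrank_self, mul_one]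
  have hA : A ∈ Submodule.span ℂ (Set.range P) := hspan ▸ Submodule.mem_top
  obtain ⟨c, rfl⟩ := (Submodule.mem_span_range_iff_exists_fun ℂ).mp hA
  refine Finset.sum_congr rfl fun a _ => ?_
  rw [htr, mul_div_cancel_right₀ _ hd]

lemma eq_sum_pauliString (A : Matrix (Qubits m) (Qubits m) ℂ) :
    A = ∑ p, ((pauliString p * A).trace / 2 ^ m) • pauliString p :=
  eq_sum_trace_smul (by simp) pauliString_trace_mul (by simp [← mul_pow]) A

lemma eq_sum_pauliOp (A : Matrix (Qubits m ⊕ Qubits m) (Qubits m ⊕ Qubits m) ℂ) :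
    A = ∑ a, ((pauliOp a * A).trace / 2 ^ (m + 1)) • pauliOp a :=
  eq_sum_trace_smul (by simp) pauliOp_trace_mul (by
    have : (4 : ℕ) ^ m = 2 ^ m * 2 ^ m := by rw [← mul_pow]; norm_num
    simp only [Fintype.card_prod, Fintype.card_pi, Fintype.card_fin, Finset.prod_const,
      Finset.card_univ, Fintype.card_sum, this]
    ring) A

/-! ### Real spans of Pauli strings and of Gell-Mann matrices -/

section RealSubspaces

variable (ι : Type*)

/-- Real symmetric matrices with zero diagonal. -/
def realSymmOffDiag : Submodule ℝ (Matrix ι ι ℂ) where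
  carrier := {A | Aᴴ = A ∧ Aᵀ = A ∧ ∀ x, A x x = 0}
  add_mem' := by
    rintro A B ⟨h1, h2, h3⟩ ⟨h1', h2', h3'⟩
    exact ⟨by rw [Matrix.conjTranspose_add, h1, h1'], by rw [Matrix.transpose_add, h2, h2'],
      fun x => by rw [Matrix.add_apply, h3, h3', add_zero]⟩
  zero_mem' := by simp
  smul_mem' := by
    rintro c A ⟨h1, h2, h3⟩
    exact ⟨by rw [Matrix.conjTranspose_smul, h1, star_trivial], by rw [Matrix.transpose_smul, h2],
      fun x => by rw [Matrix.smul_apply, h3, smul_zero]⟩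

/-- Imaginary antisymmetric matrices. -/
def imagAntisymm : Submodule ℝ (Matrix ι ι ℂ) where
  carrier := {A | Aᴴ = A ∧ Aᵀ = -A}
  add_mem' := by
    rintro A B ⟨h1, h2⟩ ⟨h1', h2'⟩
    exact ⟨by rw [Matrix.conjTranspose_add, h1, h1'], by rw [Matrix.transpose_add, h2, h2', neg_add]⟩
  zero_mem' := by simp
  smul_mem' := by
    rintro c A ⟨h1, h2⟩
    exact ⟨by rw [Matrix.conjTranspose_smul, h1, star_trivial],
      by rw [Matrix.transpose_smul, h2, smul_neg]⟩

/-- Real diagonal matrices of trace zero. -/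
def realDiagTraceless [Fintype ι] : Submodule ℝ (Matrix ι ι ℂ) where
  carrier := {A | Aᴴ = A ∧ (∀ x y, x ≠ y → A x y = 0) ∧ A.trace = 0}
  add_mem' := by
    rintro A B ⟨h1, h2, h3⟩ ⟨h1', h2', h3'⟩
    exact ⟨by rw [Matrix.conjTranspose_add, h1, h1'],
      fun x y h => by rw [Matrix.add_apply, h2 x y h, h2' x y h, add_zero],
      by rw [Matrix.trace_add, h3, h3', add_zero]⟩
  zero_mem' := by simp
  smul_mem' := by
    rintro c A ⟨h1, h2, h3⟩
    exact ⟨by rw [Matrix.conjTranspose_smul, h1, star_trivial],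
      fun x y h => by rw [Matrix.smul_apply, h2 x y h, smul_zero],
      by rw [Matrix.trace_smul, h3, smul_zero]⟩

end RealSubspaces

/-- The coefficients of a Hermitian matrix in Hermitian strings are real. Membership in a span thus
reduces to the vanishing of traces against the other strings, which follows below from transposition
parity or from disjoint supports. -/
lemma mem_span_pauliString {S : Set (Fin m → Fin 4)} {A : Matrix (Qubits m) (Qubits m) ℂ}
    (hA : Aᴴ = A) (hS : ∀ p ∉ S, (pauliString p * A).trace = 0) :
    A ∈ Submodule.span ℝ (pauliString '' S) := by
  rw [eq_sum_pauliString A]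
  refine Submodule.sum_mem _ fun p _ => ?_
  by_cases hp : p ∈ S
  · have hreal : starRingEnd ℂ (pauliString p * A).trace = (pauliString p * A).trace := by
      have := Matrix.trace_conjTranspose (pauliString p * A)
      rw [Matrix.conjTranspose_mul, hA, pauliString_conjTranspose, Matrix.trace_mul_comm] at this
      exact this.symm
    obtain ⟨r, hr⟩ := Complex.conj_eq_iff_real.mp hreal
    have : ((pauliString p * A).trace / 2 ^ m) • pauliString p =
        (r / 2 ^ m : ℝ) • pauliString p := by
      rw [hr, ← Complex.coe_smul]
      push_cast
      rfl
    rw [this]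
    exact Submodule.smul_mem _ _ (Submodule.subset_span ⟨p, hp, rfl⟩)
  · rw [hS p hp, zero_div, zero_smul]
    exact Submodule.zero_mem _

lemma trace_mul_eq_zero_of_transpose {ι : Type*} [Fintype ι] {A B : Matrix ι ι ℂ} (z w : ℂ)
    (hA : Aᵀ = z • A) (hB : Bᵀ = w • B) (h : z * w = -1) : (A * B).trace = 0 := by
  have := Matrix.trace_transpose (A * B)
  rw [Matrix.transpose_mul, hA, hB, Matrix.smul_mul, Matrix.mul_smul, smul_smul,
    Matrix.trace_smul, mul_comm w z, h, Matrix.trace_mul_comm, neg_smul, one_smul] at this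
  exact self_eq_neg.mp this.symm

lemma pauliString_apply_of_ne {p : Fin m → Fin 4} (hp : IsDiagString p) {x y : Qubits m}
    (hxy : x ≠ y) : pauliString p x y = 0 := by
  obtain ⟨k, hk⟩ := Function.ne_iff.mp hxy
  refine Finset.prod_eq_zero (Finset.mem_univ k) ?_
  revert hk
  rcases hp k with h | h <;> rw [h] <;> generalize x k = a <;> generalize y k = b <;>
    fin_cases a <;> fin_cases b <;> simp [pauli]

lemma pauliString_apply_self {p : Fin m → Fin 4} (hp : ¬ IsDiagString p) (x : Qubits m) :
    pauliString p x x = 0 := by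
  obtain ⟨k, hk⟩ := not_isDiagString.mp hp
  refine Finset.prod_eq_zero (Finset.mem_univ k) ?_
  rcases hk with h | h <;> rw [h] <;> generalize x k = a <;> fin_cases a <;> simp [pauli]

lemma trace_mul_eq_zero_of_diag {ι : Type*} [Fintype ι] {A B : Matrix ι ι ℂ}
    (hA : ∀ x y, x ≠ y → A x y = 0) (hB : ∀ x, B x x = 0) : (A * B).trace = 0 := by
  refine Finset.sum_eq_zero fun x _ => Finset.sum_eq_zero fun y _ => ?_
  change A x y * B y x = 0
  by_cases h : x = y
  · rw [h, hB, mul_zero]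
  · rw [hA _ _ h, zero_mul]

lemma span_xStrings : Submodule.span ℝ (pauliString '' (xStrings m : Set (Fin m → Fin 4))) =
    realSymmOffDiag (Qubits m) := by
  apply le_antisymm
  · rw [Submodule.span_le]
    rintro _ ⟨p, hp, rfl⟩
    obtain ⟨hs, hd⟩ := mem_xStrings.mp hp
    exact ⟨pauliString_conjTranspose p, by simp [pauliString_transpose, hs],
      pauliString_apply_self hd⟩
  · rintro A ⟨h1, h2, h3⟩
    refine mem_span_pauliString h1 fun p hp => ?_
    by_cases hd : IsDiagString p
    · exact trace_mul_eq_zero_of_diag (fun x y => pauliString_apply_of_ne hd) h3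
    · have hs := (transSign_eq_or p).resolve_left fun hs => hp (mem_xStrings.mpr ⟨hs, hd⟩)
      exact trace_mul_eq_zero_of_transpose _ 1 (pauliString_transpose p) (by rw [h2, one_smul])
        (by simp [hs])

lemma span_yStrings : Submodule.span ℝ (pauliString '' (yStrings m : Set (Fin m → Fin 4))) =
    imagAntisymm (Qubits m) := by
  apply le_antisymm
  · rw [Submodule.span_le]
    rintro _ ⟨p, hp, rfl⟩
    have hs := mem_yStrings.mp hp
    exact ⟨pauliString_conjTranspose p, by simp [pauliString_transpose, hs]⟩
  · rintro A ⟨h1, h2⟩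
    refine mem_span_pauliString h1 fun p hp => ?_
    have hs := (transSign_eq_or p).resolve_right fun hs => hp (mem_yStrings.mpr hs)
    exact trace_mul_eq_zero_of_transpose _ (-1) (pauliString_transpose p)
      (by rw [h2, neg_smul, one_smul]) (by simp [hs])

lemma pauliString_zero : pauliString (0 : Fin m → Fin 4) = 1 := tensorPow_one

lemma span_zStrings : Submodule.span ℝ (pauliString '' (zStrings m : Set (Fin m → Fin 4))) =
    realDiagTraceless (Qubits m) := by
  apply le_antisymm
  · rw [Submodule.span_le]
    rintro _ ⟨p, hp, rfl⟩
    obtain ⟨hd, h0⟩ := mem_zStrings.mp hp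
    refine ⟨pauliString_conjTranspose p, fun x y => pauliString_apply_of_ne hd, ?_⟩
    have := pauliString_trace_mul 0 p
    rwa [pauliString_zero, one_mul, if_neg (Ne.symm h0)] at this
  · rintro A ⟨h1, h2, h3⟩
    refine mem_span_pauliString h1 fun p hp => ?_
    by_cases hd : IsDiagString p
    · have h0 : p = 0 := by
        by_contra h0
        exact hp (mem_zStrings.mpr ⟨hd, h0⟩)
      rw [h0, pauliString_zero, one_mul, h3]
    · rw [Matrix.trace_mul_comm]
      exact trace_mul_eq_zero_of_diag h2 (pauliString_apply_self hd)

/-! ### Gell-Mann matrices span the same three real subspaces. -/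

section GellMann

variable {n : ℕ}

lemma conj_eq_of_conjTranspose {ι : Type*} {A : Matrix ι ι ℂ} (h : Aᴴ = A) (i j : ι) :
    starRingEnd ℂ (A i j) = A j i := congrFun (congrFun h j) i

lemma span_gellMannX : Submodule.span ℝ {A | ∃ i j : Fin n, i < j ∧ A = gellMannX i j} =
    realSymmOffDiag (Fin n) := by
  apply le_antisymm
  · rw [Submodule.span_le]
    rintro _ ⟨i, j, hij, rfl⟩
    refine ⟨?_, ?_, fun x => ?_⟩
    · simp [gellMannX, Matrix.conjTranspose_single, add_comm]
    · simp [gellMannX, Matrix.transpose_single, add_comm]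
    · simp only [gellMannX, Matrix.smul_apply, Matrix.add_apply, Matrix.single_apply]
      rw [if_neg, if_neg] <;> simp <;> omega
  · rintro A ⟨h1, h2, h3⟩
    have hre : ∀ i j, A i j = ((A i j).re : ℂ) := fun i j => by
      rw [eq_comm, ← Complex.conj_eq_iff_re, conj_eq_of_conjTranspose h1]
      exact congrFun (congrFun h2 i) j
    -- Averaging the expansions of A and Aᵀ in matrix units produces the factor 1/2 of `gellMannX`.
    -- The sum runs over all pairs; both orders of a pair give the same matrix.
    have hA : A = ∑ i, ∑ j, (A i j).re • gellMannX i j := by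
      have h4 : A = (1 / 2 : ℂ) • (A + Aᵀ) := by rw [h2, ← two_smul ℂ A, smul_smul]; simp
      have h5 : A = ∑ i, ∑ j, ((A i j).re : ℂ) • Matrix.single i j (1 : ℂ) := by
        conv_lhs => rw [Matrix.matrix_eq_sum_single A]
        simp [← hre]
      have h6 : Aᵀ = ∑ i, ∑ j, ((A i j).re : ℂ) • Matrix.single j i (1 : ℂ) := by
        conv_lhs => rw [h5]
        simp [Matrix.transpose_sum, Matrix.transpose_single]
      refine h4.trans ?_
      rw [h6]
      nth_rewrite 1 [h5]
      simp only [← Finset.sum_add_distrib, Finset.smul_sum, gellMannX, ← Complex.coe_smul,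
        ← smul_add, smul_comm (1 / 2 : ℂ)]
    rw [hA]
    refine Submodule.sum_mem _ fun i _ => Submodule.sum_mem _ fun j _ => ?_
    rcases lt_trichotomy i j with h | rfl | h
    · exact Submodule.smul_mem _ _ (Submodule.subset_span ⟨i, j, h, rfl⟩)
    · simp [h3]
    · exact Submodule.smul_mem _ _ (Submodule.subset_span ⟨j, i, h, by
        simp [gellMannX, add_comm]⟩)

lemma span_gellMannY : Submodule.span ℝ {A | ∃ i j : Fin n, i < j ∧ A = gellMannY i j} =
    imagAntisymm (Fin n) := by
  apply le_antisymm
  · rw [Submodule.span_le]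
    rintro _ ⟨i, j, hij, rfl⟩
    refine ⟨?_, ?_⟩
    · simp only [gellMannY, Matrix.conjTranspose_smul, Matrix.conjTranspose_sub,
        Matrix.conjTranspose_single]
      simp [← smul_neg, neg_div]
    · simp only [gellMannY, Matrix.transpose_smul, Matrix.transpose_sub, Matrix.transpose_single,
        ← smul_neg, neg_sub]
  · rintro A ⟨h1, h2⟩
    have hre : ∀ i j, A i j = ((A i j).im : ℂ) * Complex.I := fun i j => by
      have h3 := conj_eq_of_conjTranspose h1 i j
      have h4 : A j i = -A i j := congrFun (congrFun h2 i) j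
      rw [h4] at h3
      have h5 := congrArg Complex.re h3
      rw [Complex.conj_re, Complex.neg_re] at h5
      apply Complex.ext <;> simp
      linarith
    have hA : A = ∑ i, ∑ j, (-(A i j).im) • gellMannY i j := by
      have h4 : A = (1 / 2 : ℂ) • (A - Aᵀ) := by
        rw [h2, sub_neg_eq_add, ← two_smul ℂ A, smul_smul]; simp
      have h5 : A = ∑ i, ∑ j, (((A i j).im : ℂ) * Complex.I) • Matrix.single i j (1 : ℂ) := by
        conv_lhs => rw [Matrix.matrix_eq_sum_single A]
        simp [← hre]
      have h6 : Aᵀ = ∑ i, ∑ j, (((A i j).im : ℂ) * Complex.I) • Matrix.single j i (1 : ℂ) := by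
        conv_lhs => rw [h5]
        simp [Matrix.transpose_sum, Matrix.transpose_single]
      refine h4.trans ?_
      rw [h6]
      nth_rewrite 1 [h5]
      simp only [← Finset.sum_sub_distrib, Finset.smul_sum, gellMannY, ← Complex.coe_smul,
        ← smul_sub, smul_smul]
      refine Finset.sum_congr rfl fun i _ => Finset.sum_congr rfl fun j _ => ?_
      congr 1
      push_cast
      ring
    rw [hA]
    refine Submodule.sum_mem _ fun i _ => Submodule.sum_mem _ fun j _ => ?_
    rcases lt_trichotomy i j with h | rfl | h
    · exact Submodule.smul_mem _ _ (Submodule.subset_span ⟨i, j, h, rfl⟩)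
    · simp [gellMannY]
    · have : gellMannY i j = -gellMannY j i := by
        rw [gellMannY, gellMannY, ← smul_neg, neg_sub]
      rw [this]
      exact Submodule.smul_mem _ _ (Submodule.neg_mem _ (Submodule.subset_span ⟨j, i, h, rfl⟩))

lemma gellMannZ_apply (j a b : Fin n) : gellMannZ j a b =
    ((Real.sqrt (2 * ((j : ℝ) + 1) * (j : ℝ)) : ℂ))⁻¹ *
      if a = b then (if a < j then 1 else if a = j then -(j : ℂ) else 0) else 0 := by
  simp only [gellMannZ, Matrix.smul_apply, Matrix.sub_apply, Matrix.sum_apply, smul_eq_mul,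
    Matrix.single_apply]
  congr 1
  by_cases hab : a = b
  · subst hab
    simp only [and_self, if_true]
    rcases lt_trichotomy a j with h | rfl | h
    · simp [h, h.ne', Finset.sum_ite_eq']
    · simp
    · simp [h.not_gt, h.ne, h.ne', Finset.sum_ite_eq']
  · rw [if_neg hab, Finset.sum_eq_zero, if_neg]
    · simp
    · rintro ⟨rfl, h⟩
      exact hab h
    · intro i _
      rw [if_neg]
      rintro ⟨rfl, h⟩
      exact hab h

lemma gellMannZ_mem (j : Fin n) : gellMannZ j ∈ realDiagTraceless (Fin n) := by
  refine ⟨?_, fun x y h => ?_, ?_⟩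
  · ext a b
    rw [Matrix.conjTranspose_apply, gellMannZ_apply, gellMannZ_apply]
    by_cases h : a = b
    · subst h
      simp only [if_true]
      split_ifs <;> simp
    · simp [h, Ne.symm h]
  · rw [gellMannZ_apply, if_neg h, mul_zero]
  · simp only [Matrix.trace, Matrix.diag_apply, gellMannZ_apply, if_true, ← Finset.mul_sum]
    have : ∀ a : Fin n, (if a < j then (1 : ℂ) else if a = j then -(j : ℂ) else 0) =
        (if a < j then 1 else 0) + if a = j then -(j : ℂ) else 0 := by
      intro a
      rcases lt_trichotomy a j with h | rfl | h
      · simp [h, h.ne]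
      · simp
      · simp [h.not_gt]
    simp only [this, Finset.sum_add_distrib, Finset.sum_boole, Finset.sum_ite_eq', Finset.mem_univ,
      if_true]
    have hc : (Finset.univ.filter fun a : Fin n => a < j).card = (j : ℕ) := by
      rw [Finset.filter_gt_eq_Iio, Fin.card_Iio]
    rw [hc]
    simp

/-- Gaussian elimination from the bottom: the last nonzero diagonal entry of `gellMannZ j` is in row
j, so a multiple of it clears row k of A without disturbing the rows below. -/
lemma mem_span_gellMannZ (k : ℕ) (A : Matrix (Fin n) (Fin n) ℂ)
    (hA : A ∈ realDiagTraceless (Fin n)) (hk : ∀ a : Fin n, k ≤ a → A a a = 0) :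
    A ∈ Submodule.span ℝ {A | ∃ j : Fin n, 0 < (j : ℕ) ∧ A = gellMannZ j} := by
  induction k generalizing A with
  | zero =>
    have : A = 0 := by
      ext a b
      by_cases h : a = b
      · subst h; exact hk a (Nat.zero_le _)
      · exact hA.2.1 a b h
    rw [this]
    exact Submodule.zero_mem _
  | succ k ih =>
    by_cases hkn : k < n
    · set j : Fin n := ⟨k, hkn⟩
      rcases Nat.eq_zero_or_pos k with h0 | h0
      · refine ih A hA fun a ha => ?_
        by_cases hak : (a : ℕ) = k
        · have htr := hA.2.2
          rw [Matrix.trace, Finset.sum_eq_single a] at htr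
          · exact htr
          · intro b _ hb
            refine hk b ?_
            have : (b : ℕ) ≠ a := fun h => hb (Fin.ext h)
            omega
          · simp
        · exact hk a (by omega)
      · set w : ℝ := Real.sqrt (2 * ((j : ℝ) + 1) * (j : ℝ)) with hw
        have hj : (0 : ℝ) < (j : ℕ) := Nat.cast_pos.mpr h0
        have hw0 : w ≠ 0 := (Real.sqrt_pos.mpr (by positivity)).ne'
        have hre : ((A j j).re : ℂ) = A j j :=
          Complex.conj_eq_iff_re.mp (conj_eq_of_conjTranspose hA.1 j j)
        have hjj : gellMannZ j j j = -((j : ℕ) : ℂ) / w := by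
          rw [gellMannZ_apply, if_pos rfl, if_neg (lt_irrefl _), if_pos rfl, ← hw]
          ring
        -- The entry of `gellMannZ j` at (j, j) is -j/w, so this multiple cancels that of A.
        have hmem := ih (A + ((A j j).re * w / (j : ℕ) : ℝ) • gellMannZ j)
          (Submodule.add_mem _ hA (Submodule.smul_mem _ _ (gellMannZ_mem j))) (by
            intro a ha
            rw [Matrix.add_apply, Matrix.smul_apply]
            by_cases hak : a = j
            · subst hak
              rw [hjj, Complex.real_smul]
              push_cast
              rw [hre]
              have h1 : ((j : ℕ) : ℂ) ≠ 0 := by exact_mod_cast hj.ne'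
              have h2 : (w : ℂ) ≠ 0 := by exact_mod_cast hw0
              field_simp
              ring
            · have h1 : (a : ℕ) ≠ k := fun h => hak (Fin.ext h)
              have h2 : ¬ a < j := fun h => by
                have : (a : ℕ) < k := h
                omega
              rw [hk a (by omega), gellMannZ_apply, if_pos rfl, if_neg h2, if_neg hak]
              simp)
        have := Submodule.sub_mem _ hmem (Submodule.smul_mem _ ((A j j).re * w / (j : ℕ) : ℝ)
          (Submodule.subset_span ⟨j, h0, rfl⟩))
        simpa using this
    · exact ih A hA fun a ha => absurd a.2 (by omega)

lemma span_gellMannZ : Submodule.span ℝ {A | ∃ j : Fin n, 0 < (j : ℕ) ∧ A = gellMannZ j} =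
    realDiagTraceless (Fin n) := by
  apply le_antisymm
  · rw [Submodule.span_le]
    rintro _ ⟨j, _, rfl⟩
    exact gellMannZ_mem j
  · intro A hA
    exact mem_span_gellMannZ n A hA fun a ha => absurd a.2 (by omega)

end GellMann

lemma span_toQubits {S : Set (Matrix (Fin (2 ^ m)) (Fin (2 ^ m)) ℂ)}
    {W : Submodule ℝ (Matrix (Fin (2 ^ m)) (Fin (2 ^ m)) ℂ)}
    {W' : Submodule ℝ (Matrix (Qubits m) (Qubits m) ℂ)}
    (h : Submodule.span ℝ S = W) (hW : ∀ A, toQubits A ∈ W' ↔ A ∈ W) :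
    Submodule.span ℝ (toQubits '' S) = W' := by
  have himg : toQubits '' S = (Matrix.reindexLinearEquiv ℝ ℂ
      finFunctionFinEquiv.symm finFunctionFinEquiv.symm).toLinearMap '' S := rfl
  rw [himg, ← Submodule.map_span, h]
  ext B
  obtain ⟨A, rfl⟩ := (Matrix.reindex (finFunctionFinEquiv (m := 2) (n := m)).symm
    (finFunctionFinEquiv (m := 2) (n := m)).symm).surjective B
  refine Iff.trans ?_ (hW A).symm
  constructor
  · rintro ⟨A', hA', h'⟩
    have : A' = A := (Matrix.reindex (finFunctionFinEquiv (m := 2) (n := m)).symm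
      (finFunctionFinEquiv (m := 2) (n := m)).symm).injective h'
    exact this ▸ hA'
  · exact fun hA => ⟨A, hA, rfl⟩

lemma toQubits_eq_iff {A B : Matrix (Fin (2 ^ m)) (Fin (2 ^ m)) ℂ} :
    toQubits A = toQubits B ↔ A = B := Equiv.apply_eq_iff_eq _

theorem span_toQubits_gellMannX :
    Submodule.span ℝ {A | ∃ i j : Fin (2 ^ m), i < j ∧ A = toQubits (gellMannX i j)} =
      realSymmOffDiag (Qubits m) := by
  refine Eq.trans ?_ (span_toQubits span_gellMannX ?_)
  · congr 1
    ext A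
    constructor
    · rintro ⟨i, j, h, rfl⟩
      exact ⟨_, ⟨i, j, h, rfl⟩, rfl⟩
    · rintro ⟨_, ⟨i, j, h, rfl⟩, rfl⟩
      exact ⟨i, j, h, rfl⟩
  · intro A
    refine and_congr ?_ (and_congr ?_ ?_)
    · exact toQubits_eq_iff (A := Aᴴ)
    · exact toQubits_eq_iff (A := Aᵀ)
    · exact finFunctionFinEquiv.forall_congr_right (q := fun x => A x x = 0)

theorem span_toQubits_gellMannY :
    Submodule.span ℝ {A | ∃ i j : Fin (2 ^ m), i < j ∧ A = toQubits (gellMannY i j)} =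
      imagAntisymm (Qubits m) := by
  refine Eq.trans ?_ (span_toQubits span_gellMannY ?_)
  · congr 1
    ext A
    constructor
    · rintro ⟨i, j, h, rfl⟩
      exact ⟨_, ⟨i, j, h, rfl⟩, rfl⟩
    · rintro ⟨_, ⟨i, j, h, rfl⟩, rfl⟩
      exact ⟨i, j, h, rfl⟩
  · intro A
    refine and_congr ?_ ?_
    · exact toQubits_eq_iff (A := Aᴴ)
    · exact toQubits_eq_iff (A := Aᵀ) (B := -A)

theorem span_toQubits_gellMannZ :
    Submodule.span ℝ {A | ∃ j : Fin (2 ^ m), 0 < (j : ℕ) ∧ A = toQubits (gellMannZ j)} =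
      realDiagTraceless (Qubits m) := by
  refine Eq.trans ?_ (span_toQubits span_gellMannZ ?_)
  · congr 1
    ext A
    constructor
    · rintro ⟨j, h, rfl⟩
      exact ⟨_, ⟨j, h, rfl⟩, rfl⟩
    · rintro ⟨_, ⟨j, h, rfl⟩, rfl⟩
      exact ⟨j, h, rfl⟩
  · intro A
    refine and_congr ?_ (and_congr ?_ ?_)
    · exact toQubits_eq_iff (A := Aᴴ)
    · constructor
      · intro h x y hxy
        simpa [toQubits] using h (finFunctionFinEquiv.symm x) (finFunctionFinEquiv.symm y)
          (by simpa using hxy)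
      · intro h x y hxy
        exact h _ _ (by simpa using hxy)
    · have : (toQubits A).trace = A.trace :=
        finFunctionFinEquiv.sum_comp fun x => A x x
      rw [this]

end SpAKLT

namespace SpAKLT

/-! ### The compact symplectic group and the Kraus operators -/

section Symplectic

variable {l : Type} [Fintype l] [DecidableEq l]

lemma J_mul_J : Matrix.J l ℂ * Matrix.J l ℂ = -1 := Matrix.J_squared l ℂ

lemma J_mul_J_mul (A : Matrix (l ⊕ l) (l ⊕ l) ℂ) :
    Matrix.J l ℂ * (Matrix.J l ℂ * A) = -A := by
  rw [← mul_assoc, J_mul_J, neg_one_mul]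

lemma J_map_conj {l : Type} [DecidableEq l] : (Matrix.J l ℂ).map (starRingEnd ℂ) = Matrix.J l ℂ := by
  ext a b
  rcases a with a | a <;> rcases b with b | b <;>
    simp [Matrix.J, Matrix.one_apply, apply_ite (starRingEnd ℂ)]

lemma map_conj_map_conj {ι κ : Type*} (A : Matrix ι κ ℂ) :
    (A.map (starRingEnd ℂ)).map (starRingEnd ℂ) = A := by
  ext
  simp

lemma mem_sp_iff {A : Matrix (l ⊕ l) (l ⊕ l) ℂ} :
    A ∈ LieAlgebra.Symplectic.sp l ℂ ↔ Matrix.J l ℂ * Aᵀ = -(A * Matrix.J l ℂ) := by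
  rw [LieAlgebra.Symplectic.sp, mem_skewAdjointMatricesLieSubalgebra,
    mem_skewAdjointMatricesSubmodule]
  change Aᵀ * Matrix.J l ℂ = Matrix.J l ℂ * -A ↔ _
  constructor
  · intro h
    have := congrArg (fun B => Matrix.J l ℂ * B * Matrix.J l ℂ) h
    simp only [mul_neg, J_mul_J_mul, neg_neg, mul_assoc, J_mul_J, mul_one] at this
    rw [← this, neg_neg]
  · intro h
    have := congrArg (fun B => Matrix.J l ℂ * B * Matrix.J l ℂ) h
    simp only [mul_neg, neg_mul, J_mul_J_mul, neg_neg, mul_assoc, J_mul_J, mul_one] at this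
    rw [mul_neg, ← this, neg_neg]

/-- This is the identification of sp with symmetric matrices, through multiplication by Δ, that
underlies the bijectivity of `krausOp`. -/
lemma mem_sp_iff_transpose {A : Matrix (l ⊕ l) (l ⊕ l) ℂ} :
    A ∈ LieAlgebra.Symplectic.sp l ℂ ↔ (Matrix.J l ℂ * A)ᵀ = Matrix.J l ℂ * A := by
  rw [LieAlgebra.Symplectic.sp, mem_skewAdjointMatricesLieSubalgebra,
    mem_skewAdjointMatricesSubmodule, Matrix.transpose_mul, Matrix.J_transpose, mul_neg]
  change Aᵀ * Matrix.J l ℂ = Matrix.J l ℂ * -A ↔ _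
  rw [mul_neg, neg_eq_iff_eq_neg]

/-- The normalization `√(2n)` of the singlet. -/
noncomputable def sqrtDim (l : Type) [Fintype l] : ℂ := (Real.sqrt (Fintype.card (l ⊕ l)) : ℂ)

lemma sqrtDim_mul_self {l : Type} [Fintype l] : sqrtDim l * sqrtDim l = Fintype.card (l ⊕ l) := by
  rw [sqrtDim, ← Complex.ofReal_mul, Real.mul_self_sqrt (Nat.cast_nonneg _), Complex.ofReal_natCast]

lemma sqrtDim_ne_zero {l : Type} [Fintype l] [Nonempty l] : sqrtDim l ≠ 0 := by
  intro h
  have := sqrtDim_mul_self (l := l)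
  rw [h, mul_zero, eq_comm, Nat.cast_eq_zero] at this
  exact Fintype.card_ne_zero this

lemma conj_sqrtDim {l : Type} [Fintype l] : starRingEnd ℂ (sqrtDim l) = sqrtDim l := Complex.conj_ofReal _

lemma krausOp_eq (s : Matrix (l ⊕ l) (l ⊕ l) ℂ) :
    krausOp s = -(sqrtDim l)⁻¹ • (Matrix.J l ℂ * s.map (starRingEnd ℂ)) := rfl

/-- The inverse of `krausOp`. -/
noncomputable def krausInv (A : Matrix (l ⊕ l) (l ⊕ l) ℂ) : Matrix (l ⊕ l) (l ⊕ l) ℂ :=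
  sqrtDim l • (Matrix.J l ℂ * A).map (starRingEnd ℂ)

lemma map_conj_smul {ι κ : Type*} (c : ℂ) (A : Matrix ι κ ℂ) :
    (c • A).map (starRingEnd ℂ) = starRingEnd ℂ c • A.map (starRingEnd ℂ) := by
  ext
  simp

lemma krausOp_krausInv [Nonempty l] (A : Matrix (l ⊕ l) (l ⊕ l) ℂ) : krausOp (krausInv A) = A := by
  rw [krausOp_eq, krausInv, map_conj_smul, map_conj_map_conj, conj_sqrtDim, Matrix.mul_smul,
    smul_smul, J_mul_J_mul, neg_mul, inv_mul_cancel₀ sqrtDim_ne_zero, smul_neg, neg_smul, one_smul,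
    neg_neg]

lemma krausInv_krausOp [Nonempty l] (s : Matrix (l ⊕ l) (l ⊕ l) ℂ) : krausInv (krausOp s) = s := by
  rw [krausOp_eq, krausInv, Matrix.mul_smul, J_mul_J_mul, smul_neg, neg_smul, neg_neg,
    map_conj_smul, map_conj_map_conj, smul_smul, map_inv₀, conj_sqrtDim,
    mul_inv_cancel₀ sqrtDim_ne_zero, one_smul]

lemma krausOp_mem_sp {s : Matrix (l ⊕ l) (l ⊕ l) ℂ} (hs : s ∈ onSite l) :
    krausOp s ∈ LieAlgebra.Symplectic.sp l ℂ := by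
  have hs' : sᵀ = s := hs
  rw [mem_sp_iff_transpose, krausOp_eq, Matrix.mul_smul, J_mul_J_mul, Matrix.transpose_smul,
    Matrix.transpose_neg, ← Matrix.transpose_map, hs']

lemma krausInv_mem_onSite {A : Matrix (l ⊕ l) (l ⊕ l) ℂ}
    (hA : A ∈ LieAlgebra.Symplectic.sp l ℂ) : krausInv A ∈ onSite l := by
  change (krausInv A)ᵀ = krausInv A
  rw [krausInv, Matrix.transpose_smul, ← Matrix.transpose_map, mem_sp_iff_transpose.mp hA]

theorem bijOn_krausOp [Nonempty l] :
    Set.BijOn krausOp (onSite l : Set (Matrix (l ⊕ l) (l ⊕ l) ℂ))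
      (LieAlgebra.Symplectic.sp l ℂ : Set (Matrix (l ⊕ l) (l ⊕ l) ℂ)) :=
  Set.InvOn.bijOn (f' := krausInv) ⟨fun s _ => krausInv_krausOp s, fun A _ => krausOp_krausInv A⟩
    (fun _ hs => krausOp_mem_sp hs) (fun _ hA => krausInv_mem_onSite hA)

/-- Projection onto a vector uses its bra, so the dependence on the vector is antilinear. -/
lemma krausOp_sum {ι : Type*} (S : Finset ι) (c : ι → ℂ) (s : ι → Matrix (l ⊕ l) (l ⊕ l) ℂ) :
    krausOp (∑ i ∈ S, starRingEnd ℂ (c i) • s i) = ∑ i ∈ S, c i • krausOp (s i) := by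
  have : (∑ i ∈ S, starRingEnd ℂ (c i) • s i).map (starRingEnd ℂ) =
      ∑ i ∈ S, c i • (s i).map (starRingEnd ℂ) := by
    ext a b
    simp [Matrix.sum_apply]
  simp only [krausOp_eq, this, Matrix.mul_sum, Finset.smul_sum, Matrix.mul_smul]
  exact Finset.sum_congr rfl fun i _ => smul_comm _ _ _

lemma mem_CSp_iff {g : Matrix (l ⊕ l) (l ⊕ l) ℂ} :
    g ∈ CSp l ↔ g * gᴴ = 1 ∧ g * Matrix.J l ℂ * gᵀ = Matrix.J l ℂ := by
  rw [CSp, Submonoid.mem_inf, Matrix.mem_unitaryGroup_iff, SymplecticGroup.mem_iff]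
  rfl

lemma mul_conjTranspose_of_mem_CSp {g : Matrix (l ⊕ l) (l ⊕ l) ℂ} (hg : g ∈ CSp l) :
    g * gᴴ = 1 := (mem_CSp_iff.mp hg).1

lemma conjTranspose_mul_of_mem_CSp {g : Matrix (l ⊕ l) (l ⊕ l) ℂ} (hg : g ∈ CSp l) :
    gᴴ * g = 1 := mul_eq_one_comm.mp (mem_CSp_iff.mp hg).1

/-- For a unitary matrix, preserving the symplectic form amounts to commuting with the quaternionic
structure v ↦ Δ v̄. The covariance of `krausOp` is a direct consequence. -/
lemma mul_J_of_mem_CSp {g : Matrix (l ⊕ l) (l ⊕ l) ℂ} (hg : g ∈ CSp l) :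
    g * Matrix.J l ℂ = Matrix.J l ℂ * g.map (starRingEnd ℂ) := by
  have h1 : gᵀ * g.map (starRingEnd ℂ) = 1 := by
    have := congrArg Matrix.transpose (conjTranspose_mul_of_mem_CSp hg)
    rw [Matrix.transpose_mul, Matrix.transpose_one] at this
    exact this
  have h2 := congrArg (fun B => B * g.map (starRingEnd ℂ)) (mem_CSp_iff.mp hg).2
  simpa only [mul_assoc, h1, mul_one] using h2

lemma J_mul_transpose_of_mem_CSp {g : Matrix (l ⊕ l) (l ⊕ l) ℂ} (hg : g ∈ CSp l) :
    Matrix.J l ℂ * gᵀ = gᴴ * Matrix.J l ℂ := by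
  have h2 := congrArg (fun B => gᴴ * B) (mem_CSp_iff.mp hg).2
  simp only [mul_assoc] at h2
  rw [← mul_assoc, conjTranspose_mul_of_mem_CSp hg, one_mul] at h2
  exact h2

lemma conjTranspose_mem_CSp {g : Matrix (l ⊕ l) (l ⊕ l) ℂ} (hg : g ∈ CSp l) : gᴴ ∈ CSp l := by
  rw [mem_CSp_iff]
  refine ⟨by rw [Matrix.conjTranspose_conjTranspose]; exact conjTranspose_mul_of_mem_CSp hg, ?_⟩
  have : (gᴴ)ᵀ = g.map (starRingEnd ℂ) := rfl
  rw [this, mul_assoc, ← mul_J_of_mem_CSp hg, ← mul_assoc, conjTranspose_mul_of_mem_CSp hg, one_mul]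

lemma conj_mem_sp {g A : Matrix (l ⊕ l) (l ⊕ l) ℂ} (hg : g ∈ CSp l)
    (hA : A ∈ LieAlgebra.Symplectic.sp l ℂ) : g * A * gᴴ ∈ LieAlgebra.Symplectic.sp l ℂ := by
  rw [mem_sp_iff] at hA ⊢
  have : (gᴴ)ᵀ = g.map (starRingEnd ℂ) := rfl
  rw [Matrix.transpose_mul, Matrix.transpose_mul, this, ← mul_assoc, ← mul_J_of_mem_CSp hg,
    mul_assoc g, ← mul_assoc _ Aᵀ, hA, neg_mul, mul_neg, mul_assoc A, J_mul_transpose_of_mem_CSp hg]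
  simp only [mul_assoc]

lemma siteSym_mem_onSite {l : Type} [Fintype l] (g : Matrix (l ⊕ l) (l ⊕ l) ℂ) {s : Matrix (l ⊕ l) (l ⊕ l) ℂ}
    (hs : s ∈ onSite l) : siteSym g s ∈ onSite l := by
  have hs' : sᵀ = s := hs
  change (g * s * gᵀ)ᵀ = g * s * gᵀ
  rw [Matrix.transpose_mul, Matrix.transpose_mul, hs', Matrix.transpose_transpose, mul_assoc]

theorem krausOp_siteSym {g : Matrix (l ⊕ l) (l ⊕ l) ℂ} (hg : g ∈ CSp l)
    (s : Matrix (l ⊕ l) (l ⊕ l) ℂ) : krausOp (siteSym g s) = g * krausOp s * gᴴ := by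
  have : (gᵀ).map (starRingEnd ℂ) = gᴴ := rfl
  rw [krausOp_eq, krausOp_eq, siteSym, Matrix.map_mul, Matrix.map_mul, this, Matrix.mul_smul,
    Matrix.smul_mul, ← mul_assoc, ← mul_assoc, ← mul_J_of_mem_CSp hg]
  simp only [mul_assoc]

/-- The anti-automorphism A ↦ -Δ Aᵀ Δ preserves traces; it fixes P and negates A. Hence only
generators occur in the Pauli expansion of an element of sp. -/
lemma trace_mul_eq_zero_of_symp {P A : Matrix (l ⊕ l) (l ⊕ l) ℂ}
    (hP : Matrix.J l ℂ * Pᵀ = P * Matrix.J l ℂ) (hA : Matrix.J l ℂ * Aᵀ = -(A * Matrix.J l ℂ)) :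
    (P * A).trace = 0 := by
  have h1 : Pᵀ = -(Matrix.J l ℂ * (P * Matrix.J l ℂ)) := by rw [← hP, J_mul_J_mul, neg_neg]
  have h2 : Aᵀ = Matrix.J l ℂ * (A * Matrix.J l ℂ) := by
    rw [← neg_eq_iff_eq_neg.mpr hA, mul_neg, J_mul_J_mul, neg_neg]
  have h := Matrix.trace_transpose (P * A)
  rw [Matrix.transpose_mul, h1, h2] at h
  simp only [mul_neg, mul_assoc, J_mul_J_mul, neg_neg] at h
  rw [Matrix.trace_mul_comm] at h
  simp only [mul_assoc, J_mul_J, mul_neg, mul_one, Matrix.trace_neg] at h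
  rw [Matrix.trace_mul_comm] at h
  exact self_eq_neg.mp h.symm

end Symplectic

/-! ### The Pauli generators -/

section Generators

variable {m : ℕ}

lemma card_virtual : Fintype.card (Qubits m ⊕ Qubits m) = 2 * 2 ^ m := by
  simp
  ring

lemma card_virtual_cast : (Fintype.card (Qubits m ⊕ Qubits m) : ℂ) = 2 ^ (m + 1) := by
  rw [card_virtual]
  push_cast
  ring

lemma gen_conjTranspose (a : Gen m) : (gen a)ᴴ = gen a := pauliOp_conjTranspose _

lemma gen_mul_self (a : Gen m) : gen a * gen a = 1 := pauliOp_mul_self _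

lemma gen_trace_mul (a b : Gen m) :
    (gen a * gen b).trace = if a = b then 2 ^ (m + 1) else 0 := by
  rw [gen, gen, pauliOp_trace_mul]
  simp only [Subtype.ext_iff]

lemma gen_mem_sp (a : Gen m) : gen a ∈ LieAlgebra.Symplectic.sp (Qubits m) ℂ := by
  rw [mem_sp_iff, gen, J_mul_pauliOp_transpose, sympSign_gen]
  simp

lemma eq_sum_gen {A : Matrix (Qubits m ⊕ Qubits m) (Qubits m ⊕ Qubits m) ℂ}
    (hA : A ∈ LieAlgebra.Symplectic.sp (Qubits m) ℂ) :
    A = ∑ a, ((gen a * A).trace / 2 ^ (m + 1)) • gen a := by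
  have h := Finset.sum_coe_sort (genLabels m)
    fun a => ((pauliOp a * A).trace / 2 ^ (m + 1)) • pauliOp a
  conv_lhs => rw [eq_sum_pauliOp A]
  refine Eq.trans ?_ h.symm
  symm
  refine Finset.sum_subset (Finset.subset_univ _) fun a _ ha => ?_
  have hs := (sympSign_eq_or a).resolve_right fun h => ha (mem_genLabels.mpr h)
  rw [trace_mul_eq_zero_of_symp (by rw [J_mul_pauliOp_transpose, hs]; simp) (mem_sp_iff.mp hA),
    zero_div, zero_smul]

lemma siteVec_eq (a : Gen m) :
    siteVec a = (2 ^ (m + 1) : ℂ)⁻¹ • krausInv (gen a) := by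
  rw [siteVec, krausInv, smul_smul, ← card_virtual_cast, ← sqrtDim_mul_self, mul_inv, mul_assoc,
    inv_mul_cancel₀ sqrtDim_ne_zero, mul_one]
  rfl

lemma siteVec_mem (a : Gen m) : siteVec a ∈ onSite (Qubits m) := by
  rw [siteVec_eq]
  exact Submodule.smul_mem _ _ (krausInv_mem_onSite (gen_mem_sp a))

lemma krausOp_siteVec (a : Gen m) : krausOp (siteVec a) = (2 ^ (m + 1) : ℂ)⁻¹ • gen a := by
  have h := krausOp_sum {a} (fun _ => (2 ^ (m + 1) : ℂ)⁻¹) (fun a => krausInv (gen a))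
  simp only [Finset.sum_singleton, krausOp_krausInv] at h
  rw [← h, siteVec_eq, map_inv₀, map_pow, map_ofNat]

theorem trace_siteVec (a b : Gen m) :
    ((siteVec a)ᴴ * siteVec b).trace = if a = b then 1 else 0 := by
  have h1 : ((Matrix.J (Qubits m) ℂ * gen a).map (starRingEnd ℂ))ᴴ *
      (Matrix.J (Qubits m) ℂ * gen b).map (starRingEnd ℂ) =
      (gen a * gen b).map (starRingEnd ℂ) := by
    have h2 : ∀ A : Matrix (Qubits m ⊕ Qubits m) (Qubits m ⊕ Qubits m) ℂ,
        (A.map (starRingEnd ℂ))ᴴ = (Aᴴ).map (starRingEnd ℂ) := fun _ => rfl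
    have h3 : (Matrix.J (Qubits m) ℂ)ᴴ = -Matrix.J (Qubits m) ℂ := by
      rw [← Matrix.J_transpose, ← J_map_conj]
      simp only [J_map_conj]
      exact congrArg Matrix.transpose J_map_conj
    rw [h2, ← Matrix.map_mul, Matrix.conjTranspose_mul, gen_conjTranspose, h3, mul_assoc, neg_mul,
      J_mul_J_mul, neg_neg]
  have h4 : (starRingEnd ℂ) ((sqrtDim (Qubits m))⁻¹) * (sqrtDim (Qubits m))⁻¹ =
      (2 ^ (m + 1) : ℂ)⁻¹ := by
    rw [map_inv₀, conj_sqrtDim, ← mul_inv, sqrtDim_mul_self, card_virtual_cast]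
  have h5 : ∀ A : Matrix (Qubits m ⊕ Qubits m) (Qubits m ⊕ Qubits m) ℂ,
      (A.map (starRingEnd ℂ)).trace = starRingEnd ℂ A.trace := fun A => by
    simp [Matrix.trace]
  change (((sqrtDim (Qubits m))⁻¹ • (Matrix.J (Qubits m) ℂ * gen a).map (starRingEnd ℂ))ᴴ *
    ((sqrtDim (Qubits m))⁻¹ • (Matrix.J (Qubits m) ℂ * gen b).map (starRingEnd ℂ))).trace = _
  rw [Matrix.conjTranspose_smul, Matrix.smul_mul, Matrix.mul_smul, smul_smul, h1,
    Matrix.trace_smul, h5, gen_trace_mul]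
  change (starRingEnd ℂ ((sqrtDim (Qubits m))⁻¹) * (sqrtDim (Qubits m))⁻¹) • _ = _
  rw [h4]
  split_ifs
  · rw [map_pow, map_ofNat, smul_eq_mul, inv_mul_cancel₀ (by simp)]
  · simp

theorem span_siteVec :
    Submodule.span ℂ (Set.range (siteVec (m := m))) = onSite (Qubits m) := by
  apply le_antisymm
  · rw [Submodule.span_le]
    rintro _ ⟨a, rfl⟩
    exact siteVec_mem a
  · intro s hs
    have h : krausOp s = krausOp (∑ a, starRingEnd ℂ ((gen a * krausOp s).trace) • siteVec a) := by
      rw [krausOp_sum]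
      conv_lhs => rw [eq_sum_gen (krausOp_mem_sp hs)]
      simp only [krausOp_siteVec, smul_smul, div_eq_mul_inv]
    have h' := congrArg krausInv h
    rw [krausInv_krausOp, krausInv_krausOp] at h'
    rw [h']
    exact Submodule.sum_mem _ fun a _ =>
      Submodule.smul_mem _ _ (Submodule.subset_span (Set.mem_range_self a))

theorem finrank_onSite : Module.finrank ℂ (onSite (Qubits m)) = 2 ^ m * (2 * 2 ^ m + 1) := by
  have hli : LinearIndependent ℂ (siteVec (m := m)) := by
    rw [Fintype.linearIndependent_iff]
    intro c hc a
    have h : ((siteVec a)ᴴ * ∑ b, c b • siteVec b).trace = c a := by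
      simp [Finset.mul_sum, Matrix.trace_sum, Matrix.trace_smul, trace_siteVec]
    rw [← h, hc, mul_zero, Matrix.trace_zero]
  rw [← span_siteVec, finrank_span_eq_card hli, card_gen]

lemma sum_adjMatrix_smul_gen {g : Matrix (Qubits m ⊕ Qubits m) (Qubits m ⊕ Qubits m) ℂ}
    (hg : g ∈ CSp (Qubits m)) (a : Gen m) :
    ∑ b, adjMatrix g a b • gen b = gᴴ * gen a * g := by
  have h := eq_sum_gen (conj_mem_sp (conjTranspose_mem_CSp hg) (gen_mem_sp a))
  rw [Matrix.conjTranspose_conjTranspose] at h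
  rw [h]
  refine Finset.sum_congr rfl fun b _ => ?_
  rw [adjMatrix, Matrix.of_apply, gen_conjTranspose, card_virtual_cast]
  congr 2
  rw [Matrix.trace_mul_comm (gen b), Matrix.trace_mul_comm (gen a * g * gen b)]
  simp only [mul_assoc]

/-- The rows hold the coordinates of g† N_a g in an orthogonal basis, and conjugation by g preserves
the trace inner product. -/
theorem adjMatrix_mem_unitaryGroup
    {g : Matrix (Qubits m ⊕ Qubits m) (Qubits m ⊕ Qubits m) ℂ} (hg : g ∈ CSp (Qubits m)) :
    adjMatrix g ∈ Matrix.unitaryGroup (Gen m) ℂ := by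
  rw [Matrix.mem_unitaryGroup_iff]
  ext a c
  have h0 : (2 ^ (m + 1) : ℂ) ≠ 0 := by simp
  have h1 := sum_adjMatrix_smul_gen hg a
  have h2 := congrArg Matrix.conjTranspose (sum_adjMatrix_smul_gen hg c)
  simp only [Matrix.conjTranspose_sum, Matrix.conjTranspose_smul, gen_conjTranspose,
    Matrix.conjTranspose_mul, Matrix.conjTranspose_conjTranspose] at h2
  -- This inner product is computed once by cancelling g against g†, and once more, below, from the
  -- expansions in generators.
  have h3 : ((gᴴ * gen a * g) * (gᴴ * (gen c * g))).trace = if a = c then 2 ^ (m + 1) else 0 := by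
    rw [← gen_trace_mul, mul_assoc, ← mul_assoc g, mul_conjTranspose_of_mem_CSp hg, one_mul,
      ← mul_assoc, Matrix.trace_mul_comm, ← mul_assoc, ← mul_assoc,
      mul_conjTranspose_of_mem_CSp hg, one_mul]
  rw [← h1, ← h2] at h3
  simp only [Matrix.sum_mul, Matrix.mul_sum, Matrix.smul_mul, Matrix.mul_smul, Matrix.trace_sum,
    Matrix.trace_smul, gen_trace_mul, smul_eq_mul, mul_ite, mul_zero,
    Finset.mem_univ, if_true, Finset.sum_ite_eq'] at h3
  rw [Matrix.mul_apply, Matrix.one_apply]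
  simp only [Matrix.star_apply]
  apply mul_right_cancel₀ h0
  rw [Finset.sum_mul, ite_mul, one_mul, zero_mul, ← h3]
  exact Finset.sum_congr rfl fun b _ => by ring

lemma rotVec_mem (g : Matrix (Qubits m ⊕ Qubits m) (Qubits m ⊕ Qubits m) ℂ) (a : Gen m) :
    rotVec g a ∈ onSite (Qubits m) := siteSym_mem_onSite _ (siteVec_mem a)

lemma krausOp_rotVec {g : Matrix (Qubits m ⊕ Qubits m) (Qubits m ⊕ Qubits m) ℂ}
    (hg : g ∈ CSp (Qubits m)) (a : Gen m) :
    krausOp (rotVec g a) = (2 ^ (m + 1) : ℂ)⁻¹ • (gᴴ * gen a * g) := by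
  rw [rotVec, krausOp_siteSym (conjTranspose_mem_CSp hg), krausOp_siteVec,
    Matrix.conjTranspose_conjTranspose, Matrix.mul_smul, Matrix.smul_mul]

/-- Both sides have the same image under the injective map `krausOp`. The coefficients are
conjugated because these are kets; the bras carry `adjMatrix` itself. -/
theorem rotVec_eq_sum {g : Matrix (Qubits m ⊕ Qubits m) (Qubits m ⊕ Qubits m) ℂ}
    (hg : g ∈ CSp (Qubits m)) (a : Gen m) :
    rotVec g a = ∑ b, starRingEnd ℂ (adjMatrix g a b) • siteVec b := by
  have h : krausOp (rotVec g a) =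
      krausOp (∑ b, starRingEnd ℂ (adjMatrix g a b) • siteVec b) := by
    rw [krausOp_sum, krausOp_rotVec hg, ← sum_adjMatrix_smul_gen hg, Finset.smul_sum]
    exact Finset.sum_congr rfl fun b _ => by rw [krausOp_siteVec, smul_comm]
  rw [← krausInv_krausOp (rotVec g a), h, krausInv_krausOp]

end Generators

end SpAKLT

namespace SpAKLT

variable {m : ℕ}

/-! ### The elementary gates -/

lemma exp_smul_of_mul_self_eq_one {ι : Type*} [Fintype ι] [DecidableEq ι] {N : Matrix ι ι ℂ}
    (hN : N * N = 1) (z : ℂ) :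
    NormedSpace.exp (z • N) = Complex.cosh z • 1 + Complex.sinh z • N := by
  have he : ∀ k : ℕ, N ^ (2 * k) = 1 := fun k => by rw [pow_mul, sq, hN, one_pow]
  rw [NormedSpace.exp_eq_tsum ℂ]
  refine HasSum.tsum_eq (HasSum.even_add_odd ?_ ?_)
  · refine Eq.mp (congrArg (HasSum · _) (funext fun k => ?_))
      ((Complex.hasSum_cosh z).smul_const (1 : Matrix ι ι ℂ))
    rw [smul_pow, he, smul_smul, div_eq_inv_mul]
  · refine Eq.mp (congrArg (HasSum · _) (funext fun k => ?_))
      ((Complex.hasSum_sinh z).smul_const N)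
    rw [smul_pow, pow_succ N, he, one_mul, smul_smul, div_eq_inv_mul]

lemma expGate_eq (a : Gen m) (θ : ℝ) :
    expGate a θ = (Real.cos θ : ℂ) • 1 - ((Real.sin θ : ℂ) * Complex.I) • gen a := by
  rw [expGate, exp_smul_of_mul_self_eq_one (gen_mul_self a), Complex.cosh_neg, Complex.sinh_neg,
    mul_comm Complex.I, Complex.cosh_mul_I, Complex.sinh_mul_I, neg_smul, ← sub_eq_add_neg,
    Complex.ofReal_cos, Complex.ofReal_sin]

lemma expGate_zero (a : Gen m) : expGate a 0 = 1 := by simp [expGate_eq]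

lemma expGate_mul (a : Gen m) (s t : ℝ) : expGate a s * expGate a t = expGate a (s + t) := by
  rw [expGate, expGate, expGate, ← Matrix.exp_add_of_commute _ _ (((Commute.refl (gen a)).smul_left _).smul_right _),
    ← add_smul]
  congr 2
  push_cast
  ring

lemma expGate_conjTranspose (a : Gen m) (θ : ℝ) : (expGate a θ)ᴴ = expGate a (-θ) := by
  rw [expGate_eq, expGate_eq, Matrix.conjTranspose_sub, Matrix.conjTranspose_smul,
    Matrix.conjTranspose_smul, gen_conjTranspose, Matrix.conjTranspose_one, star_mul']
  have h1 : ∀ r : ℝ, star (r : ℂ) = r := Complex.conj_ofReal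
  have h2 : star Complex.I = -Complex.I := Complex.conj_I
  rw [h1, h1, h2, Real.cos_neg, Real.sin_neg, Complex.ofReal_neg, mul_neg, neg_mul]

/-- Moving a Pauli operator past a gate at most reverses the angle. This governs success and failure
of a measurement as well as the correction for byproducts. -/
lemma pauliOp_mul_expGate (b : (Fin m → Fin 4) × Fin 4) (a : Gen m) (θ : ℝ) :
    pauliOp b * expGate a θ = expGate a (opCommSign b a.1 * θ) * pauliOp b := by
  have h : pauliOp b * gen a = (opCommSign b a.1 : ℂ) • (gen a * pauliOp b) :=
    pauliOp_mul_comm b a.1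
  rw [expGate_eq, expGate_eq, mul_sub, sub_mul, Matrix.mul_smul, Matrix.mul_smul,
    Matrix.smul_mul, Matrix.smul_mul, one_mul, mul_one, h]
  rcases opCommSign_eq_or b a.1 with h | h <;> simp [h]

lemma expGate_mem_CSp (a : Gen m) (θ : ℝ) : expGate a θ ∈ CSp (Qubits m) := by
  have h1 : expGate a θ * (expGate a θ)ᴴ = 1 := by
    rw [expGate_conjTranspose, expGate_mul, add_neg_cancel, expGate_zero]
  have h2 : Matrix.J (Qubits m) ℂ * (expGate a θ)ᵀ = (expGate a θ)ᴴ * Matrix.J (Qubits m) ℂ := by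
    have h3 := mem_sp_iff.mp (gen_mem_sp a)
    rw [expGate_conjTranspose, expGate_eq, expGate_eq, Matrix.transpose_sub, Matrix.transpose_smul,
      Matrix.transpose_smul, mul_sub, Matrix.mul_smul, Matrix.mul_smul, h3, sub_mul,
      Matrix.smul_mul, Matrix.smul_mul]
    simp
  exact mem_CSp_iff.mpr ⟨h1, by rw [mul_assoc, h2, ← mul_assoc, h1, one_mul]⟩

/-- In g† N_b g, moving g† to the right of N_b turns it into g if N_a and N_b anticommute, so the
two half angles add up to θ; if they commute, the angles cancel. -/
lemma krausOp_rotVec_expGate (a b : Gen m) (θ : ℝ) :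
    krausOp (rotVec (expGate a (θ / 2)) b) = (2 ^ (m + 1) : ℂ)⁻¹ •
      if opCommSign b.1 a.1 = -1 then gen b * expGate a θ else gen b := by
  rw [krausOp_rotVec (expGate_mem_CSp a _), expGate_conjTranspose]
  congr 1
  have h := fun t => pauliOp_mul_expGate b.1 a t
  change ∀ t, gen b * _ = _ * gen b at h
  split_ifs with hs
  · simp only [hs, Int.cast_neg, Int.cast_one, neg_mul, one_mul] at h
    rw [← h, mul_assoc, expGate_mul, add_halves]
  · simp only [(opCommSign_eq_or b.1 a.1).resolve_right hs, Int.cast_one, one_mul] at h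
    rw [← h, mul_assoc, expGate_mul, neg_add_cancel, expGate_zero, mul_one]

lemma gen_trace (a : Gen m) : (gen a).trace = 0 := by
  have h := pauliOp_trace_mul (fun _ => 0, 0) a.1
  rw [pauliOp_one, one_mul] at h
  rw [gen, h, if_neg]
  intro h0
  have := sympSign_gen a
  rw [← h0] at this
  simp [sympSign, transSign, transSign₁, sympSign₁] at this

lemma mem_successes {a b : Gen m} {θ : ℝ} (hθ : Real.sin θ ≠ 0) :
    b ∈ successes a θ ↔ opCommSign b.1 a.1 = -1 := by
  have h0 : (2 ^ (m + 1) : ℂ) ≠ 0 := by simp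
  change (∃ c : ℂ, c ≠ 0 ∧ _) ↔ _
  rw [krausOp_rotVec_expGate]
  constructor
  · rintro ⟨c, hc, h⟩
    by_contra hs
    rw [if_neg hs] at h
    -- In the commuting case, removing N_b and multiplying by N_a leaves a traceless matrix on one
    -- side and a matrix with trace proportional to c sin θ on the other.
    have h' := congrArg (fun A => gen b * A * gen a) h
    simp only [Matrix.mul_smul, Matrix.smul_mul, gen_mul_self, one_mul] at h'
    rw [← mul_assoc, gen_mul_self, one_mul, expGate_eq, sub_mul, Matrix.smul_mul, Matrix.smul_mul,
      one_mul, gen_mul_self] at h'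
    have h2 := congrArg Matrix.trace h'
    simp only [Matrix.trace_smul, Matrix.trace_sub, gen_trace, Matrix.trace_one, card_virtual_cast,
      smul_eq_mul, mul_zero, zero_sub, mul_neg] at h2
    have hsin : (Real.sin θ : ℂ) ≠ 0 := by exact_mod_cast hθ
    exact (neg_ne_zero.mpr
      (mul_ne_zero hc (mul_ne_zero (mul_ne_zero hsin Complex.I_ne_zero) h0))) h2.symm
  · intro hs
    exact ⟨(2 ^ (m + 1) : ℂ)⁻¹, inv_ne_zero h0, by rw [if_pos hs]⟩

lemma opCommSign_comm (a b : (Fin m → Fin 4) × Fin 4) : opCommSign a b = opCommSign b a := by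
  have : ∀ x y, commSign₁ x y = commSign₁ y x := by decide
  simp only [opCommSign, commSign, this a.2, fun k => this (a.1 k)]

lemma gen_anticommute_iff (a b : Gen m) :
    gen a * gen b = -(gen b * gen a) ↔ opCommSign b.1 a.1 = -1 := by
  rw [opCommSign_comm]
  exact (commute_of_sign (opCommSign_eq_or a.1 b.1) (gen_mul_self a) (gen_mul_self b)
    (pauliOp_mul_comm a.1 b.1)).2

lemma card_successes (a : Gen m) :
    (Finset.univ.filter fun b : Gen m => opCommSign b.1 a.1 = -1).card =
      2 ^ m * (2 ^ m + 1) := by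
  rw [← card_anticommuting_gen a]
  simp only [opCommSign_comm a.1]

/-! ### The operators induced by adaptive measurements -/

/-- The operator on the virtual space that is induced by the outcomes `i`. -/
noncomputable def Rule.op (π : Rule m) {N : ℕ} (i : Fin N → Gen m) :
    Matrix (Qubits m ⊕ Qubits m) (Qubits m ⊕ Qubits m) ℂ :=
  (List.ofFn fun k => krausOp (π.vecs i k)).reverse.prod

lemma Rule.out_eq (π : Rule m) (L : Qubits m ⊕ Qubits m → ℂ) {N : ℕ} (i : Fin N → Gen m) :
    π.out L i = π.op i *ᵥ L :=
  contract_aklt _ (fun _ => rotVec_mem _ _) L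

lemma Rule.op_zero (π : Rule m) (i : Fin 0 → Gen m) : π.op i = 1 := by
  simp [Rule.op]

lemma ofFn_snoc {α : Type*} {N : ℕ} (h : Fin N → α) (b : α) :
    List.ofFn (Fin.snoc h b : Fin (N + 1) → α) = List.ofFn h ++ [b] := by
  rw [List.ofFn_succ', List.concat_eq_append]
  simp

lemma Rule.op_snoc (π : Rule m) {N : ℕ} (h : Fin N → Gen m) (b : Gen m) :
    π.op (Fin.snoc h b : Fin (N + 1) → Gen m) =
      krausOp (rotVec (π (List.ofFn h)) b) * π.op h := by
  have h1 : π.vecs (Fin.snoc h b : Fin (N + 1) → Gen m) (Fin.last N) =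
      rotVec (π (List.ofFn h)) b := by
    rw [Rule.vecs, ofFn_snoc, Fin.snoc_last, Fin.val_last, List.take_left' (by simp)]
  have h2 : ∀ k : Fin N, π.vecs (Fin.snoc h b : Fin (N + 1) → Gen m) k.castSucc =
      π.vecs h k := by
    intro k
    simp only [Rule.vecs, ofFn_snoc, Fin.snoc_castSucc, Fin.val_castSucc]
    rw [List.take_append_of_le_length (by simp)]
  rw [Rule.op, List.ofFn_succ', List.concat_eq_append, List.reverse_append]
  simp only [h1, h2]
  simp [Rule.op]

lemma gen_eq_smul_expGate (a : Gen m) : gen a = Complex.I • expGate a (Real.pi / 2) := by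
  rw [expGate_eq]
  simp [smul_smul]

/-- Every site contributes g† N_b g / (2n), and N_b is i times a gate. The modulus of the scalar
depends only on N, which is why the Born probabilities are uniform. -/
lemma exists_op_eq_smul {π : Rule m} (hπ : π.IsSymmetric) {N : ℕ} (i : Fin N → Gen m) :
    ∃ (c : ℂ) (S : Matrix (Qubits m ⊕ Qubits m) (Qubits m ⊕ Qubits m) ℂ),
      ‖c‖ = ((2 : ℝ) ^ (m + 1))⁻¹ ^ N ∧ S ∈ CSp (Qubits m) ∧ π.op i = c • S := by
  induction N with
  | zero => exact ⟨1, 1, by simp, one_mem _, by rw [Rule.op_zero, one_smul]⟩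
  | succ N ih =>
    obtain ⟨c, S, hc, hS, h⟩ := ih (Fin.init i)
    set g := π (List.ofFn (Fin.init i))
    have hg : g ∈ CSp (Qubits m) := hπ _
    refine ⟨(2 ^ (m + 1) : ℂ)⁻¹ * Complex.I * c,
      gᴴ * expGate (i (Fin.last N)) (Real.pi / 2) * g * S, ?_, ?_, ?_⟩
    · have h2 : ‖(2 : ℂ)‖ = 2 := by simp
      rw [norm_mul, norm_mul, hc, pow_succ _ N, norm_inv, norm_pow, h2, Complex.norm_I, mul_one,
        mul_comm]
    · exact mul_mem (mul_mem (mul_mem (conjTranspose_mem_CSp hg) (expGate_mem_CSp _ _)) hg) hS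
    · rw [← Fin.snoc_init_self i, Rule.op_snoc, krausOp_rotVec hg, h, gen_eq_smul_expGate]
      simp only [Matrix.mul_smul, Matrix.smul_mul, smul_smul, Fin.snoc_last]
      congr 1
      ring

lemma sum_norm_sq_mulVec {ι : Type*} [Fintype ι] [DecidableEq ι] {U : Matrix ι ι ℂ}
    (hU : Uᴴ * U = 1) (v : ι → ℂ) : ∑ e, ‖(U *ᵥ v) e‖ ^ 2 = ∑ e, ‖v e‖ ^ 2 := by
  have h : ∀ w : ι → ℂ, ((∑ e, ‖w e‖ ^ 2 : ℝ) : ℂ) = star w ⬝ᵥ w := fun w => by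
    simp only [dotProduct, Pi.star_apply, Complex.ofReal_sum]
    refine Finset.sum_congr rfl fun e _ => ?_
    rw [mul_comm, ← Complex.normSq_eq_norm_sq, ← Complex.mul_conj]
    rfl
  rw [← Complex.ofReal_inj, h, h, Matrix.star_mulVec, Matrix.dotProduct_mulVec,
    Matrix.vecMul_vecMul, hU, Matrix.vecMul_one]

/-- Per site, the squared scalar 1/(2n)² is divided by the norm factor (2n+1)/(4n) of the AKLT
state, with n = 2 ^ m. -/
theorem prob_eq {π : Rule m} (hπ : π.IsSymmetric) {N : ℕ} {L : Qubits m ⊕ Qubits m → ℂ}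
    (hL : L ≠ 0) (i : Fin N → Gen m) :
    π.prob L i = ((2 ^ m * (2 * 2 ^ m + 1) : ℝ)⁻¹) ^ N := by
  obtain ⟨c, S, hc, hS, h⟩ := exists_op_eq_smul hπ i
  have hL' : ∑ e, ‖L e‖ ^ 2 ≠ 0 := by
    intro h0
    apply hL
    ext e
    have := (Finset.sum_eq_zero_iff_of_nonneg fun e _ => sq_nonneg ‖L e‖).mp h0 e
      (Finset.mem_univ e)
    simpa using this
  have hout : ∑ e, ‖π.out L i e‖ ^ 2 = ‖c‖ ^ 2 * ∑ e, ‖L e‖ ^ 2 := by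
    rw [Rule.out_eq, h, Matrix.smul_mulVec, ← sum_norm_sq_mulVec (conjTranspose_mul_of_mem_CSp hS) L,
      Finset.mul_sum]
    simp [mul_pow]
  rw [Rule.prob, hout, sum_norm_sq_aklt, mul_div_mul_right _ _ hL', hc, ← pow_mul, mul_comm N 2,
    pow_mul, ← div_pow, card_virtual]
  congr 1
  have : (2 : ℝ) ^ m ≠ 0 := by simp
  push_cast
  field_simp
  ring

theorem sum_prob_successes {π : Rule m} (hπ : π.IsSymmetric) {N : ℕ} (h : Fin N → Gen m)
    (a : Gen m) {θ : ℝ} (hθ : Real.sin θ ≠ 0) {L : Qubits m ⊕ Qubits m → ℂ} (hL : L ≠ 0) :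
    ∑ b : Gen m, Set.indicator (successes a θ)
        (fun b => π.prob L (Fin.snoc h b : Fin (N + 1) → Gen m)) b =
      ((2 ^ m + 1 : ℝ) / (2 * 2 ^ m + 1)) * π.prob L h := by
  have hind : ∀ b : Gen m, Set.indicator (successes a θ)
      (fun b => π.prob L (Fin.snoc h b : Fin (N + 1) → Gen m)) b =
        if opCommSign b.1 a.1 = -1 then ((2 ^ m * (2 * 2 ^ m + 1) : ℝ)⁻¹) ^ (N + 1) else 0 := by
    classical
    intro b
    rw [Set.indicator_apply, prob_eq hπ hL]
    exact if_congr (mem_successes hθ) rfl rfl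
  rw [Finset.sum_congr rfl fun b _ => hind b, prob_eq hπ hL, ← Finset.sum_filter, Finset.sum_const, card_successes, nsmul_eq_mul, pow_succ]
  have : (2 : ℝ) ^ m ≠ 0 := by simp
  push_cast
  field_simp

lemma executes_iff (π : Rule m) {N : ℕ} (i : Fin N → Gen m)
    (V : Matrix (Qubits m ⊕ Qubits m) (Qubits m ⊕ Qubits m) ℂ) :
    π.Executes i V ↔ ∃ (b : (Fin m → Fin 4) × Fin 4) (c : ℂ), c ≠ 0 ∧
      π.op i = c • (pauliOp b * V) := by
  refine exists_congr fun b => exists_congr fun c => and_congr_right fun _ => ?_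
  simp only [Rule.out_eq, ← Matrix.smul_mulVec]
  constructor
  · intro h
    exact Matrix.ext_of_mulVec_single fun k => h _
  · intro h L
    rw [h]

/-- A Pauli operator of symplectic sign -1 is a generator, hence i times a gate; one of sign +1 is
itself symplectic. Byproducts therefore never lead out of Sp(2n) up to a scalar. -/
lemma exists_pauliOp_eq_smul (b : (Fin m → Fin 4) × Fin 4) :
    ∃ (c : ℂ) (S : Matrix (Qubits m ⊕ Qubits m) (Qubits m ⊕ Qubits m) ℂ),
      S ∈ CSp (Qubits m) ∧ pauliOp b = c • S := by
  by_cases hb : b ∈ genLabels m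
  · exact ⟨Complex.I, _, expGate_mem_CSp ⟨b, hb⟩ (Real.pi / 2), gen_eq_smul_expGate ⟨b, hb⟩⟩
  · have hs := (sympSign_eq_or b).resolve_right fun h => hb (mem_genLabels.mpr h)
    refine ⟨1, pauliOp b, mem_CSp_iff.mpr ⟨?_, ?_⟩, (one_smul _ _).symm⟩
    · rw [pauliOp_conjTranspose, pauliOp_mul_self]
    · rw [mul_assoc, J_mul_pauliOp_transpose, hs, Int.cast_one, one_smul, ← mul_assoc,
        pauliOp_mul_self, one_mul]

theorem exists_phase_of_executes {π : Rule m} (hπ : π.IsSymmetric) {N : ℕ} (i : Fin N → Gen m)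
    {V : Matrix (Qubits m ⊕ Qubits m) (Qubits m ⊕ Qubits m) ℂ}
    (hV : V ∈ Matrix.unitaryGroup (Qubits m ⊕ Qubits m) ℂ) (h : π.Executes i V) :
    ∃ z : ℂ, ‖z‖ = 1 ∧ z • V ∈ CSp (Qubits m) := by
  obtain ⟨b, c, hc, h⟩ := (executes_iff π i V).mp h
  obtain ⟨c', S, -, hS, h'⟩ := exists_op_eq_smul hπ i
  obtain ⟨c'', S', hS', hb⟩ := exists_pauliOp_eq_smul b
  have hVS : V = (c⁻¹ * c'' * c') • (S' * S) := by
    have h1 := congrArg (fun A => c⁻¹ • (pauliOp b * A)) (h'.symm.trans h)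
    simp only [Matrix.mul_smul, smul_smul, inv_mul_cancel₀ hc, one_smul] at h1
    rw [← mul_assoc, pauliOp_mul_self, one_mul] at h1
    rw [← h1, hb, Matrix.smul_mul, smul_smul]
    congr 1
    ring
  set w := c⁻¹ * c'' * c'
  have hT : S' * S ∈ CSp (Qubits m) := mul_mem hS' hS
  have hw : ‖w‖ = 1 := by
    have h1 := Matrix.mem_unitaryGroup_iff.mp hV
    rw [hVS, star_smul, Matrix.smul_mul, Matrix.mul_smul, smul_smul] at h1
    change (w * star w) • ((S' * S) * (S' * S)ᴴ) = 1 at h1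
    rw [mul_conjTranspose_of_mem_CSp hT] at h1
    have h2 := congrFun (congrFun h1 (Sum.inl 0)) (Sum.inl 0)
    simp only [Matrix.smul_apply, Matrix.one_apply_eq, smul_eq_mul, mul_one] at h2
    have h3 := congrArg norm h2
    rw [norm_mul, norm_star, norm_one] at h3
    nlinarith [norm_nonneg w]
  have hw0 : w ≠ 0 := norm_ne_zero_iff.mp (by rw [hw]; exact one_ne_zero)
  refine ⟨w⁻¹, by rw [norm_inv, hw, inv_one], ?_⟩
  rw [hVS, smul_smul, inv_mul_cancel₀ hw0, one_smul]
  exact hT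

end SpAKLT

namespace SpAKLT

/-! ### Generation of `Sp(2n)` by the elementary gates -/

section Skew

open scoped Matrix.Norms.Operator

/-- The difference D = U - W is also U† - W†, and unitarity gives W D + D U† = 0. With W and U†
close to 1 the left side is close to 2 D, which forces D = 0. The skew-Hermitian part thus serves as
a local chart. -/
lemma eq_of_skew_part_eq {ι : Type*} [Fintype ι] [DecidableEq ι] {U W : Matrix ι ι ℂ}
    (hU : U * Uᴴ = 1) (hW : W * Wᴴ = 1) (h : U - Uᴴ = W - Wᴴ) (hU1 : ‖Uᴴ - 1‖ < 1)
    (hW1 : ‖W - 1‖ < 1) : U = W := by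
  set D := U - W with hD
  have hDU : U = W + D := by rw [hD, add_sub_cancel]
  have hDU' : Uᴴ = Wᴴ + D := by
    rw [hD, ← sub_eq_zero]
    rw [← sub_eq_zero] at h
    rw [← neg_eq_zero, ← h]
    abel
  have h0 : W * D + D * Uᴴ = 0 := by
    have h1 : (W + D) * Uᴴ = 1 := by rw [← hDU, hU]
    rw [add_mul] at h1
    have h2 : W * Uᴴ = 1 + W * D := by rw [hDU', mul_add, hW]
    rw [h2, add_assoc] at h1
    exact left_eq_add.mp h1.symm
  have h1 : (2 : ℂ) • D = -((W - 1) * D + D * (Uᴴ - 1)) := by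
    have : (W - 1) * D + D * (Uᴴ - 1) = (W * D + D * Uᴴ) - (2 : ℂ) • D := by
      rw [two_smul]
      noncomm_ring
    rw [this, h0, zero_sub, neg_neg]
  have h2 : 2 * ‖D‖ ≤ ‖W - 1‖ * ‖D‖ + ‖D‖ * ‖Uᴴ - 1‖ := by
    calc 2 * ‖D‖ = ‖(2 : ℂ) • D‖ := by rw [norm_smul]; simp
      _ ≤ ‖(W - 1) * D‖ + ‖D * (Uᴴ - 1)‖ := by
        rw [h1, norm_neg]
        exact norm_add_le _ _
      _ ≤ _ := add_le_add (norm_mul_le _ _) (norm_mul_le _ _)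
  have h3 : ‖D‖ = 0 := by
    by_contra h4
    have h5 : 0 < ‖D‖ := lt_of_le_of_ne (norm_nonneg _) (Ne.symm h4)
    nlinarith
  exact sub_eq_zero.mp (norm_eq_zero.mp h3)

variable {m : ℕ}

/-- The product of the gates `exp(-i θ_a N_a)`, over a list of generators. -/
noncomputable def prodGates (s : List (Gen m)) (θ : Gen m → ℝ) :
    Matrix (Qubits m ⊕ Qubits m) (Qubits m ⊕ Qubits m) ℂ :=
  (s.map fun a => expGate a (θ a)).prod

lemma prodGates_zero (s : List (Gen m)) : prodGates s 0 = 1 := by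
  simp [prodGates, expGate_zero]

lemma hasStrictDerivAt_expGate (a : Gen m) :
    HasStrictDerivAt (expGate a) (-(Complex.I • gen a)) 0 := by
  have h : expGate a = fun t => Real.cos t • (1 : Matrix _ _ ℂ) -
      Real.sin t • (Complex.I • gen a) := by
    ext1 t
    rw [expGate_eq, ← Complex.coe_smul, ← Complex.coe_smul, smul_smul]
  rw [h]
  have h1 := ((Real.hasStrictDerivAt_cos 0).smul_const
    (1 : Matrix (Qubits m ⊕ Qubits m) (Qubits m ⊕ Qubits m) ℂ)).fun_sub
    ((Real.hasStrictDerivAt_sin 0).smul_const (Complex.I • gen a))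
  exact h1.congr_deriv (by simp)

/-- In the product rule at angle zero all the other factors are 1, so the order of the gates does
not affect the derivative. -/
lemma exists_hasStrictFDerivAt_prodGates (s : List (Gen m)) :
    ∃ F' : (Gen m → ℝ) →L[ℝ] Matrix (Qubits m ⊕ Qubits m) (Qubits m ⊕ Qubits m) ℂ,
      HasStrictFDerivAt (prodGates s) F' 0 ∧
        ∀ v, F' v = (s.map fun a => v a • -(Complex.I • gen a)).sum := by
  induction s with
  | nil =>
    refine ⟨0, ?_, by simp⟩
    have : prodGates ([] : List (Gen m)) = fun _ => 1 := by
      ext1 θ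
      simp [prodGates]
    rw [this]
    exact hasStrictFDerivAt_const _ _
  | cons a s ih =>
    obtain ⟨F', hF, hv⟩ := ih
    have h1 : HasStrictFDerivAt (fun θ : Gen m → ℝ => expGate a (θ a)) _ 0 :=
      (hasStrictDerivAt_expGate a).hasStrictFDerivAt.comp (0 : Gen m → ℝ)
        (ContinuousLinearMap.proj (R := ℝ) (φ := fun _ : Gen m => ℝ) a).hasStrictFDerivAt
    have h2 := h1.mul' hF
    refine ⟨_, h2, fun v => ?_⟩
    change expGate a 0 * F' v + (v a • -(Complex.I • gen a)) * prodGates s 0 = _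
    rw [expGate_zero, prodGates_zero, one_mul, mul_one, hv, List.map_cons, List.sum_cons, add_comm]

/-- Coordinates of the skew-Hermitian part with respect to the generators. -/
noncomputable def skewCoord :
    Matrix (Qubits m ⊕ Qubits m) (Qubits m ⊕ Qubits m) ℂ →ₗ[ℝ] (Gen m → ℝ) where
  toFun A b := -(gen b * A).trace.im / 2 ^ (m + 1)
  map_add' A B := by
    ext b
    simp only [mul_add, Matrix.trace_add, Complex.add_im, Pi.add_apply]
    ring
  map_smul' c A := by
    ext b
    simp only [Matrix.mul_smul, Matrix.trace_smul, Complex.smul_im, Pi.smul_apply, smul_eq_mul,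
      RingHom.id_apply]
    ring

lemma skewCoord_one : skewCoord (1 : Matrix (Qubits m ⊕ Qubits m) (Qubits m ⊕ Qubits m) ℂ) = 0 := by
  ext b
  simp [skewCoord, gen_trace]

lemma skewCoord_gen (a b : Gen m) :
    skewCoord (-(Complex.I • gen a)) b = if b = a then 1 else 0 := by
  have h : ((2 : ℂ) ^ (m + 1)).re = 2 ^ (m + 1) := by
    rw [← Complex.ofReal_ofNat, ← Complex.ofReal_pow, Complex.ofReal_re]
  have h0 : (2 : ℝ) ^ (m + 1) ≠ 0 := by simp
  change -((gen b * -(Complex.I • gen a)).trace).im / 2 ^ (m + 1) = _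
  rw [mul_neg, Matrix.mul_smul, Matrix.trace_neg, Matrix.trace_smul, gen_trace_mul]
  split_ifs
  · rw [Complex.neg_im, smul_eq_mul, Complex.I_mul_im, h, neg_neg, div_self h0]
  · simp

lemma sub_conjTranspose_mem_sp {l : Type} [Fintype l] [DecidableEq l]
    {U : Matrix (l ⊕ l) (l ⊕ l) ℂ} (hU : U ∈ CSp l) :
    U - Uᴴ ∈ LieAlgebra.Symplectic.sp l ℂ := by
  have h := J_mul_transpose_of_mem_CSp (conjTranspose_mem_CSp hU)
  rw [Matrix.conjTranspose_conjTranspose] at h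
  rw [mem_sp_iff, Matrix.transpose_sub, mul_sub, h, J_mul_transpose_of_mem_CSp hU, sub_mul, neg_sub]

/-- The skew part of an element of Sp(2n) lies in sp, so its traces against the generators determine
it. -/
lemma sub_conjTranspose_eq_of_skewCoord_eq
    {U W : Matrix (Qubits m ⊕ Qubits m) (Qubits m ⊕ Qubits m) ℂ} (hU : U ∈ CSp (Qubits m))
    (hW : W ∈ CSp (Qubits m)) (h : skewCoord U = skewCoord W) : U - Uᴴ = W - Wᴴ := by
  have htr : ∀ (A : Matrix (Qubits m ⊕ Qubits m) (Qubits m ⊕ Qubits m) ℂ) (b : Gen m),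
      (gen b * (A - Aᴴ)).trace = 2 * ((gen b * A).trace.im : ℂ) * Complex.I := by
    intro A b
    have h1 : (gen b * Aᴴ).trace = starRingEnd ℂ (gen b * A).trace := by
      have := Matrix.trace_conjTranspose (gen b * A)
      rw [Matrix.conjTranspose_mul, gen_conjTranspose, Matrix.trace_mul_comm] at this
      exact this
    rw [mul_sub, Matrix.trace_sub, h1, Complex.sub_conj]
    push_cast
    rfl
  rw [eq_sum_gen (sub_conjTranspose_mem_sp hU), eq_sum_gen (sub_conjTranspose_mem_sp hW)]
  refine Finset.sum_congr rfl fun b _ => ?_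
  have hb : -(gen b * U).trace.im / 2 ^ (m + 1) = -(gen b * W).trace.im / 2 ^ (m + 1) :=
    congrFun h b
  have h0 : (2 : ℝ) ^ (m + 1) ≠ 0 := by simp
  rw [div_left_inj' h0, neg_inj] at hb
  rw [htr, htr, hb]

variable (m) in
/-- The set of products of elementary gates. -/
def gateClosure : Submonoid (Matrix (Qubits m ⊕ Qubits m) (Qubits m ⊕ Qubits m) ℂ) :=
  Submonoid.closure {W | ∃ (a : Gen m) (θ : ℝ), W = expGate a θ}

lemma expGate_mem_gateClosure (a : Gen m) (θ : ℝ) : expGate a θ ∈ gateClosure m :=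
  Submonoid.subset_closure ⟨a, θ, rfl⟩

lemma gateClosure_le : gateClosure m ≤ CSp (Qubits m) := by
  rw [gateClosure, Submonoid.closure_le]
  rintro _ ⟨a, θ, rfl⟩
  exact expGate_mem_CSp a θ

lemma prodGates_mem (s : List (Gen m)) (θ : Gen m → ℝ) : prodGates s θ ∈ gateClosure m := by
  refine list_prod_mem fun W hW => ?_
  obtain ⟨a, -, rfl⟩ := List.mem_map.mp hW
  exact expGate_mem_gateClosure a _

/-- In skew coordinates, the product of all gates, as a function of the angles, has the identity as
its derivative at 0 and so attains every small value. An element of Sp(2n) near 1 shares its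
coordinates with such a product, and `eq_of_skew_part_eq` makes the two equal. -/
lemma eventually_mem_gateClosure :
    ∀ᶠ U in 𝓝 (1 : Matrix (Qubits m ⊕ Qubits m) (Qubits m ⊕ Qubits m) ℂ),
      U ∈ CSp (Qubits m) → U ∈ gateClosure m := by
  set s : List (Gen m) := Finset.univ.toList
  obtain ⟨F', hF, hv⟩ := exists_hasStrictFDerivAt_prodGates s
  set C := LinearMap.toContinuousLinearMap (skewCoord (m := m)) with hC
  have hCf : ∀ A, C A = skewCoord A := fun _ => rfl
  have hid : C.comp F' = (ContinuousLinearEquiv.refl ℝ (Gen m → ℝ) :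
      (Gen m → ℝ) →L[ℝ] (Gen m → ℝ)) := by
    ext1 v
    rw [ContinuousLinearMap.comp_apply, hv, hCf, Finset.sum_map_toList, map_sum]
    ext b
    simp only [map_smul, Finset.sum_apply, Pi.smul_apply, skewCoord_gen, smul_eq_mul, mul_ite,
      mul_zero, mul_one, Finset.sum_ite_eq, Finset.mem_univ, if_true]
    rfl
  have hcomp : HasStrictFDerivAt (C ∘ prodGates s)
      ((ContinuousLinearEquiv.refl ℝ (Gen m → ℝ) : (Gen m → ℝ) →L[ℝ] (Gen m → ℝ))) 0 := by
    rw [← hid]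
    exact C.hasStrictFDerivAt.comp _ hF
  have hmap := hcomp.map_nhds_eq_of_equiv
  have h00 : (C ∘ prodGates s) 0 = 0 := by
    rw [Function.comp_apply, prodGates_zero, hCf, skewCoord_one]
  -- Only angles whose product is close to 1 are admitted, as the uniqueness of the chart requires.
  have hT : {θ : Gen m → ℝ | ‖prodGates s θ - 1‖ < 1} ∈ 𝓝 0 := by
    have hcont : Tendsto (fun θ => ‖prodGates s θ - 1‖) (𝓝 0) (𝓝 ‖prodGates s 0 - 1‖) :=
      (hF.continuousAt.sub continuousAt_const).norm
    rw [prodGates_zero, sub_self, norm_zero] at hcont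
    exact hcont.eventually (gt_mem_nhds one_pos)
  have himg : (C ∘ prodGates s) '' {θ | ‖prodGates s θ - 1‖ < 1} ∈ 𝓝 (0 : Gen m → ℝ) := by
    rw [← h00, ← hmap]
    exact image_mem_map hT
  have hev1 : ∀ᶠ U in 𝓝 (1 : Matrix (Qubits m ⊕ Qubits m) (Qubits m ⊕ Qubits m) ℂ),
      C U ∈ (C ∘ prodGates s) '' {θ | ‖prodGates s θ - 1‖ < 1} := by
    have : Tendsto C (𝓝 1) (𝓝 (C 1)) := C.continuous.continuousAt
    rw [hCf, skewCoord_one] at this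
    exact this himg
  have hev2 : ∀ᶠ U in 𝓝 (1 : Matrix (Qubits m ⊕ Qubits m) (Qubits m ⊕ Qubits m) ℂ),
      ‖Uᴴ - 1‖ < 1 := by
    have hcont : Continuous fun U : Matrix (Qubits m ⊕ Qubits m) (Qubits m ⊕ Qubits m) ℂ =>
        ‖Uᴴ - 1‖ := ((continuous_id.matrix_conjTranspose).sub continuous_const).norm
    have := hcont.tendsto 1
    rw [Matrix.conjTranspose_one, sub_self, norm_zero] at this
    exact this.eventually (gt_mem_nhds one_pos)
  filter_upwards [hev1, hev2] with U ⟨θ, hθ, hCU⟩ hU2 hU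
  have hW : prodGates s θ ∈ CSp (Qubits m) := gateClosure_le (prodGates_mem s θ)
  have := eq_of_skew_part_eq (mul_conjTranspose_of_mem_CSp hU) (mul_conjTranspose_of_mem_CSp hW)
    (sub_conjTranspose_eq_of_skewCoord_eq hU hW hCU.symm) hU2 hθ
  rw [this]
  exact prodGates_mem s θ

/-- R t is a power of R (t/(k+1)), which for large k lies in the neighbourhood of 1 already reached.
-/
lemma oneParam_mem_gateClosure {R : ℝ → Matrix (Qubits m ⊕ Qubits m) (Qubits m ⊕ Qubits m) ℂ}
    (hcont : Continuous R) (h0 : R 0 = 1) (hadd : ∀ s t, R (s + t) = R s * R t)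
    (hR : ∀ t, R t ∈ CSp (Qubits m)) (t : ℝ) : R t ∈ gateClosure m := by
  have h1 : Tendsto (fun k : ℕ => R (t * ((k : ℝ) + 1)⁻¹)) atTop (𝓝 1) := by
    have h2 : Tendsto (fun k : ℕ => t * ((k : ℝ) + 1)⁻¹) atTop (𝓝 0) := by
      have := (tendsto_one_div_add_atTop_nhds_zero_nat (𝕜 := ℝ)).const_mul t
      simpa using this
    have h3 := hcont.tendsto 0
    rw [h0] at h3
    exact h3.comp h2
  obtain ⟨k, hk⟩ := (h1.eventually eventually_mem_gateClosure).exists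
  have hpow : ∀ (j : ℕ) (s : ℝ), R (j * s) = R s ^ j := by
    intro j s
    induction j with
    | zero => simp [h0]
    | succ j ih =>
      rw [pow_succ, ← ih, ← hadd]
      congr 1
      push_cast
      ring
  have hk0 : ((k : ℝ) + 1) ≠ 0 := by positivity
  have h4 : R t = R (t * ((k : ℝ) + 1)⁻¹) ^ (k + 1) := by
    rw [← hpow]
    congr 1
    push_cast
    field_simp
  rw [h4]
  exact pow_mem (hk (hR _)) _

end Skew

/-! ### Symplectic rotations about a line and its quaternionic conjugate -/

section Rotations

variable {l : Type} [Fintype l] [DecidableEq l]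

/-- The projection onto the quaternionic conjugate of the range of a projection `P`. -/
noncomputable def conjProj (P : Matrix (l ⊕ l) (l ⊕ l) ℂ) : Matrix (l ⊕ l) (l ⊕ l) ℂ :=
  -(Matrix.J l ℂ * Pᵀ * Matrix.J l ℂ)

/-- The symplectic rotation by the phases `exp(i t)` on the range of `P` and `exp(-i t)` on its
quaternionic conjugate. -/
noncomputable def symplRot (P : Matrix (l ⊕ l) (l ⊕ l) ℂ) (t : ℝ) : Matrix (l ⊕ l) (l ⊕ l) ℂ :=
  1 + (Complex.exp (t * Complex.I) - 1) • P + (Complex.exp (-(t * Complex.I)) - 1) • conjProj P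

variable {P : Matrix (l ⊕ l) (l ⊕ l) ℂ}

lemma conjProj_mul_self (hP : P * P = P) : conjProj P * conjProj P = conjProj P := by
  have h := congrArg Matrix.transpose hP
  rw [Matrix.transpose_mul] at h
  rw [conjProj, neg_mul_neg]
  simp only [mul_assoc, J_mul_J_mul, mul_neg]
  rw [← mul_assoc Pᵀ Pᵀ, h]

/-- The hypothesis P Δ Pᵀ = 0 makes the range of P orthogonal to its quaternionic conjugate, so that
the two phases of `symplRot` act independently. -/
lemma mul_conjProj (hPJ : P * Matrix.J l ℂ * Pᵀ = 0) : P * conjProj P = 0 := by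
  rw [conjProj, mul_neg, ← mul_assoc, ← mul_assoc, hPJ, zero_mul, neg_zero]

lemma J_conjTranspose {l : Type} [DecidableEq l] : (Matrix.J l ℂ)ᴴ = -Matrix.J l ℂ := by
  have : (Matrix.J l ℂ)ᴴ = ((Matrix.J l ℂ).map (starRingEnd ℂ))ᵀ := rfl
  rw [this, J_map_conj, Matrix.J_transpose]

lemma conjProj_conjTranspose (hP : Pᴴ = P) : (conjProj P)ᴴ = conjProj P := by
  have h : (Pᵀ)ᴴ = Pᵀ := congrArg Matrix.transpose hP
  rw [conjProj, Matrix.conjTranspose_neg, Matrix.conjTranspose_mul, Matrix.conjTranspose_mul, h,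
    J_conjTranspose]
  simp [mul_assoc]

lemma conjProj_mul (hP : Pᴴ = P) (hPJ : P * Matrix.J l ℂ * Pᵀ = 0) : conjProj P * P = 0 := by
  have h := congrArg Matrix.conjTranspose (mul_conjProj hPJ)
  rwa [Matrix.conjTranspose_mul, conjProj_conjTranspose hP, hP, Matrix.conjTranspose_zero] at h

lemma symplRot_zero : symplRot P 0 = 1 := by simp [symplRot]

lemma symplRot_add (hP : P * P = P) (hP' : Pᴴ = P) (hPJ : P * Matrix.J l ℂ * Pᵀ = 0) (s t : ℝ) :
    symplRot P (s + t) = symplRot P s * symplRot P t := by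
  have h1 := conjProj_mul_self hP
  have h2 := mul_conjProj hPJ
  have h3 := conjProj_mul hP' hPJ
  simp only [symplRot, mul_add, add_mul, one_mul, mul_one, Matrix.smul_mul, Matrix.mul_smul, hP, h1,
    h2, h3, smul_zero, add_zero, Complex.ofReal_add, neg_add, Complex.exp_add, smul_smul]
  module

lemma continuous_symplRot : Continuous (symplRot P) := by
  unfold symplRot
  fun_prop

lemma symplRot_conjTranspose (hP : Pᴴ = P) (t : ℝ) : (symplRot P t)ᴴ = symplRot P (-t) := by
  have h : ∀ z : ℂ, star (Complex.exp z - 1) = Complex.exp (starRingEnd ℂ z) - 1 := fun z => by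
    rw [star_sub, star_one, Complex.exp_conj]
    rfl
  simp only [symplRot, Matrix.conjTranspose_add, Matrix.conjTranspose_smul, hP,
    conjProj_conjTranspose hP, Matrix.conjTranspose_one, h]
  simp

lemma symplRot_mem_CSp (hP : P * P = P) (hP' : Pᴴ = P) (hPJ : P * Matrix.J l ℂ * Pᵀ = 0)
    (t : ℝ) : symplRot P t ∈ CSp l := by
  have h1 : symplRot P t * (symplRot P t)ᴴ = 1 := by
    rw [symplRot_conjTranspose hP', ← symplRot_add hP hP' hPJ, add_neg_cancel, symplRot_zero]
  -- Transposition followed by exchange with Δ interchanges P and `conjProj P`; since they carry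
  -- opposite phases, this turns the rotation into its inverse.
  have h2 : Matrix.J l ℂ * Pᵀ = conjProj P * Matrix.J l ℂ := by
    rw [conjProj, neg_mul, mul_assoc, mul_assoc, J_mul_J]
    simp
  have h3 : Matrix.J l ℂ * (conjProj P)ᵀ = P * Matrix.J l ℂ := by
    rw [conjProj, Matrix.transpose_neg, Matrix.transpose_mul, Matrix.transpose_mul,
      Matrix.transpose_transpose, Matrix.J_transpose]
    simp [J_mul_J_mul]
  have h4 : Matrix.J l ℂ * (symplRot P t)ᵀ = (symplRot P t)ᴴ * Matrix.J l ℂ := by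
    rw [symplRot_conjTranspose hP']
    simp only [symplRot, Matrix.transpose_add, Matrix.transpose_smul, Matrix.transpose_one, mul_add,
      add_mul, Matrix.mul_smul, Matrix.smul_mul, h2, h3, mul_one, one_mul, Complex.ofReal_neg,
      neg_mul, neg_neg]
    abel
  exact mem_CSp_iff.mpr ⟨h1, by rw [mul_assoc, h4, ← mul_assoc, h1, one_mul]⟩

/-- The projection onto the line spanned by `v`. -/
noncomputable def lineProj {l : Type} [Fintype l] (v : l ⊕ l → ℂ) : Matrix (l ⊕ l) (l ⊕ l) ℂ :=
  (star v ⬝ᵥ v)⁻¹ • Matrix.vecMulVec v (star v)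

lemma dotProduct_J_mulVec_self (v : l ⊕ l → ℂ) : v ⬝ᵥ (Matrix.J l ℂ *ᵥ v) = 0 := by
  have h : v ⬝ᵥ (Matrix.J l ℂ *ᵥ v) = -(v ⬝ᵥ (Matrix.J l ℂ *ᵥ v)) := by
    conv_lhs => rw [Matrix.dotProduct_mulVec, ← Matrix.mulVec_transpose, Matrix.J_transpose,
      Matrix.neg_mulVec, neg_dotProduct, dotProduct_comm]
  exact self_eq_neg.mp h

open scoped ComplexOrder in
lemma lineProj_mul_self {l : Type} [Fintype l] {v : l ⊕ l → ℂ} (hv : v ≠ 0) : lineProj v * lineProj v = lineProj v := by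
  have hs : star v ⬝ᵥ v ≠ 0 := fun h => hv (dotProduct_star_self_eq_zero.mp h)
  rw [lineProj, Matrix.smul_mul, Matrix.mul_smul, Matrix.vecMulVec_mul_vecMulVec,
    Matrix.vecMulVec_smul, smul_smul (star v ⬝ᵥ v)⁻¹ (star v ⬝ᵥ v), inv_mul_cancel₀ hs, one_smul]

lemma lineProj_conjTranspose {l : Type} [Fintype l] (v : l ⊕ l → ℂ) : (lineProj v)ᴴ = lineProj v := by
  have : star (star v ⬝ᵥ v) = star v ⬝ᵥ v :=
    (Matrix.star_dotProduct v v).symm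
  rw [lineProj, Matrix.conjTranspose_smul, Matrix.conjTranspose_vecMulVec, star_star, star_inv₀,
    this]

/-- A line is isotropic for an antisymmetric form, so every line is admissible for `symplRot`. -/
lemma lineProj_J_transpose (v : l ⊕ l → ℂ) :
    lineProj v * Matrix.J l ℂ * (lineProj v)ᵀ = 0 := by
  rw [lineProj, Matrix.transpose_smul, Matrix.transpose_vecMulVec, Matrix.smul_mul, Matrix.smul_mul,
    Matrix.mul_smul, mul_assoc, Matrix.mul_vecMulVec, Matrix.vecMulVec_mul_vecMulVec,
    dotProduct_J_mulVec_self]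
  simp

lemma lineProj_mulVec {l : Type} [Fintype l] (v x : l ⊕ l → ℂ) :
    lineProj v *ᵥ x = ((star v ⬝ᵥ v)⁻¹ * (star v ⬝ᵥ x)) • v := by
  rw [lineProj, Matrix.smul_mulVec, Matrix.vecMulVec_mulVec, ← smul_smul]
  congr 1
  ext
  simp [mul_comm]

/-- The conjugate line is spanned by Δ v̄, and the hypothesis expresses orthogonality of x to it. -/
lemma conjProj_lineProj_mulVec {v x : l ⊕ l → ℂ} (h : v ⬝ᵥ (Matrix.J l ℂ *ᵥ x) = 0) :
    conjProj (lineProj v) *ᵥ x = 0 := by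
  rw [conjProj, lineProj, Matrix.transpose_smul, Matrix.transpose_vecMulVec, Matrix.neg_mulVec,
    ← Matrix.mulVec_mulVec, ← Matrix.mulVec_mulVec, Matrix.smul_mulVec, Matrix.vecMulVec_mulVec, h]
  simp

lemma star_mulVec_dotProduct_mulVec {ι : Type*} [Fintype ι] [DecidableEq ι] {U : Matrix ι ι ℂ}
    (hU : Uᴴ * U = 1) (x y : ι → ℂ) : star (U *ᵥ x) ⬝ᵥ (U *ᵥ y) = star x ⬝ᵥ y := by
  rw [Matrix.star_mulVec, Matrix.dotProduct_mulVec, Matrix.vecMul_vecMul, hU, Matrix.vecMul_one]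

-- The range of U - 1 is invariant and nonzero, so it contains an eigenvector. For unitary U this
-- range is orthogonal to the fixed vectors, which excludes the eigenvalue 1.
open scoped ComplexOrder in
lemma exists_eigenvector_ne_one {ι : Type*} [Fintype ι] [DecidableEq ι] {U : Matrix ι ι ℂ}
    (hU : Uᴴ * U = 1) (hne : U ≠ 1) :
    ∃ (z : ℂ) (v : ι → ℂ), v ≠ 0 ∧ z ≠ 1 ∧ U *ᵥ v = z • v := by
  set E := LinearMap.range (U - 1).mulVecLin with hE
  have hmaps : ∀ x ∈ E, U.mulVecLin x ∈ E := by
    rintro _ ⟨w, rfl⟩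
    refine ⟨U *ᵥ w, ?_⟩
    simp only [Matrix.mulVecLin_apply, Matrix.mulVec_mulVec]
    rw [sub_mul, mul_sub, one_mul, mul_one]
  have hnt : Nontrivial E := by
    rw [Submodule.nontrivial_iff_ne_bot]
    intro h
    rw [hE, LinearMap.range_eq_bot] at h
    apply hne
    rw [← sub_eq_zero]
    exact Matrix.ext_of_mulVec_single fun k => by
      exact (LinearMap.congr_fun h (Pi.single k 1)).trans (Matrix.zero_mulVec _).symm
  obtain ⟨z, hz⟩ := Module.End.exists_eigenvalue (U.mulVecLin.restrict hmaps)
  obtain ⟨⟨v, hv⟩, hvz⟩ := hz.exists_hasEigenvector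
  have hv0 : v ≠ 0 := fun h => hvz.2 (Subtype.ext h)
  have hUv : U *ᵥ v = z • v := congrArg Subtype.val hvz.apply_eq_smul
  refine ⟨z, v, hv0, ?_, hUv⟩
  rintro rfl
  rw [one_smul] at hUv
  obtain ⟨w, rfl⟩ := hv
  rw [Matrix.mulVecLin_apply] at hv0 hUv
  apply hv0
  rw [← dotProduct_star_self_eq_zero]
  set x := (U - 1) *ᵥ w with hx
  have h1 : star x ⬝ᵥ (U *ᵥ w) = star x ⬝ᵥ w := by
    rw [← star_mulVec_dotProduct_mulVec hU x w, hUv]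
  have h2 : x = U *ᵥ w - w := by rw [hx, Matrix.sub_mulVec, Matrix.one_mulVec]
  nth_rewrite 2 [h2]
  rw [dotProduct_sub, h1, sub_self]

lemma dotProduct_J_mulVec_of_mem_CSp {U : Matrix (l ⊕ l) (l ⊕ l) ℂ} (hU : U ∈ CSp l)
    (x y : l ⊕ l → ℂ) :
    (U *ᵥ x) ⬝ᵥ (Matrix.J l ℂ *ᵥ (U *ᵥ y)) = x ⬝ᵥ (Matrix.J l ℂ *ᵥ y) := by
  have h1 : Uᵀ * (Matrix.J l ℂ * U) = Matrix.J l ℂ := by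
    have h2 := congrArg (fun B => -(Matrix.J l ℂ * B)) (J_mul_transpose_of_mem_CSp hU)
    simp only [J_mul_J_mul, neg_neg] at h2
    rw [h2, neg_mul, mul_assoc, mul_assoc, J_mul_J_mul, mul_neg,
      conjTranspose_mul_of_mem_CSp hU, mul_neg, mul_one, neg_neg]
  rw [Matrix.mulVec_mulVec, Matrix.dotProduct_mulVec, ← Matrix.vecMul_transpose,
    Matrix.vecMul_vecMul, h1, Matrix.dotProduct_mulVec]

end Rotations

/-! ### Reduction of an arbitrary element of Sp(2n) to the identity -/

section Closure

variable {m : ℕ}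

-- Induction on a bound k for the codimension of the fixed space. A rotation about an eigenvector v
-- with eigenvalue z ≠ 1 makes v fixed and keeps all vectors fixed by U, since these are orthogonal
-- both to v and to its quaternionic conjugate. No diagonalization by symplectic bases is needed.
open scoped ComplexOrder in
lemma mem_gateClosure_of_mem_CSp (k : ℕ)
    (U : Matrix (Qubits m ⊕ Qubits m) (Qubits m ⊕ Qubits m) ℂ) (hU : U ∈ CSp (Qubits m))
    (hk : Fintype.card (Qubits m ⊕ Qubits m) ≤
      k + Module.finrank ℂ (LinearMap.ker (U - 1).mulVecLin)) : U ∈ gateClosure m := by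
  induction k generalizing U with
  | zero =>
    have htop : LinearMap.ker (U - 1).mulVecLin = ⊤ := by
      apply Submodule.eq_top_of_finrank_eq
      refine le_antisymm (Submodule.finrank_le _) ?_
      rw [Module.finrank_fintype_fun_eq_card]
      omega
    have : U = 1 := by
      rw [LinearMap.ker_eq_top] at htop
      rw [← sub_eq_zero]
      exact Matrix.ext_of_mulVec_single fun k => by
        exact (LinearMap.congr_fun htop (Pi.single k 1)).trans (Matrix.zero_mulVec _).symm
    rw [this]
    exact one_mem _
  | succ k ih =>
    by_cases hne : U = 1
    · rw [hne]
      exact one_mem _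
    have hUU := conjTranspose_mul_of_mem_CSp hU
    obtain ⟨z, v, hv, hz, hUv⟩ := exists_eigenvector_ne_one hUU hne
    have hs : star v ⬝ᵥ v ≠ 0 := fun h => hv (dotProduct_star_self_eq_zero.mp h)
    have hzn : ‖z‖ = 1 := by
      have h := star_mulVec_dotProduct_mulVec hUU v v
      rw [hUv, star_smul, smul_dotProduct, dotProduct_smul, smul_smul, smul_eq_mul] at h
      have h1 : star z * z = 1 := mul_right_cancel₀ hs (by rw [h, one_mul])
      have h2 := congrArg norm h1
      rw [norm_mul, norm_star, norm_one] at h2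
      nlinarith [norm_nonneg z]
    have hzexp : Complex.exp (z.arg * Complex.I) = z := by
      have := Complex.norm_mul_exp_arg_mul_I z
      rwa [hzn, Complex.ofReal_one, one_mul] at this
    set P := lineProj v
    have hP : P * P = P := lineProj_mul_self hv
    have hP' : Pᴴ = P := lineProj_conjTranspose v
    have hPJ : P * Matrix.J (Qubits m) ℂ * Pᵀ = 0 := lineProj_J_transpose v
    have hrot : ∀ t, symplRot P t ∈ gateClosure m := oneParam_mem_gateClosure continuous_symplRot
      symplRot_zero (symplRot_add hP hP' hPJ) (symplRot_mem_CSp hP hP' hPJ)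
    -- As |z| = 1, the phase exp(-i arg z) on the line of v cancels the eigenvalue.
    set W := symplRot P (-z.arg) * U with hW
    have hWC : W ∈ CSp (Qubits m) := mul_mem (symplRot_mem_CSp hP hP' hPJ _) hU
    have hUW : U = symplRot P z.arg * W := by
      rw [hW, ← mul_assoc, ← symplRot_add hP hP' hPJ, add_neg_cancel, symplRot_zero, one_mul]
    have hfix : ∀ x, U *ᵥ x = x → W *ᵥ x = x := by
      intro x hx
      have h1 : star v ⬝ᵥ x = 0 := by
        have h := star_mulVec_dotProduct_mulVec hUU v x
        rw [hUv, hx, star_smul, smul_dotProduct, smul_eq_mul] at h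
        have h2 : (star z - 1) * (star v ⬝ᵥ x) = 0 := by rw [sub_mul, h, one_mul, sub_self]
        refine (mul_eq_zero.mp h2).resolve_left fun h3 => hz ?_
        have := congrArg star (sub_eq_zero.mp h3)
        simpa using this
      -- U preserves the symplectic form, which multiplies this pairing by z ≠ 1.
      have h2 : v ⬝ᵥ (Matrix.J (Qubits m) ℂ *ᵥ x) = 0 := by
        have h := dotProduct_J_mulVec_of_mem_CSp hU v x
        rw [hUv, hx, smul_dotProduct, smul_eq_mul] at h
        have h2 : (z - 1) * (v ⬝ᵥ (Matrix.J (Qubits m) ℂ *ᵥ x)) = 0 := by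
          rw [sub_mul, h, one_mul, sub_self]
        exact (mul_eq_zero.mp h2).resolve_left (sub_ne_zero.mpr hz)
      rw [hW, ← Matrix.mulVec_mulVec, hx, symplRot, Matrix.add_mulVec, Matrix.add_mulVec,
        Matrix.smul_mulVec, Matrix.smul_mulVec, conjProj_lineProj_mulVec h2, lineProj_mulVec, h1]
      simp
    have hWv : W *ᵥ v = v := by
      rw [hW, ← Matrix.mulVec_mulVec, hUv, Matrix.mulVec_smul, symplRot, Matrix.add_mulVec,
        Matrix.add_mulVec, Matrix.smul_mulVec, Matrix.smul_mulVec,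
        conjProj_lineProj_mulVec (dotProduct_J_mulVec_self v), lineProj_mulVec,
        inv_mul_cancel₀ hs, one_smul, smul_zero, add_zero, Matrix.one_mulVec]
      have hexp : z * Complex.exp (((-z.arg : ℝ) : ℂ) * Complex.I) = 1 := by
        rw [Complex.ofReal_neg, neg_mul, Complex.exp_neg, hzexp, mul_inv_cancel₀]
        exact norm_ne_zero_iff.mp (by rw [hzn]; exact one_ne_zero)
      rw [← one_smul ℂ v, smul_smul, ← add_smul, mul_one, add_sub_cancel, smul_smul, hexp]
    have hlt : LinearMap.ker (U - 1).mulVecLin < LinearMap.ker (W - 1).mulVecLin := by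
      have hmem : ∀ (A : Matrix (Qubits m ⊕ Qubits m) (Qubits m ⊕ Qubits m) ℂ) x,
          x ∈ LinearMap.ker (A - 1).mulVecLin ↔ A *ᵥ x = x := by
        intro A x
        rw [LinearMap.mem_ker, Matrix.mulVecLin_apply, Matrix.sub_mulVec, Matrix.one_mulVec,
          sub_eq_zero]
      refine lt_of_le_of_ne (fun x hx => (hmem _ _).mpr (hfix x ((hmem _ _).mp hx))) fun h => ?_
      have h1 : U *ᵥ v = v := (hmem _ _).mp (h ▸ (hmem _ _).mpr hWv)
      rw [hUv] at h1
      have h2 : (z - 1) • v = 0 := by rw [sub_smul, h1, one_smul, sub_self]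
      exact hv ((smul_eq_zero.mp h2).resolve_left (sub_ne_zero.mpr hz))
    rw [hUW]
    refine mul_mem (hrot _) (ih W hWC ?_)
    have := Submodule.finrank_lt_finrank_of_lt hlt
    omega

theorem gateClosure_eq : gateClosure m = CSp (Qubits m) :=
  le_antisymm gateClosure_le fun U hU =>
    mem_gateClosure_of_mem_CSp _ U hU (Nat.le_add_right _ _)

end Closure

end SpAKLT

namespace SpAKLT

variable {m : ℕ}

/-! ### An adaptive rule that executes a given gate -/

/-- The label of the product of two Pauli operators. -/
noncomputable def mulLabel (a b : (Fin m → Fin 4) × Fin 4) : (Fin m → Fin 4) × Fin 4 :=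
  (pauliOp_mul_eq_smul a b).choose

lemma pauliOp_mul (a b : (Fin m → Fin 4) × Fin 4) :
    ∃ c : ℂ, c ≠ 0 ∧ pauliOp a * pauliOp b = c • pauliOp (mulLabel a b) :=
  (pauliOp_mul_eq_smul a b).choose_spec

/-- The product of a list of elementary gates, the first one in the list acting first. -/
noncomputable def gateProd : List (Gen m × ℝ) →
    Matrix (Qubits m ⊕ Qubits m) (Qubits m ⊕ Qubits m) ℂ
  | [] => 1
  | g :: gs => gateProd gs * expGate g.1 g.2

lemma exists_gateProd_eq {V : Matrix (Qubits m ⊕ Qubits m) (Qubits m ⊕ Qubits m) ℂ}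
    (hV : V ∈ gateClosure m) : ∃ gs : List (Gen m × ℝ), V = gateProd gs := by
  induction hV using Submonoid.closure_induction_right with
  | one => exact ⟨[], rfl⟩
  | mul_right x _ y hy ih =>
    obtain ⟨gs, rfl⟩ := ih
    obtain ⟨a, θ, rfl⟩ := hy
    exact ⟨(a, θ) :: gs, rfl⟩

/-- The gates still to be executed, and the label of the byproduct operator so far. -/
abbrev Progress (m : ℕ) : Type := List (Gen m × ℝ) × ((Fin m → Fin 4) × Fin 4)

/-- The update of the progress by the next outcome. -/
noncomputable def Progress.step : Progress m → Gen m → Progress m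
  | ([], B), b => ([], mulLabel b.1 B)
  | (g :: gs, B), b => (if opCommSign b.1 g.1.1 = -1 then gs else g :: gs, mulLabel b.1 B)

instance : Nonempty (Gen m) := by
  rw [← Fintype.card_pos_iff, card_gen]
  positivity

/-- The rotation of the next basis: the rotation angle of the next gate is corrected by the
commutation sign of the byproduct operator. -/
noncomputable def Progress.rot : Progress m → Matrix (Qubits m ⊕ Qubits m) (Qubits m ⊕ Qubits m) ℂ
  | ([], _) => expGate (Classical.arbitrary (Gen m)) 0
  | (g :: _, B) => expGate g.1 (opCommSign B g.1.1 * g.2 / 2)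

/-- The progress after given outcomes. -/
noncomputable def progress (gs : List (Gen m × ℝ)) (h : List (Gen m)) : Progress m :=
  h.foldl Progress.step (gs, (fun _ => 0, 0))

/-- The adaptive rule that executes a list of gates. -/
noncomputable def gateRule (gs : List (Gen m × ℝ)) : Rule m := fun h => (progress gs h).rot

lemma gateRule_isElementary (gs : List (Gen m × ℝ)) : (gateRule gs).IsElementary := by
  intro h
  rw [gateRule]
  match progress gs h with
  | ([], _) => exact ⟨_, _, rfl⟩
  | (g :: _, B) => exact ⟨_, _, rfl⟩

lemma Rule.IsElementary.isSymmetric {π : Rule m} (hπ : π.IsElementary) : π.IsSymmetric := by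
  intro h
  obtain ⟨a, θ, hh⟩ := hπ h
  exact hh ▸ expGate_mem_CSp a θ

/-- The invariant of the adaptive rule: the induced operator is a Pauli byproduct times a matrix D,
the part already executed, and the remaining gates complete D to the full product. The sign in the
angle is the one produced by moving the gate past the byproduct. -/
lemma gateRule_op (gs : List (Gen m × ℝ)) {N : ℕ} (i : Fin N → Gen m) :
    ∃ (c : ℂ) (D : Matrix (Qubits m ⊕ Qubits m) (Qubits m ⊕ Qubits m) ℂ), c ≠ 0 ∧
      (gateRule gs).op i = c • (pauliOp (progress gs (List.ofFn i)).2 * D) ∧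
      gateProd (progress gs (List.ofFn i)).1 * D = gateProd gs := by
  induction N with
  | zero =>
    refine ⟨1, 1, one_ne_zero, ?_, ?_⟩
    · rw [Rule.op_zero, List.ofFn_zero]
      change 1 = (1 : ℂ) • (pauliOp (fun _ => 0, 0) * 1)
      rw [pauliOp_one, one_smul, mul_one]
    · rw [List.ofFn_zero, mul_one]
      rfl
  | succ N ih =>
    obtain ⟨c, D, hc, hop, hD⟩ := ih (Fin.init i)
    set b := i (Fin.last N)
    have hi : List.ofFn i = List.ofFn (Fin.init i) ++ [b] := by
      rw [← ofFn_snoc, Fin.snoc_init_self]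
    have hst : progress gs (List.ofFn i) = (progress gs (List.ofFn (Fin.init i))).step b := by
      rw [hi, progress, List.foldl_append]
      rfl
    have hopi : (gateRule gs).op i =
        krausOp (rotVec (progress gs (List.ofFn (Fin.init i))).rot b) *
          (gateRule gs).op (Fin.init i) := by
      rw [← Fin.snoc_init_self i, Rule.op_snoc]
      simp only [Fin.snoc_init_self]
      rfl
    rw [hst, hopi, hop]
    generalize progress gs (List.ofFn (Fin.init i)) = st at hD
    have hd : (2 ^ (m + 1) : ℂ)⁻¹ ≠ 0 := by simp
    obtain ⟨gs', B⟩ := st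
    obtain ⟨c', hc', hmul⟩ := pauliOp_mul b.1 B
    -- An identity step changes only the byproduct. It occurs after a failure and also when no gate
    -- is left and the remaining sites are measured with angle 0.
    have hfail : ((2 ^ (m + 1) : ℂ)⁻¹ • gen b) * (c • (pauliOp B * D)) =
        ((2 ^ (m + 1) : ℂ)⁻¹ * c * c') • (pauliOp (mulLabel b.1 B) * D) := by
      rw [Matrix.smul_mul, Matrix.mul_smul, ← mul_assoc, gen, hmul, Matrix.smul_mul, smul_smul,
        smul_smul, mul_assoc]
    have hne : (2 ^ (m + 1) : ℂ)⁻¹ * c * c' ≠ 0 := mul_ne_zero (mul_ne_zero hd hc) hc'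
    match gs', hD with
    | [], hD =>
      refine ⟨_, D, hne, ?_, hD⟩
      simp only [Progress.step, Progress.rot]
      rw [← hfail, expGate_zero, krausOp_rotVec (one_mem _)]
      simp
    | g :: gs', hD =>
      simp only [Progress.step, Progress.rot] at hD ⊢
      rw [krausOp_rotVec_expGate]
      by_cases hs : opCommSign b.1 g.1.1 = -1
      · refine ⟨_, expGate g.1 g.2 * D, hne, ?_, ?_⟩
        · rw [if_pos hs, Matrix.smul_mul, Matrix.mul_smul, ← mul_assoc, mul_assoc (gen b),
            ← pauliOp_mul_expGate, ← mul_assoc, gen, hmul, Matrix.smul_mul, Matrix.smul_mul,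
            smul_smul, smul_smul, mul_assoc, mul_assoc]
        · rw [if_pos hs, ← mul_assoc]
          exact hD
      · refine ⟨_, D, hne, ?_, ?_⟩
        · rw [if_neg hs, hfail]
        · rw [if_neg hs]
          exact hD

/-! ### Probability that the list of gates is not yet finished -/

/-- Upper bound for the indicator of unfinished progress. -/
noncomputable def Progress.weight (st : Progress m) : ℝ := 2 ^ st.1.length - 1

variable (m) in
/-- The factor by which the total weight grows at most with every outcome. -/
noncomputable def growth : ℝ := 2 ^ m * (2 * 2 ^ m + 1) - 2 ^ m * (2 ^ m + 1) / 2

lemma growth_nonneg : 0 ≤ growth m := by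
  have : (0 : ℝ) < 2 ^ m := by positivity
  unfold growth
  nlinarith

/-- With k + 1 gates left, each of the n(n+1) successful outcomes lowers the weight by 2 ^ k, which
is more than half of 2 ^ (k+1) - 1; here n = 2 ^ m. The half is the one in `growth`. Subtracting 1
makes finished progress weigh 0 and stay so. -/
lemma sum_weight_step (st : Progress m) :
    ∑ b, (st.step b).weight ≤ growth m * st.weight := by
  match st with
  | ([], B) => simp [Progress.step, Progress.weight]
  | (g :: gs, B) =>
    have hw : ∀ b : Gen m, (Progress.step (g :: gs, B) b).weight =
        (2 ^ (gs.length + 1) - 1) - if opCommSign b.1 g.1.1 = -1 then 2 ^ gs.length else 0 := by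
      intro b
      simp only [Progress.step, Progress.weight]
      split_ifs
      · rw [pow_succ]; ring
      · simp
    rw [Finset.sum_congr rfl fun b _ => hw b, Finset.sum_sub_distrib, ← Finset.sum_filter,
      Finset.sum_const, Finset.sum_const, card_successes, Finset.card_univ, card_gen]
    simp only [nsmul_eq_mul, Progress.weight, List.length_cons, growth, pow_succ]
    have h1 : (0 : ℝ) < 2 ^ m := by positivity
    push_cast
    nlinarith

lemma sum_weight (N : ℕ) (st : Progress m) :
    ∑ i : Fin N → Gen m, ((List.ofFn i).foldl Progress.step st).weight ≤
      growth m ^ N * st.weight := by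
  induction N generalizing st with
  | zero => simp
  | succ N ih =>
    rw [sum_fin_succ]
    simp only [List.ofFn_cons, List.foldl_cons]
    calc _ ≤ ∑ b, growth m ^ N * (st.step b).weight := Finset.sum_le_sum fun b _ => ih _
      _ = growth m ^ N * ∑ b, (st.step b).weight := by rw [Finset.mul_sum]
      _ ≤ growth m ^ N * (growth m * st.weight) :=
        mul_le_mul_of_nonneg_left (sum_weight_step st) (pow_nonneg growth_nonneg N)
      _ = _ := by ring

theorem tendsto_execProb_gateRule (gs : List (Gen m × ℝ)) {L : Qubits m ⊕ Qubits m → ℂ}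
    (hL : L ≠ 0) : Tendsto (fun N => (gateRule gs).execProb L N (gateProd gs)) atTop (𝓝 1) := by
  have hπ := (gateRule_isElementary gs).isSymmetric
  set d : ℝ := 2 ^ m * (2 * 2 ^ m + 1) with hd
  have hm : (0 : ℝ) < 2 ^ m := by positivity
  have hd0 : 0 < d := by positivity
  set w : ℝ := Progress.weight (gs, ((fun _ => 0, 0) : (Fin m → Fin 4) × Fin 4)) with hw
  have hcard : ∀ N, ((Fintype.card (Fin N → Gen m) : ℕ) : ℝ) = d ^ N := by
    intro N
    rw [Fintype.card_fun, Fintype.card_fin, card_gen, hd]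
    push_cast
    rfl
  -- By the invariant, an empty list of remaining gates means that the full product has been
  -- executed; otherwise the weight is at least 1.
  have hfin : ∀ (N : ℕ) (i : Fin N → Gen m), ¬ (gateRule gs).Executes i (gateProd gs) →
      1 ≤ (progress gs (List.ofFn i)).weight := by
    intro N i hi
    obtain ⟨c, D, hc, hop, hD⟩ := gateRule_op gs i
    rcases hst : (progress gs (List.ofFn i)).1 with _ | ⟨g, gs'⟩
    · rw [hst] at hD
      refine absurd ((executes_iff _ _ _).mpr ⟨(progress gs (List.ofFn i)).2, c, hc, ?_⟩) hi
      rw [hop, ← hD, gateProd, one_mul]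
    · rw [Progress.weight, hst, List.length_cons, pow_succ]
      have : (1 : ℝ) ≤ 2 ^ gs'.length := one_le_pow₀ one_le_two
      linarith
  have hnonneg : ∀ st : Progress m, 0 ≤ st.weight := fun st =>
    sub_nonneg.mpr (one_le_pow₀ one_le_two)
  -- A Markov bound: outcomes are uniform, so the probability of failure is at most the mean weight,
  -- and this is at most (growth/d)^N times the initial weight.
  have hlow : ∀ N, 1 - (growth m / d) ^ N * w ≤ (gateRule gs).execProb L N (gateProd gs) := by
    intro N
    have h1 : ∀ i : Fin N → Gen m, d⁻¹ ^ N * (1 - (progress gs (List.ofFn i)).weight) ≤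
        Set.indicator {i | (gateRule gs).Executes i (gateProd gs)}
          (fun i => (gateRule gs).prob L i) i := by
      classical
      intro i
      rw [Set.indicator_apply, prob_eq hπ hL]
      have hp : 0 ≤ d⁻¹ ^ N := by positivity
      split_ifs with hi
      · exact mul_le_of_le_one_right hp (by linarith [hnonneg (progress gs (List.ofFn i))])
      · exact mul_nonpos_of_nonneg_of_nonpos hp (by linarith [hfin N i hi])
    calc 1 - (growth m / d) ^ N * w = d⁻¹ ^ N * (d ^ N - growth m ^ N * w) := by
          rw [mul_sub, ← mul_pow, inv_mul_cancel₀ hd0.ne', one_pow, div_eq_inv_mul, mul_pow]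
          ring
      _ ≤ d⁻¹ ^ N * (d ^ N - ∑ i : Fin N → Gen m, (progress gs (List.ofFn i)).weight) := by
          apply mul_le_mul_of_nonneg_left _ (by positivity)
          exact sub_le_sub_left (sum_weight N _) _
      _ = ∑ i : Fin N → Gen m, d⁻¹ ^ N * (1 - (progress gs (List.ofFn i)).weight) := by
          rw [← Finset.mul_sum, Finset.sum_sub_distrib, Finset.sum_const, Finset.card_univ,
            nsmul_eq_mul, mul_one, hcard]
      _ ≤ _ := Finset.sum_le_sum fun i _ => h1 i
  have hup : ∀ N, (gateRule gs).execProb L N (gateProd gs) ≤ 1 := by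
    intro N
    calc (gateRule gs).execProb L N (gateProd gs) ≤ ∑ _i : Fin N → Gen m, d⁻¹ ^ N := by
          refine Finset.sum_le_sum fun i _ => ?_
          refine (Set.indicator_le_self' (fun i _ => ?_) i).trans (prob_eq hπ hL i).le
          rw [prob_eq hπ hL]
          positivity
      _ = 1 := by
          rw [Finset.sum_const, Finset.card_univ, nsmul_eq_mul, hcard, ← mul_pow,
            mul_inv_cancel₀ hd0.ne', one_pow]
  have hlim : Tendsto (fun N => 1 - (growth m / d) ^ N * w) atTop (𝓝 1) := by
    have h1 : growth m / d < 1 := by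
      rw [div_lt_one hd0, growth, hd]
      nlinarith
    have h2 := (tendsto_pow_atTop_nhds_zero_of_lt_one (div_nonneg growth_nonneg hd0.le) h1).mul_const w
    simpa using h2.const_sub 1
  exact tendsto_of_tendsto_of_tendsto_of_le_of_le hlim tendsto_const_nhds hlow hup

theorem exists_elementary_rule {V : Matrix (Qubits m ⊕ Qubits m) (Qubits m ⊕ Qubits m) ℂ}
    (hV : V ∈ CSp (Qubits m)) : ∃ π : Rule m, π.IsElementary ∧
      ∀ L : Qubits m ⊕ Qubits m → ℂ, L ≠ 0 →
        Tendsto (fun N => π.execProb L N V) atTop (𝓝 1) := by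
  rw [← gateClosure_eq] at hV
  obtain ⟨gs, rfl⟩ := exists_gateProd_eq hV
  exact ⟨gateRule gs, gateRule_isElementary gs, fun L hL => tendsto_execProb_gateRule gs hL⟩

end SpAKLT

theorem proposition6 (m n : ℕ) (hn : n = 2 ^ m) :
    -- the AKLT state is a matrix product state
    (∀ (N : ℕ) (s : Fin N → Matrix (Qubits m ⊕ Qubits m) (Qubits m ⊕ Qubits m) ℂ),
      (∀ k, s k ∈ onSite (Qubits m)) → ∀ L : Qubits m ⊕ Qubits m → ℂ,
        contract s (aklt N L) = (List.ofFn fun k => krausOp (s k)).reverse.prod *ᵥ L) ∧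
    -- with virtual dimension `2n`, on-site dimension `n(2n+1)`,
    -- and the adjoint representation on every site
    Fintype.card (Qubits m ⊕ Qubits m) = 2 * n ∧
    Module.finrank ℂ (onSite (Qubits m)) = n * (2 * n + 1) ∧
    Set.BijOn krausOp (onSite (Qubits m) : Set (Matrix (Qubits m ⊕ Qubits m) (Qubits m ⊕ Qubits m) ℂ))
      (LieAlgebra.Symplectic.sp (Qubits m) ℂ :
        Set (Matrix (Qubits m ⊕ Qubits m) (Qubits m ⊕ Qubits m) ℂ)) ∧
    (∀ g ∈ CSp (Qubits m), ∀ s ∈ onSite (Qubits m),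
      siteSym g s ∈ onSite (Qubits m) ∧ krausOp (siteSym g s) = g * krausOp s * gᴴ) ∧
    -- the generators can be chosen as tensor products of Pauli matrices
    Submodule.span ℝ (pauliString '' (xStrings m : Set (Fin m → Fin 4))) =
      Submodule.span ℝ {A | ∃ i j : Fin (2 ^ m), i < j ∧ A = toQubits (gellMannX i j)} ∧
    Submodule.span ℝ (pauliString '' (yStrings m : Set (Fin m → Fin 4))) =
      Submodule.span ℝ {A | ∃ i j : Fin (2 ^ m), i < j ∧ A = toQubits (gellMannY i j)} ∧
    Submodule.span ℝ (pauliString '' (zStrings m : Set (Fin m → Fin 4))) =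
      Submodule.span ℝ {A | ∃ j : Fin (2 ^ m), 0 < (j : ℕ) ∧ A = toQubits (gellMannZ j)} ∧
    Fintype.card (Gen m) = n * (2 * n + 1) ∧
    (∀ a : Gen m, siteVec a ∈ onSite (Qubits m) ∧ krausOp (siteVec a) = (2 * n : ℂ)⁻¹ • gen a) ∧
    (∀ a b : Gen m, ((siteVec a)ᴴ * siteVec b).trace = if a = b then 1 else 0) ∧
    Submodule.span ℂ (Set.range (siteVec (m := m))) = onSite (Qubits m) ∧
    -- the symmetry condition
    (∀ g ∈ CSp (Qubits m), adjMatrix g ∈ Matrix.unitaryGroup (Gen m) ℂ ∧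
      ∀ a : Gen m, rotVec g a = ∑ b, starRingEnd ℂ (adjMatrix g a b) • siteVec b ∧
        ∑ b, adjMatrix g a b • gen b = gᴴ * gen a * g) ∧
    -- the numbers of commuting pairs of Pauli strings
    (∀ p ∈ xStrings m,
      4 * {q | q ∈ xStrings m ∧ Commute (pauliString p) (pauliString q)}.ncard = n ^ 2 ∧
      4 * {q | q ∈ yStrings m ∧ Commute (pauliString p) (pauliString q)}.ncard + 2 * n = n ^ 2 ∧
      2 * {q | q ∈ zStrings m ∧ Commute (pauliString p) (pauliString q)}.ncard + 2 = n) ∧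
    (∀ p ∈ yStrings m,
      4 * {q | q ∈ yStrings m ∧ Commute (pauliString p) (pauliString q)}.ncard = n ^ 2 ∧
      4 * {q | q ∈ xStrings m ∧ Commute (pauliString p) (pauliString q)}.ncard + 2 * n = n ^ 2 ∧
      2 * {q | q ∈ zStrings m ∧ Commute (pauliString p) (pauliString q)}.ncard + 2 = n) ∧
    (∀ p ∈ zStrings m,
      4 * {q | q ∈ xStrings m ∧ Commute (pauliString p) (pauliString q)}.ncard + 2 * n = n ^ 2 ∧
      4 * {q | q ∈ yStrings m ∧ Commute (pauliString p) (pauliString q)}.ncard + 2 * n = n ^ 2) ∧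
    -- all outcomes are equally likely
    (∀ (π : Rule m), π.IsSymmetric → ∀ (N : ℕ) (L : Qubits m ⊕ Qubits m → ℂ), L ≠ 0 →
      ∀ i : Fin N → Gen m, π.prob L i = ((n * (2 * n + 1) : ℝ)⁻¹) ^ N) ∧
    -- one measurement executes the gate, or the identity, up to the byproduct of the outcome;
    -- the gate succeeds exactly for the byproducts that anticommute with its generator
    (∀ (a : Gen m) (θ : ℝ), Real.sin θ ≠ 0 → ∀ b : Gen m,
      (b ∈ successes a θ ↔ gen a * gen b = -(gen b * gen a)) ∧
      (b ∉ successes a θ →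
        krausOp (rotVec (expGate a (θ / 2)) b) = (2 * n : ℂ)⁻¹ • gen b)) ∧
    -- its probability of success, given any earlier outcomes `h`
    (∀ (π : Rule m), π.IsSymmetric → ∀ (N : ℕ) (h : Fin N → Gen m) (a : Gen m) (θ : ℝ),
      π (List.ofFn h) = expGate a (θ / 2) → Real.sin θ ≠ 0 →
      ∀ L : Qubits m ⊕ Qubits m → ℂ, L ≠ 0 →
        ∑ b : Gen m, Set.indicator (successes a θ)
            (fun b => π.prob L (Fin.snoc h b : Fin (N + 1) → Gen m)) b =
          ((n + 1 : ℝ) / (2 * n + 1)) * π.prob L h) ∧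
    -- the gates form `Sp(2n)` (gates that differ by a phase being the same)
    Submonoid.closure {W | ∃ (a : Gen m) (θ : ℝ), W = expGate a θ} = CSp (Qubits m) ∧
    (∀ V ∈ CSp (Qubits m), ∃ π : Rule m, π.IsElementary ∧
      ∀ L : Qubits m ⊕ Qubits m → ℂ, L ≠ 0 →
        Tendsto (fun N => π.execProb L N V) atTop (𝓝 1)) ∧
    (∀ (π : Rule m), π.IsSymmetric → ∀ (N : ℕ) (i : Fin N → Gen m),
      ∀ V ∈ Matrix.unitaryGroup (Qubits m ⊕ Qubits m) ℂ, π.Executes i V →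
        ∃ z : ℂ, ‖z‖ = 1 ∧ z • V ∈ CSp (Qubits m)) := by
  subst hn
  have hdim : ((2 : ℂ) * ((2 ^ m : ℕ) : ℂ))⁻¹ = (2 ^ (m + 1) : ℂ)⁻¹ := by
    push_cast
    ring
  refine ⟨fun N s hs L => contract_aklt s hs L, card_virtual, finrank_onSite, bijOn_krausOp,
    fun g hg s hs => ⟨siteSym_mem_onSite g hs, krausOp_siteSym hg s⟩,
    span_xStrings.trans span_toQubits_gellMannX.symm,
    span_yStrings.trans span_toQubits_gellMannY.symm,
    span_zStrings.trans span_toQubits_gellMannZ.symm, card_gen,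
    fun a => ⟨siteVec_mem a, by rw [krausOp_siteVec, hdim]⟩, trace_siteVec, span_siteVec,
    fun g hg => ⟨adjMatrix_mem_unitaryGroup hg, fun a =>
      ⟨rotVec_eq_sum hg a, sum_adjMatrix_smul_gen hg a⟩⟩,
    fun p hp => ncard_commute_of_mem_xStrings hp, fun p hp => ncard_commute_of_mem_yStrings hp,
    fun p hp => ncard_commute_of_mem_zStrings hp, ?_, ?_, ?_, gateClosure_eq,
    fun V hV => exists_elementary_rule hV,
    fun π hπ N i V hV h => exists_phase_of_executes hπ i hV h⟩
  · intro π hπ N L hL i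
    rw [prob_eq hπ hL]
    push_cast
    rfl
  · intro a θ hθ b
    rw [mem_successes hθ, gen_anticommute_iff]
    exact ⟨Iff.rfl, fun hb => by rw [krausOp_rotVec_expGate, if_neg hb, hdim]⟩
  · intro π hπ N h a θ _ hθ L hL
    rw [sum_prob_successes hπ h a hθ hL]
    push_cast
    rfl
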